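/- Let $k,l\ge 0$ and $n=k+l$. **Partitions.** Let $\Omega$ be the set of partitions $\lambda=(\lambda_1\ge\lambda_2\ge\cdots)$ and $\Omega_{k,l}\subset\Omega$ the set of those with $\lambda_{k+1}=0$ and $\lambda_i\le l$ for all $i$. For $\lambda\in\Omega$ let $\phi_\lambda:\mathbb Z+\frac12\to\{\pm1\}$ be $-1$ on $\{\lambda_i-i+\frac12\mid i\ge1\}$ and $+1$ elsewhere. A *$\lambda$-pair* is a pair $(\alpha,\beta)$ with $\phi_\lambda(\alpha)=-1$, $\phi_\lambda(\beta)=+1$ such that $\beta$ is the smallest number greater than $\alpha$ with $\sum_{\alpha\le\gamma\le\beta}\phi_\lambda(\gamma)=0$. Write $\lambda\to\mu$ if for some $\lambda$-pair $(\alpha,\beta)$ one has $\phi_\mu(\alpha)=+1$, $\phi_\mu(\beta)=-1$ and $\phi_\mu=\phi_\lambda$ elsewhere, and write $\lambda\leftrightarrow\mu$ if $\lambda\to\mu$ or $\mu\to\lambda$. A *diamond* is a 4-tuple of distinct elements of $\Omega$ that are cyclically related by $\leftrightarrow$. **Orbits.** Let $X$ be the Grassmannian of $k$-dimensional subspaces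 of $\mathbb C^n$ and $B\subset SL(n,\mathbb C)$ the group of upper triangular matrices. For $\lambda\in\Omega_{k,l}$ put $I_\lambda=\{\lambda_{k-j+1}+j\mid 1\le j\le k\}$, let $W_\lambda$ be the span of the standard basis vectors $\mathbf e_i$, $i\in I_\lambda$, and let $X_\lambda=\{V\mid \dim(V\cap\mathbb C^m)=\#\{i\in I_\lambda\mid i\le m\},\ 0\le m\le n\}$ be the Schubert cell containing $W_\lambda$. Fix $\lambda\in\Omega_{k,l}$ and put $W=W_\lambda$. Let $M_\lambda\subset T^*_WX=\mathrm{Hom}(\mathbb C^n/W,W)$ be the fibre at $W$ of the conormal bundle of $X_\lambda$; the stabilizer $B_\lambda$ of $W$ in $B$ acts on it. The dual space $M_\lambda^*$, with the dual action, is identified with the subspace of $\mathrm{Hom}(W,\mathbb C^n/W)$ spanned by the elementary maps $\mathbf e_i\mapsto\mathbf e_j$ with $i\in I_\lambda$, $j\notin I_\lambda$, $i<j$. Identifying $\mathbb C^n/W$ with the span of the $\mathbf e_j$, $j\notin I_\lambda$, let $\epsilon:M_\lambda^*\to X$ send a map to its graph. Call a $B_\lambda$-orbit $O\subset M_\lambda$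 *dual* to a $B_\lambda$-orbit $Q\subset M_\lambda^*$ if $\overline O$ is the dual cone of $\overline Q$, i.e. the closure of $\bigcup_{\xi\in Q}(T_\xi Q)^\perp$. For $\lambda'>\lambda$ in $\Omega_{k,l}$ let $O_\lambda^{\lambda'}\subset M_\lambda$ be the orbit dual to the open $B_\lambda$-orbit in $\epsilon^{-1}(X_{\lambda'})$. **Proposition.** The map $\lambda'\mapsto O_\lambda^{\lambda'}$ is a well-defined bijection from the set of those $\lambda'\in\Omega_{k,l}$ for which there is a diamond $(\lambda\to\lambda_1\leftrightarrow\lambda'\leftrightarrow\lambda_2\leftarrow\lambda)$ in $\Omega$ with at least one of $\lambda_1,\lambda_2$ in $\Omega_{k,l}$, onto the set of $B_\lambda$-orbits of codimension two in $M_\lambda$. For each such $\lambda'$ the diamond is unique up to exchanging $\lambda_1$ and $\lambda_2$, and the orbits $O_\lambda^{\lambda_m}$, for those $m\in\{1,2\}$ with $\lambda_m\in\Omega_{k,l}$, are well defined and are exactly the $B_\lambda$-orbits of codimension one in $M_\lambda$ whose closures contain $O_\lambda^{\lambda'}$. -/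

import Mathlib

namespace GrassConormal

/-! ### Partitions, sign sequences and diamonds

A partition `λ` is a Young diagram; its parts are `λ.rowLen 0 ≥ λ.rowLen 1 ≥ ⋯` (rows are numbered
from `0`).  The integer `a` stands for the half-integer `a + 1/2`. -/

/-- Partitions whose diagram fits in a rectangle with `k` rows and `l` columns. -/
def Omega (k l : ℕ) : Set YoungDiagram :=
  {lam | lam.rowLen k = 0 ∧ ∀ i, lam.rowLen i ≤ l}

open Classical in
/-- The sign function of a partition: it is `-1` at the half-integers `λ_i - i + 1/2` (`i ≥ 1`) and
`+1` elsewhere.  The row with index `i` here is the `(i+1)`-st row. -/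
noncomputable def phi (lam : YoungDiagram) (a : ℤ) : ℤ :=
  if ∃ i : ℕ, a = (lam.rowLen i : ℤ) - ((i : ℤ) + 1) then -1 else 1

/-- `(a, b)` is a `λ`-pair. -/
def IsPair (lam : YoungDiagram) (a b : ℤ) : Prop :=
  phi lam a = -1 ∧ phi lam b = 1 ∧
    IsLeast {c : ℤ | a < c ∧ ∑ d ∈ Finset.Icc a c, phi lam d = 0} b

/-- `λ → μ`: the sign function of `μ` is obtained from that of `λ` by exchanging the signs at the
two ends of some `λ`-pair. -/
def Arrow (lam mu : YoungDiagram) : Prop :=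
  ∃ a b : ℤ, IsPair lam a b ∧ phi mu a = 1 ∧ phi mu b = -1 ∧
    ∀ c : ℤ, c ≠ a → c ≠ b → phi mu c = phi lam c

/-- `λ ↔ μ`. -/
def Linked (lam mu : YoungDiagram) : Prop :=
  Arrow lam mu ∨ Arrow mu lam

/-- A diamond: four distinct partitions linked cyclically. -/
def IsDiamond (a b c d : YoungDiagram) : Prop :=
  [a, b, c, d].Nodup ∧ Linked a b ∧ Linked b c ∧ Linked c d ∧ Linked d a

/-- A diamond `λ → λ₁ ↔ λ' ↔ λ₂ ← λ`. -/
def IsUpDiamond (lam lam1 lam' lam2 : YoungDiagram) : Prop :=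
  IsDiamond lam lam1 lam' lam2 ∧ Arrow lam lam1 ∧ Arrow lam lam2

/-- The `λ' ∈ Ω_{k,l}` for which there is a diamond `λ → λ₁ ↔ λ' ↔ λ₂ ← λ` of partitions with at
least one of `λ₁, λ₂` in `Ω_{k,l}`. -/
def diamondTops (k l : ℕ) (lam : YoungDiagram) : Set YoungDiagram :=
  {lam' | lam' ∈ Omega k l ∧ ∃ lam1 lam2, IsUpDiamond lam lam1 lam' lam2 ∧
    (lam1 ∈ Omega k l ∨ lam2 ∈ Omega k l)}

/-! ### The Grassmannian and its Schubert cells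

`ℂⁿ`, `n = k + l`, is `Fin (k + l) → ℂ`, with basis vectors numbered from `0`. -/

/-- The indices of the basis vectors spanning the torus-fixed point of the Schubert cell of `λ`.
The index `p` (the `(p+1)`-st basis vector) corresponds to the half-integer `p - k + 1/2`. -/
def fixedIdx (k l : ℕ) (lam : YoungDiagram) : Set (Fin (k + l)) :=
  {p | phi lam (((p : ℕ) : ℤ) - (k : ℤ)) = -1}

/-- The torus-fixed point `W_λ` of the Schubert cell `X_λ`. -/
noncomputable def fixedPt (k l : ℕ) (lam : YoungDiagram) : Submodule ℂ (Fin (k + l) → ℂ) :=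
  Submodule.span ℂ ((fun p : Fin (k + l) => Pi.single p (1 : ℂ)) '' fixedIdx k l lam)

/-- The member `ℂ^m` of the standard flag. -/
noncomputable def stdFlag (n m : ℕ) : Submodule ℂ (Fin n → ℂ) :=
  Submodule.span ℂ ((fun p : Fin n => Pi.single p (1 : ℂ)) '' {p | (p : ℕ) < m})

/-- The Schubert cell `X_λ`: the subspaces of `ℂⁿ` in the same position as `W_λ` with respect to
all the members of the standard flag. -/
def schubertCell (k l : ℕ) (lam : YoungDiagram) : Set (Submodule ℂ (Fin (k + l) → ℂ)) :=
  {V | ∀ m : ℕ, m ≤ k + l → Module.finrank ℂ ↥(V ⊓ stdFlag (k + l) m) =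
    {p : Fin (k + l) | p ∈ fixedIdx k l lam ∧ (p : ℕ) < m}.ncard}

/-! ### The conormal space `M_λ`, its dual, and the orbits of `B_λ` on them -/

/-- The stabilizer `B_λ` of `W_λ` in the group `B` of upper triangular matrices in `SL(n, ℂ)`. -/
def borelStab (k l : ℕ) (lam : YoungDiagram) : Set (Matrix.SpecialLinearGroup (Fin (k + l)) ℂ) :=
  {g | (g : Matrix (Fin (k + l)) (Fin (k + l)) ℂ).BlockTriangular id ∧
    (fixedPt k l lam).map
      (Matrix.toLin' (g : Matrix (Fin (k + l)) (Fin (k + l)) ℂ)) = fixedPt k l lam}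

/-- `M_λ`, the fibre over `W = W_λ` of the conormal bundle of `X_λ` in the Grassmannian.
A cotangent vector at `W` is an element of `Hom(ℂⁿ/W, W)`, written as the endomorphism
`ℂⁿ → ℂⁿ/W → W ⊆ ℂⁿ`; it pairs with the tangent vector `W → ℂⁿ → ℂⁿ/W` given by `b ∈ 𝔰𝔩_n` to
`tr (A b)`.  The tangent space of `X_λ` at `W` consists of the tangent vectors given by the traceless
upper triangular `b`. -/
def conormal (k l : ℕ) (lam : YoungDiagram) :
    Submodule ℂ (Matrix (Fin (k + l)) (Fin (k + l)) ℂ) where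
  carrier := {A | (∀ v ∈ fixedPt k l lam, A.mulVec v = 0) ∧
    (∀ v, A.mulVec v ∈ fixedPt k l lam) ∧
    ∀ b : Matrix (Fin (k + l)) (Fin (k + l)) ℂ, b.BlockTriangular id → b.trace = 0 →
      (A * b).trace = 0}
  add_mem' := by
    rintro A A' ⟨h1, h2, h3⟩ ⟨h1', h2', h3'⟩
    refine ⟨fun v hv => ?_, fun v => ?_, fun b hb ht => ?_⟩
    · rw [Matrix.add_mulVec, h1 v hv, h1' v hv, add_zero]
    · rw [Matrix.add_mulVec]
      exact Submodule.add_mem _ (h2 v) (h2' v)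
    · rw [Matrix.add_mul, Matrix.trace_add, h3 b hb ht, h3' b hb ht, add_zero]
  zero_mem' := by
    refine ⟨fun v _ => ?_, fun v => ?_, fun b _ _ => ?_⟩ <;> simp
  smul_mem' := by
    rintro c A ⟨h1, h2, h3⟩
    refine ⟨fun v hv => ?_, fun v => ?_, fun b hb ht => ?_⟩
    · rw [Matrix.smul_mulVec, h1 v hv, smul_zero]
    · rw [Matrix.smul_mulVec]
      exact Submodule.smul_mem _ c (h2 v)
    · rw [Matrix.smul_mul, Matrix.trace_smul, h3 b hb ht, smul_zero]

/-- The dual space `M_λ^*`, placed in `Hom(W, ℂⁿ/W)` (where `ℂⁿ/W` is identified with the span of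
the remaining basis vectors) as the span of the elementary matrices dual to those spanning `M_λ`.
The pairing of `A ∈ M_λ` and `ξ ∈ M_λ^*` is `tr (A ξ)`. -/
def conormalDual (k l : ℕ) (lam : YoungDiagram) :
    Set (Matrix (Fin (k + l)) (Fin (k + l)) ℂ) :=
  {ξ | ∀ p q, ξ p q ≠ 0 → q ∈ fixedIdx k l lam ∧ p ∉ fixedIdx k l lam ∧ q < p}

/-- `O` is an orbit of `B_λ` in `M_λ`; the action `g · A = g|_W ∘ A ∘ (g|_{ℂⁿ/W})⁻¹` is conjugation
of the endomorphism of `ℂⁿ` that represents `A`. -/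
def IsOrbit (k l : ℕ) (lam : YoungDiagram)
    (O : Set (Matrix (Fin (k + l)) (Fin (k + l)) ℂ)) : Prop :=
  ∃ A ∈ conormal k l lam, O = {A' | ∃ g ∈ borelStab k l lam,
    A' = (g : Matrix (Fin (k + l)) (Fin (k + l)) ℂ) * A *
      ((g⁻¹ : Matrix.SpecialLinearGroup (Fin (k + l)) ℂ) : Matrix (Fin (k + l)) (Fin (k + l)) ℂ)}

/-- `Q` is an orbit in `M_λ^*` of the dual action of `B_λ`, `⟨A, g · ξ⟩ = ⟨g⁻¹ · A, ξ⟩`. -/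
def IsDualSpaceOrbit (k l : ℕ) (lam : YoungDiagram)
    (Q : Set (Matrix (Fin (k + l)) (Fin (k + l)) ℂ)) : Prop :=
  ∃ ξ ∈ conormalDual k l lam, Q = {ξ' | ξ' ∈ conormalDual k l lam ∧
    ∃ g ∈ borelStab k l lam, ∀ A ∈ conormal k l lam,
      (A * ξ').trace =
        (((g⁻¹ : Matrix.SpecialLinearGroup (Fin (k + l)) ℂ) : Matrix (Fin (k + l)) (Fin (k + l)) ℂ) * A *
          (g : Matrix (Fin (k + l)) (Fin (k + l)) ℂ) * ξ).trace}

/-- The tangent space at `x` of a complex submanifold `S` of a space of matrices, as the linear span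
of the limits of `c_i (x_i - x)` with `c_i ∈ ℂ`, `x_i ∈ S`, `x_i → x`. -/
noncomputable def tangentSpace {n : ℕ} (S : Set (Matrix (Fin n) (Fin n) ℂ))
    (x : Matrix (Fin n) (Fin n) ℂ) : Submodule ℂ (Matrix (Fin n) (Fin n) ℂ) :=
  Submodule.span ℂ (tangentConeAt ℂ S x)

/-- `O` is an orbit of `B_λ` in `M_λ` of complex codimension `c`. -/
def IsCodimOrbit (k l : ℕ) (lam : YoungDiagram) (c : ℕ)
    (O : Set (Matrix (Fin (k + l)) (Fin (k + l)) ℂ)) : Prop :=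
  IsOrbit k l lam O ∧ ∀ x ∈ O,
    Module.finrank ℂ (tangentSpace O x) + c = Module.finrank ℂ (conormal k l lam)

/-- The inverse image of `X_μ` under `ε : M_λ^* → X`, where `ε(ξ) = {w + ξ w | w ∈ W_λ}` is the graph
of `ξ`. -/
def slice (k l : ℕ) (lam mu : YoungDiagram) : Set (Matrix (Fin (k + l)) (Fin (k + l)) ℂ) :=
  {ξ | ξ ∈ conormalDual k l lam ∧
    (fixedPt k l lam).map (Matrix.toLin' (1 + ξ)) ∈ schubertCell k l mu}

/-- `Q` is a `B_λ`-orbit in `M_λ^*` which is contained in `ε⁻¹(X_μ)` and open in it. -/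
def IsOpenOrbit (k l : ℕ) (lam mu : YoungDiagram)
    (Q : Set (Matrix (Fin (k + l)) (Fin (k + l)) ℂ)) : Prop :=
  IsDualSpaceOrbit k l lam Q ∧
    ∃ U : Set (Matrix (Fin (k + l)) (Fin (k + l)) ℂ), IsOpen U ∧ Q = U ∩ slice k l lam mu

/-- The dual cone in `M_λ` of the closure of a `B_λ`-orbit `Q` in `M_λ^*`: the closure of the set of
all `x` that annihilate a tangent space of `Q` (which is smooth, and open and dense in its
closure). -/
def dualCone (k l : ℕ) (lam : YoungDiagram)
    (Q : Set (Matrix (Fin (k + l)) (Fin (k + l)) ℂ)) :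
    Set (Matrix (Fin (k + l)) (Fin (k + l)) ℂ) :=
  closure {x | x ∈ conormal k l lam ∧ ∃ ξ ∈ Q, ∀ v ∈ tangentSpace Q ξ, (x * v).trace = 0}

/-- `O = O_λ^μ`: the orbit `O` of `M_λ` is dual to the open orbit of `ε⁻¹(X_μ)`, i.e. the closure of
`O` is the dual cone of the closure of that orbit. -/
def IsAttached (k l : ℕ) (lam mu : YoungDiagram)
    (O : Set (Matrix (Fin (k + l)) (Fin (k + l)) ℂ)) : Prop :=
  IsOrbit k l lam O ∧ ∃ Q, IsOpenOrbit k l lam mu Q ∧ closure O = dualCone k l lam Q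

end GrassConormal

namespace GrassConormal

/-! ### Sign functions and partitions -/

/-! Write `I` for the index set of `W_λ`. Conormal vectors are the matrices supported at the
positions (p, q) with p ∈ I, q ∉ I, p < q, and the stabilizer acts through its block diagonal part,
that is, by independent upward row operations and rightward column operations. Elimination turns
each vector into a rook matrix. The ranks of the lower left regions (rows ≥ i, columns < j) are
invariants and recover the placement (`rook_eq_of_count`). The tangent space of the orbit at a rook
matrix is spanned by the coordinates weakly above or weakly to the right of a rook
(`IsRook.tangentSpace_orb`), so the codimension is the number of uncovered positions; these also
determine the placement (`rook_eq_of_uncov`).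

The dual space is treated in the same way. The conormal space there at the rook matrix of `u`
consists of the vectors vanishing weakly to the left of and weakly below the rooks of `u`
(`IsRook.annihilator_iff`). Its dense orbit is that of the placement which leaves these positions
uncovered and is the only such placement with counts at least its own
(`IsRook.clearAt_subset_closure`). The slice over X_μ consists of the placements with row set I_λ ∖
I_μ and column set I_μ ∖ I_λ (`IsRook.mem_slice_iff`). In the cases that matter there are one or two
rooks, and the noncrossing choice gives the unique open orbit.

The combinatorial side rests on the λ-pairs, which form a noncrossing perfect matching `s` of the
integers in which every pair has a parent. Placements are written as p ↦ s (π p) for a permutation π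
of the left ends. With π = 1 nothing is uncovered. Exchanging `a` with its parent uncovers exactly
(a, s a). Two exchanges uncover two positions: (a, s a) and (b, s b) if neither pair is the parent
of the other; if `a` is the parent of `b`, the two orders of composition give two placements, which
uncover (b, s b) together with (a, s b) or with (b, s a). By `MatchingOn.classify_two` no other sets
of two uncovered positions occur. Diamonds obey the same trichotomy (`IsUpDiamond.exists_isTop`): λ'
is obtained by flipping both pairs, or, for a parent and a child, by one of the two mixed flips.
Comparing the two lists gives the bijection and the uniqueness of the diamond.

For the closure relation, the placement of a diamond fills the interval of every pair in the range
other than its own two pairs, so ranks exclude all codimension one orbits but those of `a` and `b`.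
For these two, either the orbit lies in an explicit linear space contained in the closure, or a
one-parameter degeneration by one elementary operation reaches it. -/

theorem phi_eq_neg_one_iff {lam : YoungDiagram} {a : ℤ} :
    phi lam a = -1 ↔ ∃ i : ℕ, a = (lam.rowLen i : ℤ) - ((i : ℤ) + 1) := by
  unfold phi
  split_ifs with h
  · simp [h]
  · simp [h]

theorem phi_eq_one_iff {lam : YoungDiagram} {a : ℤ} : phi lam a = 1 ↔ phi lam a ≠ -1 := by
  unfold phi
  split_ifs <;> simp

theorem phi_eq_or (lam : YoungDiagram) (a : ℤ) : phi lam a = 1 ∨ phi lam a = -1 := by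
  unfold phi
  split_ifs <;> simp

theorem rowLen_injective : Function.Injective YoungDiagram.rowLen := by
  intro lam mu h
  ext ⟨i, j⟩
  rw [YoungDiagram.mem_cells, YoungDiagram.mem_cells, YoungDiagram.mem_iff_lt_rowLen,
    YoungDiagram.mem_iff_lt_rowLen, h]

theorem bead_strictMono (lam : YoungDiagram) :
    StrictMono fun i : ℕ => ((i : ℤ) + 1) - (lam.rowLen i : ℤ) := by
  intro i j hij
  have := lam.rowLen_anti i j hij.le
  simp only
  omega

/-- The positions of the signs `-1`, negated, form a strictly increasing sequence, and such a
sequence is recovered from its range. -/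
theorem phi_injective : Function.Injective phi := by
  intro lam mu h
  apply rowLen_injective
  have hr : Set.range (fun i : ℕ => ((i : ℤ) + 1) - (lam.rowLen i : ℤ)) =
      Set.range fun i : ℕ => ((i : ℤ) + 1) - (mu.rowLen i : ℤ) := by
    ext a
    have h1 : phi lam (-a) = -1 ↔ phi mu (-a) = -1 := by rw [h]
    rw [phi_eq_neg_one_iff, phi_eq_neg_one_iff] at h1
    constructor
    · rintro ⟨i, rfl⟩
      obtain ⟨j, hj⟩ := h1.1 ⟨i, by ring⟩
      exact ⟨j, by simp only; linarith⟩
    · rintro ⟨i, rfl⟩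
      obtain ⟨j, hj⟩ := h1.2 ⟨i, by ring⟩
      exact ⟨j, by simp only; linarith⟩
  have := ((bead_strictMono lam).range_inj (bead_strictMono mu)).1 hr
  funext i
  have := congrFun this i
  omega

/-- Rows beyond the k-th are empty exactly when the sequence of signs is constant to the left of
`-k`, and the first row bounds the last sign `-1`. This replaces row lengths by range conditions on
positions. -/
theorem mem_Omega_iff {k l : ℕ} {lam : YoungDiagram} :
    lam ∈ Omega k l ↔ (∀ a : ℤ, a < -k → phi lam a = -1) ∧ ∀ a : ℤ, l ≤ a → phi lam a = 1 := by
  constructor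
  · rintro ⟨h1, h2⟩
    refine ⟨fun a ha => ?_, fun a ha => ?_⟩
    · rw [phi_eq_neg_one_iff]
      refine ⟨(-a - 1).toNat, ?_⟩
      have := lam.rowLen_anti k (-a - 1).toNat (by omega)
      omega
    · rw [phi_eq_one_iff, Ne, phi_eq_neg_one_iff]
      rintro ⟨i, hi⟩
      have := h2 i
      omega
  · rintro ⟨h1, h2⟩
    have hz : ∃ N, k ≤ N ∧ lam.rowLen N = 0 := by
      refine ⟨max k (lam.colLen 0), le_max_left _ _, ?_⟩
      by_contra hne
      have : (max k (lam.colLen 0), 0) ∈ lam :=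
        YoungDiagram.mem_iff_lt_rowLen.2 (Nat.pos_of_ne_zero hne)
      rw [YoungDiagram.mem_iff_lt_colLen] at this
      omega
    constructor
    · obtain ⟨N, hkN, hN⟩ := hz
      induction N, hkN using Nat.le_induction with
      | base => exact hN
      | succ m hm ih =>
        -- Descent from an empty row: the sign `-1` at `-(m + 1)` belongs to some row, and only row
        -- `m`, with length zero, can produce it once row `m + 1` is empty.
        apply ih
        obtain ⟨i, hi⟩ := phi_eq_neg_one_iff.1 (h1 (-(m + 1)) (by omega))
        rcases Nat.lt_or_ge m i with him | him
        · have := lam.rowLen_anti (m + 1) i him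
          omega
        · have := lam.rowLen_anti i m him
          omega
    · intro i
      by_contra hi
      have h3 := lam.rowLen_anti 0 i (Nat.zero_le _)
      have := h2 ((lam.rowLen 0 : ℤ) - 1) (by omega)
      rw [phi_eq_one_iff, Ne, phi_eq_neg_one_iff] at this
      exact this ⟨0, by push_cast; ring⟩

/-- `μ` has the sign function of `λ` with the signs `-1` at `a` and `+1` at `b` exchanged. -/
def IsFlip (lam mu : YoungDiagram) (a b : ℤ) : Prop :=
  phi mu a = 1 ∧ phi mu b = -1 ∧ ∀ c : ℤ, c ≠ a → c ≠ b → phi mu c = phi lam c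

theorem IsFlip.unique {lam mu mu' : YoungDiagram} {a b : ℤ} (h : IsFlip lam mu a b)
    (h' : IsFlip lam mu' a b) : mu = mu' := by
  apply phi_injective
  funext c
  by_cases hca : c = a
  · rw [hca, h.1, h'.1]
  by_cases hcb : c = b
  · rw [hcb, h.2.1, h'.2.1]
  rw [h.2.2 c hca hcb, h'.2.2 c hca hcb]

/-- Moving a sign `-1` one place to the right adds a cell to its row. The sign `+1` next to it says
that the row above is strictly longer, so the result is again a diagram. -/
theorem exists_isFlip_succ (lam : YoungDiagram) (a : ℤ) (ha : phi lam a = -1)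
    (hb : phi lam (a + 1) = 1) : ∃ mu, IsFlip lam mu a (a + 1) := by
  obtain ⟨i, hi⟩ := phi_eq_neg_one_iff.1 ha
  have hb' : ∀ j : ℕ, a + 1 ≠ (lam.rowLen j : ℤ) - ((j : ℤ) + 1) := by
    intro j hj
    rw [phi_eq_one_iff, Ne, phi_eq_neg_one_iff] at hb
    exact hb ⟨j, hj⟩
  have hrow : ∀ j, j < i → lam.rowLen i < lam.rowLen j := by
    intro j hj
    have h1 := lam.rowLen_anti j (i - 1) (by omega)
    have h2 := lam.rowLen_anti (i - 1) i (by omega)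
    have h3 := hb' (i - 1)
    have h4 : ((i - 1 : ℕ) : ℤ) = (i : ℤ) - 1 := by omega
    omega
  let mu : YoungDiagram :=
    { cells := insert (i, lam.rowLen i) lam.cells
      isLowerSet := by
        rintro ⟨p, q⟩ ⟨p', q'⟩ hle hmem
        simp only [Prod.mk_le_mk] at hle
        simp only [Finset.coe_insert, Set.mem_insert_iff, Prod.mk.injEq, Finset.mem_coe,
          YoungDiagram.mem_cells, YoungDiagram.mem_iff_lt_rowLen] at hmem ⊢
        rcases hmem with ⟨rfl, rfl⟩ | hmem
        · rcases hle.1.lt_or_eq with h | rfl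
          · have := hrow p' h
            omega
          · omega
        · have := lam.rowLen_anti p' p hle.1
          omega }
  have hmu : ∀ j, mu.rowLen j = if j = i then lam.rowLen i + 1 else lam.rowLen j := by
    intro j
    apply eq_of_forall_lt_iff
    intro q
    rw [← YoungDiagram.mem_iff_lt_rowLen, ← YoungDiagram.mem_cells]
    simp only [mu, Finset.mem_insert, Prod.mk.injEq, YoungDiagram.mem_cells,
      YoungDiagram.mem_iff_lt_rowLen]
    split_ifs with h
    · subst h
      omega
    · simp [h]
  have hbead : ∀ j, j ≠ i → a ≠ (lam.rowLen j : ℤ) - ((j : ℤ) + 1) := by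
    intro j hj h
    have := (bead_strictMono lam).injective (a₁ := i) (a₂ := j) (by omega)
    omega
  refine ⟨mu, ?_, ?_, ?_⟩
  · rw [phi_eq_one_iff, Ne, phi_eq_neg_one_iff]
    rintro ⟨j, hj⟩
    rw [hmu] at hj
    split_ifs at hj with h
    · subst h
      push_cast at hj
      omega
    · exact hbead j h hj
  · rw [phi_eq_neg_one_iff]
    refine ⟨i, ?_⟩
    rw [hmu, if_pos rfl]
    push_cast
    omega
  · intro c hca hcb
    have : phi mu c = -1 ↔ phi lam c = -1 := by
      rw [phi_eq_neg_one_iff, phi_eq_neg_one_iff]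
      constructor
      · rintro ⟨j, hj⟩
        rw [hmu] at hj
        split_ifs at hj with h
        · subst h
          push_cast at hj
          omega
        · exact ⟨j, hj⟩
      · rintro ⟨j, hj⟩
        refine ⟨j, ?_⟩
        rw [hmu, if_neg]
        · exact hj
        · rintro rfl
          omega
    rcases phi_eq_or mu c with h | h
    · rw [h, eq_comm, phi_eq_one_iff, Ne, ← this, ← Ne, ← phi_eq_one_iff, h]
    · rw [h, eq_comm, ← this, h]

/-- A long flip is a composite of neighbouring ones. If the sign after `a` is `+1`, the sign at `a`
is moved first; otherwise the sign at `a + 1` travels to `b` and is then replaced by the one at `a`.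
-/
theorem exists_isFlip (lam : YoungDiagram) (a b : ℤ) (hab : a < b) (ha : phi lam a = -1)
    (hb : phi lam b = 1) : ∃ mu, IsFlip lam mu a b := by
  obtain ⟨d, rfl⟩ : ∃ d : ℕ, b = a + 1 + d := ⟨(b - a - 1).toNat, by omega⟩
  induction d generalizing a lam with
  | zero =>
    simp only [Nat.cast_zero, add_zero] at hb ⊢
    exact exists_isFlip_succ lam a ha hb
  | succ d ih =>
    have e : a + 1 + ((d + 1 : ℕ) : ℤ) = a + 1 + 1 + d := by push_cast; ring
    rw [e] at hb ⊢
    rcases phi_eq_or lam (a + 1) with h | h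
    · obtain ⟨mu, h1, h2, h3⟩ := exists_isFlip_succ lam a ha h
      obtain ⟨nu, g1, g2, g3⟩ := ih mu (a + 1) h2 (by omega)
        (by rw [h3 _ (by omega) (by omega)]; exact hb)
      refine ⟨nu, ?_, g2, fun c hca hcb => ?_⟩
      · rw [g3 _ (by omega) (by omega), h1]
      · by_cases hc : c = a + 1
        · rw [hc, g1, h]
        · rw [g3 _ hc hcb, h3 _ hca hc]
    · obtain ⟨mu, h1, h2, h3⟩ := ih lam (a + 1) h (by omega) hb
      obtain ⟨nu, g1, g2, g3⟩ := exists_isFlip_succ mu a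
        (by rw [h3 _ (by omega) (by omega)]; exact ha) h1
      refine ⟨nu, g1, ?_, fun c hca hcb => ?_⟩
      · rw [g3 _ (by omega) (by omega), h2]
      · by_cases hc : c = a + 1
        · rw [hc, g2, h]
        · rw [g3 _ hca hc, h3 _ hc hcb]

/-! ### Heights and pairs -/

/-- The height function of a partition: its increments are the signs. -/
noncomputable def height (lam : YoungDiagram) (m : ℤ) : ℤ :=
  ∑ d ∈ Finset.Ico 0 m, phi lam d - ∑ d ∈ Finset.Ico m 0, phi lam d

theorem height_succ (lam : YoungDiagram) (m : ℤ) :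
    height lam (m + 1) = height lam m + phi lam m := by
  unfold height
  rcases lt_or_ge m 0 with h | h
  · rw [Finset.Ico_eq_empty (a := (0 : ℤ)) (b := m + 1) (by omega),
      Finset.Ico_eq_empty (a := (0 : ℤ)) (b := m) (by omega),
      ← Finset.sum_Ioo_add_eq_sum_Ico h]
    have : Finset.Ioo m 0 = Finset.Ico (m + 1) 0 := by ext; simp
    rw [this]
    ring
  · rw [Finset.Ico_eq_empty (a := m + 1) (b := (0 : ℤ)) (by omega),
      Finset.Ico_eq_empty (a := m) (b := (0 : ℤ)) (by omega)]
    have : Finset.Ico 0 (m + 1) = insert m (Finset.Ico 0 m) := by ext; simp; omega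
    rw [this, Finset.sum_insert (by simp)]
    ring

theorem sum_phi_Icc (lam : YoungDiagram) (a c : ℤ) (h : a ≤ c) :
    ∑ d ∈ Finset.Icc a c, phi lam d = height lam (c + 1) - height lam a := by
  induction c, h using Int.leInduction with
  | base =>
    rw [height_succ]
    simp
  | succ c hc ih =>
    have : Finset.Icc a (c + 1) = insert (c + 1) (Finset.Icc a c) := by ext; simp; omega
    rw [this, Finset.sum_insert (by simp), ih, height_succ lam (c + 1)]
    ring

/-- Signs are steps of a lattice path. Since steps have size one, the first return to the height at
`a` is the first time the path is no longer strictly below it, so pairs are valleys of the path. -/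
theorem isPair_iff {lam : YoungDiagram} {a b : ℤ} :
    IsPair lam a b ↔ a < b ∧ height lam (b + 1) = height lam a ∧
      ∀ c, a < c → c ≤ b → height lam c < height lam a := by
  constructor
  · rintro ⟨ha, hb, ⟨hab, hs⟩, hmin⟩
    rw [sum_phi_Icc lam a b hab.le] at hs
    refine ⟨hab, by linarith, fun c hac => ?_⟩
    have hac' : a + 1 ≤ c := hac
    induction c, hac' using Int.leInduction with
    | base =>
      intro _
      rw [height_succ, ha]
      omega
    | succ c hc ih =>
      intro hcb
      have h1 := ih (by omega) (by omega)
      have h2 := height_succ lam c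
      by_contra h3
      have h4 : height lam (c + 1) = height lam a := by
        rcases phi_eq_or lam c with h | h <;> omega
      have := hmin (show c ∈ {c : ℤ | a < c ∧ ∑ d ∈ Finset.Icc a c, phi lam d = 0} from
        ⟨by omega, by rw [sum_phi_Icc lam a c (by omega), h4, sub_self]⟩)
      omega
  · rintro ⟨hab, hs, h⟩
    have h1 := h (a + 1) (by omega) (by omega)
    have h2 := h b hab le_rfl
    have h3 := height_succ lam a
    have h4 := height_succ lam b
    refine ⟨by rcases phi_eq_or lam a with h | h <;> omega,
      by rcases phi_eq_or lam b with h | h <;> omega, ⟨hab, ?_⟩, ?_⟩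
    · rw [sum_phi_Icc lam a b hab.le]
      omega
    · rintro c ⟨hac, hc⟩
      rw [sum_phi_Icc lam a c hac.le] at hc
      by_contra hcb
      have := h (c + 1) (by omega) (by omega)
      omega

theorem IsPair.exists_right (lam : YoungDiagram) {k l : ℕ} (hlam : lam ∈ Omega k l) (a : ℤ)
    (ha : phi lam a = -1) : ∃ b, IsPair lam a b := by
  have hgrow : ∀ t : ℕ, height lam (l + t) = height lam l + t := by
    intro t
    induction t with
    | zero => simp
    | succ t ih =>
      have := height_succ lam (l + t)
      rw [(mem_Omega_iff.1 hlam).2 _ (by omega), ih] at this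
      push_cast
      rw [← add_assoc, this]
      ring
  have hex : ∃ c, a < c ∧ height lam a ≤ height lam c := by
    -- To the right of `l` the path only rises; the first summand makes up the missing height and
    -- the second one passes `a`.
    refine ⟨l + ((height lam a - height lam l).toNat + (a + 1).toNat : ℕ), by omega, ?_⟩
    rw [hgrow]
    omega
  obtain ⟨c, ⟨hac, hc⟩, hmin⟩ := Int.exists_least_of_bdd
    (P := fun c => a < c ∧ height lam a ≤ height lam c) ⟨a, fun z hz => hz.1.le⟩ hex
  have h1 := height_succ lam a
  have hne : c ≠ a + 1 := by
    rintro rfl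
    omega
  have h2 : height lam (c - 1) < height lam a := by
    by_contra h
    have := hmin (c - 1) ⟨by omega, by omega⟩
    omega
  have h3 := height_succ lam (c - 1)
  rw [sub_add_cancel] at h3
  refine ⟨c - 1, isPair_iff.2 ⟨by omega, ?_, fun d had hdc => ?_⟩⟩
  · rw [sub_add_cancel]
    rcases phi_eq_or lam (c - 1) with h | h <;> omega
  · by_contra h
    have := hmin d ⟨had, by omega⟩
    omega

/-- To the left of `-k` all steps go down, so the path is arbitrarily high far to the left. Together
with its growth to the right this matches every position and gives every pair a parent. -/
theorem height_sub_unbounded {lam : YoungDiagram} {k l : ℕ} (hlam : lam ∈ Omega k l) (v a : ℤ) :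
    ∃ c, c ≤ a ∧ v ≤ height lam c := by
  have hgrow : ∀ t : ℕ, height lam (-k - t) = height lam (-k) + t := by
    intro t
    induction t with
    | zero => simp
    | succ t ih =>
      have := height_succ lam (-k - (t + 1))
      rw [(mem_Omega_iff.1 hlam).1 _ (by omega)] at this
      have e : (-(k : ℤ) - (t + 1) + 1) = -k - t := by ring
      rw [e, ih] at this
      push_cast
      omega
  refine ⟨-k - ((v - height lam (-k)).toNat + (-a).toNat : ℕ), by omega, ?_⟩
  rw [hgrow]
  omega

/-- The greatest position up to `a` at which the height is at least `v`. -/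
theorem exists_last_height {lam : YoungDiagram} {k l : ℕ} (hlam : lam ∈ Omega k l) (v a : ℤ)
    (ha : height lam a < v) :
    ∃ c, c < a ∧ height lam c = v ∧ ∀ d, c < d → d ≤ a → height lam d < v := by
  obtain ⟨c, ⟨hca, hc⟩, hmax⟩ := Int.exists_greatest_of_bdd
    (P := fun c => c ≤ a ∧ v ≤ height lam c) ⟨a, fun z hz => hz.1⟩ (height_sub_unbounded hlam v a)
  have hne : c ≠ a := by
    rintro rfl
    omega
  refine ⟨c, by omega, ?_, fun d hcd hda => ?_⟩
  · by_contra hcv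
    have h1 := height_succ lam c
    have := hmax (c + 1) ⟨by omega, by rcases phi_eq_or lam c with h | h <;> omega⟩
    omega
  · by_contra h
    have := hmax d ⟨hda, by omega⟩
    omega

theorem IsPair.exists_left (lam : YoungDiagram) {k l : ℕ} (hlam : lam ∈ Omega k l) (b : ℤ)
    (hb : phi lam b = 1) : ∃ a, IsPair lam a b := by
  have h1 := height_succ lam b
  obtain ⟨c, hcb, hc, h⟩ := exists_last_height hlam (height lam (b + 1)) b (by omega)
  refine ⟨c, isPair_iff.2 ⟨hcb, hc.symm, ?_⟩⟩
  rw [hc]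
  exact h

theorem IsPair.right_unique {lam : YoungDiagram} {a b b' : ℤ} (h : IsPair lam a b)
    (h' : IsPair lam a b') : b = b' :=
  h.2.2.unique h'.2.2

/-- The path at `c` lies below its height at `a`, so it returns to the height at `c` before it
returns to the height at `a`. -/
theorem IsPair.nested {lam : YoungDiagram} {a b c d : ℤ} (h : IsPair lam a b)
    (h' : IsPair lam c d) (hac : a < c) (hcb : c < b) : d < b := by
  rw [isPair_iff] at h h'
  by_contra hbd
  have h1 := h.2.2 c hac hcb.le
  rcases eq_or_lt_of_le (not_lt.1 hbd) with rfl | hbd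
  · omega
  · have := h'.2.2 (b + 1) (by omega) (by omega)
    omega

theorem IsPair.left_unique {lam : YoungDiagram} {a a' b : ℤ} (h : IsPair lam a b)
    (h' : IsPair lam a' b) : a = a' := by
  rcases lt_trichotomy a a' with hlt | rfl | hlt
  · have := h.nested h' hlt h'.2.2.1.1
    omega
  · rfl
  · have := h'.nested h hlt h.2.2.1.1
    omega

/-- The pair `(a, b)` is a child of the pair `(a', b')`. -/
def IsChild (lam : YoungDiagram) (a b a' b' : ℤ) : Prop :=
  IsPair lam a b ∧ IsPair lam a' b' ∧ a' < a ∧ b < b' ∧ height lam a' = height lam a + 1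

/-- The parent opens at the last position before `a` whose height is one more than that of `a`. -/
theorem exists_parent {lam : YoungDiagram} {k l : ℕ} (hlam : lam ∈ Omega k l) {a b : ℤ}
    (h : IsPair lam a b) : ∃ a' b', IsChild lam a b a' b' := by
  obtain ⟨a', ha'a, ha', hlt⟩ := exists_last_height hlam (height lam a + 1) a (by omega)
  have h1 := height_succ lam a'
  have h2 := hlt (a' + 1) (by omega) (by omega)
  obtain ⟨b', hb'⟩ := IsPair.exists_right lam hlam a'
    (by rcases phi_eq_or lam a' with h | h <;> omega)
  refine ⟨a', b', h, hb', ha'a, ?_, ha'⟩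
  have g := isPair_iff.1 h
  have g' := isPair_iff.1 hb'
  by_contra hbb'
  rcases le_or_gt (b' + 1) a with h3 | h3
  · have := hlt (b' + 1) (by omega) h3
    omega
  · have : height lam (b' + 1) ≤ height lam a := by
      rcases eq_or_lt_of_le (not_lt.1 hbb') with rfl | h4
      · omega
      · exact (g.2.2 (b' + 1) h3 (by omega)).le
    omega

/-- Heights inside the parent are at most the height at `a`, so a valley opening at `e` cannot
extend over `a`. Hence the parent is the nearest enclosing pair. -/
theorem IsChild.no_between {lam : YoungDiagram} {a b a' b' e f : ℤ} (h : IsChild lam a b a' b')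
    (hef : IsPair lam e f) (h1 : a' < e) (h2 : e < a) : f < a := by
  obtain ⟨hab, hab', h3, h4, h5⟩ := h
  have hlt := hab.2.2.1.1
  have g' := (isPair_iff.1 hab').2.2 e h1 (by omega)
  have g := (isPair_iff.1 hef).2.2 a h2
  by_contra hfa
  have := g (by omega)
  omega

theorem IsChild.unique {lam : YoungDiagram} {a b a' b' a'' b'' : ℤ} (h : IsChild lam a b a' b')
    (h' : IsChild lam a b a'' b'') : a' = a'' ∧ b' = b'' := by
  have h3 := h.1.2.2.1.1
  have key : a' = a'' := by
    obtain ⟨_, hab', h31, h41, h51⟩ := h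
    obtain ⟨_, hab'', h32, h42, h52⟩ := h'
    rcases lt_trichotomy a' a'' with hlt | h | hlt
    · have := (isPair_iff.1 hab').2.2 a'' hlt (by omega)
      omega
    · exact h
    · have := (isPair_iff.1 hab'').2.2 a' hlt (by omega)
      omega
  subst key
  exact ⟨rfl, h.2.1.right_unique h'.2.1⟩

end GrassConormal

namespace GrassConormal

/-! ### Diamonds -/

/-- A flip raises the path by two between its ends. The constant `K` only absorbs the normalization
of heights at the origin. -/
theorem IsFlip.exists_height {lam mu : YoungDiagram} {a b : ℤ} (h : IsFlip lam mu a b)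
    (hab : a < b) (ha : phi lam a = -1) (hb : phi lam b = 1) :
    ∃ K, ∀ c, height mu c = height lam c + K + if a < c ∧ c ≤ b then 2 else 0 := by
  let f : ℤ → ℤ := fun c => height mu c - height lam c - if a < c ∧ c ≤ b then 2 else 0
  have hf : ∀ c, f (c + 1) = f c := by
    intro c
    simp only [f, height_succ]
    rcases eq_or_ne c a with rfl | hca
    · rw [h.1, ha, if_pos (by omega), if_neg (by omega)]
      ring
    rcases eq_or_ne c b with rfl | hcb
    · rw [h.2.1, hb, if_neg (by omega), if_pos (by omega)]
      ring
    rw [h.2.2 c hca hcb]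
    have : (a < c + 1 ∧ c + 1 ≤ b) ↔ (a < c ∧ c ≤ b) := by omega
    simp only [this]
    ring
  have hper : ∀ c, f c = f 0 := by
    intro c
    induction c using Int.induction_on with
    | zero => rfl
    | succ i ih => rw [hf, ih]
    | pred i ih =>
      rw [← ih, ← hf (-(i : ℤ) - 1)]
      congr 1
      ring
  refine ⟨f 0, fun c => ?_⟩
  have := hper c
  simp only [f] at this ⊢
  omega

theorem Linked.symm {lam mu : YoungDiagram} (h : Linked lam mu) : Linked mu lam := Or.symm h

theorem Linked.exists_flip {lam mu : YoungDiagram} (h : Linked lam mu) :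
    ∃ c d, c < d ∧ (∀ x, phi mu x ≠ phi lam x → x = c ∨ x = d) ∧
      ((phi lam c = -1 ∧ phi lam d = 1 ∧ IsPair lam c d) ∨
        (phi lam c = 1 ∧ phi lam d = -1 ∧ IsPair mu c d)) := by
  rcases h with ⟨c, d, hp, h1, h2, h3⟩ | ⟨c, d, hp, h1, h2, h3⟩
  · refine ⟨c, d, hp.2.2.1.1, fun x hx => ?_, Or.inl ⟨hp.1, hp.2.1, hp⟩⟩
    by_contra hne
    rw [not_or] at hne
    exact hx (h3 x hne.1 hne.2)
  · refine ⟨c, d, hp.2.2.1.1, fun x hx => ?_, Or.inr ⟨h1, h2, hp⟩⟩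
    by_contra hne
    rw [not_or] at hne
    exact hx (h3 x hne.1 hne.2).symm

theorem IsPair.ends_ne {lam : YoungDiagram} {a b c d : ℤ} (h : IsPair lam a b)
    (h' : IsPair lam c d) : a ≠ d := by
  rintro rfl
  have := h.1
  rw [h'.2.1] at this
  norm_num at this

theorem IsPair.disjoint_or_nested {lam : YoungDiagram} {a b c d : ℤ} (h : IsPair lam a b)
    (h' : IsPair lam c d) (hac : a < c) : b < c ∨ d < b := by
  have := h'.ends_ne h
  rcases lt_or_ge c b with h1 | h1
  · exact Or.inr (h.nested h' hac h1)
  · left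
    omega

/-- The ways in which `λ'` can be obtained from two `λ`-pairs. -/
def IsTop (lam lam' : YoungDiagram) (a1 b1 a2 b2 : ℤ) : Prop :=
  (¬ IsChild lam a1 b1 a2 b2 ∧ ¬ IsChild lam a2 b2 a1 b1 ∧
      phi lam' a1 = 1 ∧ phi lam' b1 = -1 ∧ phi lam' a2 = 1 ∧ phi lam' b2 = -1 ∧
      ∀ c, c ≠ a1 → c ≠ b1 → c ≠ a2 → c ≠ b2 → phi lam' c = phi lam c) ∨
    ((IsChild lam a1 b1 a2 b2 ∨ IsChild lam a2 b2 a1 b1) ∧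
      (IsFlip lam lam' a2 b1 ∨ IsFlip lam lam' a1 b2))

theorem IsTop.symm {lam lam' : YoungDiagram} {a1 b1 a2 b2 : ℤ} (h : IsTop lam lam' a1 b1 a2 b2) :
    IsTop lam lam' a2 b2 a1 b1 := by
  rcases h with ⟨h1, h2, h3, h4, h5, h6, h7⟩ | ⟨h1, h2⟩
  · exact Or.inl ⟨h2, h1, h5, h6, h3, h4, fun c g1 g2 g3 g4 => h7 c g3 g4 g1 g2⟩
  · exact Or.inr ⟨h1.symm, h2.symm⟩

/-- A mixed flip belongs to a diamond only for a parent and a child: disjoint pairs contradict the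
heights, and for nested pairs the link between the two left ends forces a height difference of
exactly one. -/
theorem isChild_of_cross {lam lam1 lam' : YoungDiagram} {a1 b1 a2 b2 : ℤ}
    (hp1 : IsPair lam a1 b1) (hp2 : IsPair lam a2 b2) (hne : a1 ≠ a2)
    (hf1 : IsFlip lam lam1 a1 b1) (hf' : IsFlip lam lam' a2 b1)
    (ha1 : a1 < a2 → IsPair lam' a1 a2) (ha2 : a2 < a1 → IsPair lam1 a2 a1)
    (hb1 : b1 < b2 → IsPair lam' b1 b2) :
    IsChild lam a1 b1 a2 b2 ∨ IsChild lam a2 b2 a1 b1 := by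
  have q1 := isPair_iff.1 hp1
  have q2 := isPair_iff.1 hp2
  have s1 := height_succ lam a1
  have s2 := height_succ lam a2
  have s3 := height_succ lam b1
  rw [hp1.1] at s1
  rw [hp2.1] at s2
  rw [hp1.2.1] at s3
  rcases lt_or_gt_of_ne hne with hlt | hlt
  · have r1 := isPair_iff.1 (ha1 hlt)
    rcases hp1.disjoint_or_nested hp2 hlt with h | h
    · have r2 := isPair_iff.1 (hb1 (by omega))
      have hback : IsFlip lam' lam b1 a2 :=
        ⟨hp1.2.1, hp2.1, fun c hc1 hc2 => (hf'.2.2 c hc2 hc1).symm⟩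
      obtain ⟨K, hK⟩ := hback.exists_height h hf'.2.1 hf'.1
      have e1 := r1.2.1
      have e2 := r2.2.1
      have k1 := hK (a2 + 1)
      have k2 := hK a1
      have k3 := hK (b2 + 1)
      have k4 := hK b1
      rw [if_neg (by omega)] at k1 k2 k3 k4
      omega
    · right
      obtain ⟨K, hK⟩ := hf'.exists_height (by omega) hp2.1 hp1.2.1
      refine ⟨hp2, hp1, hlt, h, ?_⟩
      have e1 := r1.2.1
      have k1 := hK (a2 + 1)
      have k2 := hK a1
      rw [if_pos (by omega)] at k1
      rw [if_neg (by omega)] at k2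
      omega
  · have r1 := isPair_iff.1 (ha2 hlt)
    obtain ⟨K, hK⟩ := hf1.exists_height q1.1 hp1.1 hp1.2.1
    rcases hp2.disjoint_or_nested hp1 hlt with h | h
    · have e1 := r1.2.2 (b2 + 1) (by omega) (by omega)
      have k1 := hK (b2 + 1)
      have k2 := hK a2
      rw [if_neg (by omega)] at k1 k2
      omega
    · left
      refine ⟨hp1, hp2, hlt, h, ?_⟩
      have e1 := r1.2.1
      have k1 := hK (a1 + 1)
      have k2 := hK a2
      rw [if_pos (by omega)] at k1
      rw [if_neg (by omega)] at k2
      omega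

/-- Flipping a child raises its interior by two, and just after `a1` the path then reaches the
height at the left end of the parent, which closes too early. -/
theorem not_isChild_of_isPair_flip {lam lam1 : YoungDiagram} {a1 b1 a2 b2 : ℤ}
    (hf1 : IsFlip lam lam1 a1 b1) (hp : IsPair lam1 a2 b2) : ¬ IsChild lam a1 b1 a2 b2 := by
  rintro ⟨hp1, hp2, h1, h2, h3⟩
  have q1 := isPair_iff.1 hp1
  obtain ⟨K, hK⟩ := hf1.exists_height q1.1 hp1.1 hp1.2.1
  have s1 := height_succ lam a1
  rw [hp1.1] at s1
  have e1 := (isPair_iff.1 hp).2.2 (a1 + 1) (by omega) (by omega)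
  have k1 := hK (a1 + 1)
  have k2 := hK a2
  rw [if_pos (by omega)] at k1
  rw [if_neg (by omega)] at k2
  omega

theorem isFlip_of_linked_cross {lam lam1 lam2 lam' : YoungDiagram} {a1 b1 a2 b2 : ℤ}
    (hp1 : IsPair lam a1 b1) (hp2 : IsPair lam a2 b2) (hne : a1 ≠ a2)
    (hf1 : IsFlip lam lam1 a1 b1) (hf2 : IsFlip lam lam2 a2 b2)
    (h1 : ∀ x, phi lam' x ≠ phi lam1 x → x = a1 ∨ x = a2)
    (h2 : ∀ x, phi lam' x ≠ phi lam2 x → x = b1 ∨ x = b2) :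
    IsFlip lam lam' a2 b1 := by
  have n1 := hp1.ends_ne hp2
  have n2 := hp2.ends_ne hp1
  have n3 := hp2.ends_ne hp2
  have n4 := hp1.ends_ne hp1
  have n5 : b1 ≠ b2 := fun h => hne (hp1.left_unique (h ▸ hp2))
  have key1 : ∀ x, x ≠ a1 → x ≠ a2 → phi lam' x = phi lam1 x := by
    intro x hx1 hx2
    by_contra h
    rcases h1 x h with h | h <;> contradiction
  have key2 : ∀ x, x ≠ b1 → x ≠ b2 → phi lam' x = phi lam2 x := by
    intro x hx1 hx2
    by_contra h
    rcases h2 x h with h | h <;> contradiction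
  refine ⟨?_, ?_, fun c hc1 hc2 => ?_⟩
  · rw [key2 _ n2 n3, hf2.1]
  · rw [key1 _ n4.symm n2.symm, hf1.2.1]
  · by_cases hca : c = a1
    · subst hca
      rw [key2 _ n4 n1, hf2.2.2 _ hne n1]
    · rw [key1 _ hca hc1, hf1.2.2 _ hca hc2]

/-- Two two-element sets covering four points must partition them. Of the six possibilities the two
that join a left end to the right end of the other pair are excluded by hypothesis. -/
theorem pair_partition {a1 b1 a2 b2 c1 d1 c2 d2 : ℤ} (n0 : a1 ≠ a2) (n1 : a1 ≠ b2) (n2 : a2 ≠ b1)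
    (n3 : a2 ≠ b2) (n4 : a1 ≠ b1) (n5 : b1 ≠ b2)
    (w1 : (a1 = c1 ∨ a1 = d1) ∨ a1 = c2 ∨ a1 = d2) (w2 : (b1 = c1 ∨ b1 = d1) ∨ b1 = c2 ∨ b1 = d2)
    (w3 : (a2 = c1 ∨ a2 = d1) ∨ a2 = c2 ∨ a2 = d2) (w4 : (b2 = c1 ∨ b2 = d1) ∨ b2 = c2 ∨ b2 = d2)
    (g1 : ¬ (c1 = a1 ∧ d1 = b2)) (g2 : ¬ (c1 = b2 ∧ d1 = a1)) (g3 : ¬ (c1 = b1 ∧ d1 = a2))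
    (g4 : ¬ (c1 = a2 ∧ d1 = b1)) :
    ({c1, d1} : Set ℤ) = {a2, b2} ∧ ({c2, d2} : Set ℤ) = {a1, b1} ∨
      ({c1, d1} : Set ℤ) = {a1, a2} ∧ ({c2, d2} : Set ℤ) = {b1, b2} ∨
      ({c1, d1} : Set ℤ) = {b1, b2} ∧ ({c2, d2} : Set ℤ) = {a1, a2} ∨
      ({c1, d1} : Set ℤ) = {a1, b1} ∧ ({c2, d2} : Set ℤ) = {a2, b2} := by
  simp only [Set.pair_eq_pair_iff]
  rcases w1 with (rfl | rfl) | (rfl | rfl) <;> rcases w2 with (rfl | rfl) | (rfl | rfl) <;>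
    first
    | exact absurd rfl n4
    | (rcases w3 with (rfl | rfl) | (rfl | rfl) <;>
        first
        | exact absurd rfl n0
        | exact absurd rfl n2
        | (rcases w4 with (rfl | rfl) | (rfl | rfl) <;> simp_all))

/-- The structure of the diamonds `λ → λ₁ ↔ λ' ↔ λ₂ ← λ`. -/
theorem IsUpDiamond.exists_isTop {lam lam1 lam' lam2 : YoungDiagram}
    (h : IsUpDiamond lam lam1 lam' lam2) :
    ∃ a1 b1 a2 b2, IsPair lam a1 b1 ∧ IsPair lam a2 b2 ∧ a1 ≠ a2 ∧ IsFlip lam lam1 a1 b1 ∧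
      IsFlip lam lam2 a2 b2 ∧ IsTop lam lam' a1 b1 a2 b2 := by
  obtain ⟨⟨hnd, -, hl1, hl2, -⟩, ⟨a1, b1, hp1, hf1⟩, ⟨a2, b2, hp2, hf2⟩⟩ := h
  replace hf1 : IsFlip lam lam1 a1 b1 := hf1
  replace hf2 : IsFlip lam lam2 a2 b2 := hf2
  simp only [List.nodup_cons, List.mem_cons, List.not_mem_nil, or_false, not_or,
    List.nodup_nil, not_false_eq_true, and_true] at hnd
  have hne : a1 ≠ a2 := by
    rintro rfl
    obtain rfl := hp1.right_unique hp2
    exact hnd.2.1.2 (hf1.unique hf2)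
  have n1 := hp1.ends_ne hp2
  have n2 := hp2.ends_ne hp1
  have n3 := hp2.ends_ne hp2
  have n4 := hp1.ends_ne hp1
  have n5 : b1 ≠ b2 := fun h => hne (hp1.left_unique (h ▸ hp2))
  refine ⟨a1, b1, a2, b2, hp1, hp2, hne, hf1, hf2, ?_⟩
  obtain ⟨c1, d1, hcd1, hx1, hs1⟩ := hl1.exists_flip
  obtain ⟨c2, d2, hcd2, hx2, hs2⟩ := hl2.symm.exists_flip
  have v11 := hf1.1
  have v12 := hf1.2.1
  have v13 : phi lam1 a2 = -1 := by rw [hf1.2.2 _ hne.symm n2, hp2.1]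
  have v14 : phi lam1 b2 = 1 := by rw [hf1.2.2 _ n1.symm n5.symm, hp2.2.1]
  have v21 := hf2.1
  have v22 := hf2.2.1
  have v23 : phi lam2 a1 = -1 := by rw [hf2.2.2 _ hne n1, hp1.1]
  have v24 : phi lam2 b1 = 1 := by rw [hf2.2.2 _ n2.symm n5, hp1.2.1]
  -- The signs of `lam1` and `lam2` differ at the four ends of the two pairs, and each of these
  -- changes must occur in one of the two links through `lam'`.
  have cov : ∀ x, phi lam1 x ≠ phi lam2 x → (x = c1 ∨ x = d1) ∨ (x = c2 ∨ x = d2) := by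
    intro x hx
    by_cases h : phi lam' x = phi lam1 x
    · exact Or.inr (hx2 x (by rw [h]; exact hx))
    · exact Or.inl (hx1 x h)
  have w1 := cov a1 (by rw [v11, v23]; norm_num)
  have w2 := cov b1 (by rw [v12, v24]; norm_num)
  have w3 := cov a2 (by rw [v13, v21]; norm_num)
  have w4 := cov b2 (by rw [v14, v22]; norm_num)
  have hkey : ({c1, d1} : Set ℤ) = {a2, b2} ∧ ({c2, d2} : Set ℤ) = {a1, b1} ∨
      ({c1, d1} : Set ℤ) = {a1, a2} ∧ ({c2, d2} : Set ℤ) = {b1, b2} ∨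
      ({c1, d1} : Set ℤ) = {b1, b2} ∧ ({c2, d2} : Set ℤ) = {a1, a2} ∨
      ({c1, d1} : Set ℤ) = {a1, b1} ∧ ({c2, d2} : Set ℤ) = {a2, b2} := by
    -- A link exchanges opposite signs, whereas `lam1` has the same sign at `a1` and `b2`, and the
    -- same sign at `b1` and `a2`.
    have g1 : phi lam1 c1 ≠ phi lam1 d1 := by
      rcases hs1 with h | h <;> rw [h.1, h.2.1] <;> norm_num
    refine pair_partition hne n1 n2 n3 n4 n5 w1 w2 w3 w4 ?_ ?_ ?_ ?_ <;> rintro ⟨rfl, rfl⟩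
    · exact g1 (by rw [v11, v14])
    · exact g1 (by rw [v11, v14])
    · exact g1 (by rw [v12, v13])
    · exact g1 (by rw [v12, v13])
  have toset1 : ∀ {x y : ℤ}, ({c1, d1} : Set ℤ) = {x, y} →
      ∀ z, phi lam' z ≠ phi lam1 z → z = x ∨ z = y := by
    intro x y h z hz
    have : z ∈ ({c1, d1} : Set ℤ) := hx1 z hz
    rw [h] at this
    exact this
  have toset2 : ∀ {x y : ℤ}, ({c2, d2} : Set ℤ) = {x, y} →
      ∀ z, phi lam' z ≠ phi lam2 z → z = x ∨ z = y := by
    intro x y h z hz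
    have : z ∈ ({c2, d2} : Set ℤ) := hx2 z hz
    rw [h] at this
    exact this
  have up1 : ∀ {x y : ℤ}, ({c1, d1} : Set ℤ) = {x, y} → x < y → phi lam1 x = -1 →
      IsPair lam1 x y := by
    intro x y h hxy hx
    rw [Set.pair_eq_pair_iff] at h
    obtain ⟨rfl, rfl⟩ : c1 = x ∧ d1 = y := by omega
    rcases hs1 with hs | hs
    · exact hs.2.2
    · rw [hs.1] at hx
      norm_num at hx
  have dn1 : ∀ {x y : ℤ}, ({c1, d1} : Set ℤ) = {x, y} → x < y → phi lam1 x = 1 →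
      IsPair lam' x y := by
    intro x y h hxy hx
    rw [Set.pair_eq_pair_iff] at h
    obtain ⟨rfl, rfl⟩ : c1 = x ∧ d1 = y := by omega
    rcases hs1 with hs | hs
    · rw [hs.1] at hx
      norm_num at hx
    · exact hs.2.2
  have up2 : ∀ {x y : ℤ}, ({c2, d2} : Set ℤ) = {x, y} → x < y → phi lam2 x = -1 →
      IsPair lam2 x y := by
    intro x y h hxy hx
    rw [Set.pair_eq_pair_iff] at h
    obtain ⟨rfl, rfl⟩ : c2 = x ∧ d2 = y := by omega
    rcases hs2 with hs | hs
    · exact hs.2.2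
    · rw [hs.1] at hx
      norm_num at hx
  have dn2 : ∀ {x y : ℤ}, ({c2, d2} : Set ℤ) = {x, y} → x < y → phi lam2 x = 1 →
      IsPair lam' x y := by
    intro x y h hxy hx
    rw [Set.pair_eq_pair_iff] at h
    obtain ⟨rfl, rfl⟩ : c2 = x ∧ d2 = y := by omega
    rcases hs2 with hs | hs
    · rw [hs.1] at hx
      norm_num at hx
    · exact hs.2.2
  rcases hkey with ⟨e1, e2⟩ | ⟨e1, e2⟩ | ⟨e1, e2⟩ | ⟨e1, e2⟩
  · left
    have k1 := toset1 e1
    have k2 := toset2 e2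
    have key1 : ∀ x, x ≠ a2 → x ≠ b2 → phi lam' x = phi lam1 x := by
      intro x hx1 hx2
      by_contra h
      rcases k1 x h with h | h <;> contradiction
    have key2 : ∀ x, x ≠ a1 → x ≠ b1 → phi lam' x = phi lam2 x := by
      intro x hx1 hx2
      by_contra h
      rcases k2 x h with h | h <;> contradiction
    refine ⟨not_isChild_of_isPair_flip hf1 (up1 e1 hp2.2.2.1.1 v13),
      not_isChild_of_isPair_flip hf2 (up2 e2 hp1.2.2.1.1 v23), ?_, ?_, ?_, ?_, ?_⟩
    · rw [key1 _ hne n1, v11]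
    · rw [key1 _ n2.symm n5, v12]
    · rw [key2 _ hne.symm n2, v21]
    · rw [key2 _ n1.symm n5.symm, v22]
    · intro c hc1 hc2 hc3 hc4
      rw [key1 c hc3 hc4, hf1.2.2 c hc1 hc2]
  · right
    have hf' := isFlip_of_linked_cross hp1 hp2 hne hf1 hf2 (toset1 e1) (toset2 e2)
    refine ⟨isChild_of_cross hp1 hp2 hne hf1 hf' (fun h => dn1 e1 h v11)
      (fun h => up1 (e1.trans (Set.pair_comm _ _)) h v13) (fun h => dn2 e2 h v24), Or.inl hf'⟩
  · right
    have hf' := isFlip_of_linked_cross hp2 hp1 hne.symm hf2 hf1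
      (toset2 (e2.trans (Set.pair_comm _ _))) (toset1 (e1.trans (Set.pair_comm _ _)))
    refine ⟨(isChild_of_cross hp2 hp1 hne.symm hf2 hf'
      (fun h => dn2 (e2.trans (Set.pair_comm _ _)) h v21)
      (fun h => up2 e2 h v23)
      (fun h => dn1 (e1.trans (Set.pair_comm _ _)) h v14)).symm, Or.inr hf'⟩
  -- In the remaining partition the second link undoes the first flip, so `lam'` would be `lam`.
  · exfalso
    refine hnd.1.2.1 (phi_injective (funext fun x => ?_))
    by_cases hxa : x = a1
    · subst hxa
      by_contra h
      have : phi lam' x ≠ phi lam2 x := by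
        rw [v23, ← hp1.1]
        exact fun h' => h h'.symm
      rcases toset2 e2 x this with h | h <;> contradiction
    by_cases hxb : x = b1
    · subst hxb
      by_contra h
      have : phi lam' x ≠ phi lam2 x := by
        rw [v24, ← hp1.2.1]
        exact fun h' => h h'.symm
      rcases toset2 e2 x this with h | h
      · exact n2 h.symm
      · exact n5 h
    by_contra h
    have : phi lam' x ≠ phi lam1 x := by
      rw [hf1.2.2 _ hxa hxb]
      exact fun h' => h h'.symm
    rcases toset1 e1 x this with h | h <;> contradiction

/-- The only danger is the raised interval lying inside the second pair. If the first pair is nested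
but not a child, it starts at least two below the left end of the second pair, so the raised part
stays strictly below. -/
theorem IsPair.flip_of_not_isChild {lam lam1 : YoungDiagram} {a1 b1 a2 b2 : ℤ}
    (hp1 : IsPair lam a1 b1) (hp2 : IsPair lam a2 b2) (hne : a1 ≠ a2)
    (hf1 : IsFlip lam lam1 a1 b1) (hc : ¬ IsChild lam a1 b1 a2 b2) : IsPair lam1 a2 b2 := by
  have q1 := isPair_iff.1 hp1
  have q2 := isPair_iff.1 hp2
  have n5 : b1 ≠ b2 := fun h => hne (hp1.left_unique (h ▸ hp2))
  obtain ⟨K, hK⟩ := hf1.exists_height q1.1 hp1.1 hp1.2.1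
  have k1 := hK a2
  have k2 := hK (b2 + 1)
  have n1 := hp1.ends_ne hp2
  have n2 := hp2.ends_ne hp1
  rcases lt_or_gt_of_ne hne with hlt | hlt
  · rcases hp1.disjoint_or_nested hp2 hlt with h | h
    · refine isPair_iff.2 ⟨q2.1, ?_, fun c h1 h2 => ?_⟩
      · rw [if_neg (by omega)] at k1 k2
        omega
      · have k3 := hK c
        have := q2.2.2 c h1 h2
        rw [if_neg (by omega)] at k1 k3
        omega
    · refine isPair_iff.2 ⟨q2.1, ?_, fun c h1 h2 => ?_⟩
      · rw [if_pos (by omega)] at k1 k2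
        omega
      · have k3 := hK c
        have := q2.2.2 c h1 h2
        rw [if_pos (by omega)] at k1 k3
        omega
  · rcases hp2.disjoint_or_nested hp1 hlt with h | h
    · refine isPair_iff.2 ⟨q2.1, ?_, fun c h1 h2 => ?_⟩
      · rw [if_neg (by omega)] at k1 k2
        omega
      · have k3 := hK c
        have := q2.2.2 c h1 h2
        rw [if_neg (by omega)] at k1 k3
        omega
    · have h3 : height lam a1 + 2 ≤ height lam a2 := by
        have := q2.2.2 a1 hlt (by omega)
        by_contra h4
        exact hc ⟨hp1, hp2, hlt, h, by omega⟩
      refine isPair_iff.2 ⟨q2.1, ?_, fun c h1 h2 => ?_⟩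
      · rw [if_neg (by omega)] at k1 k2
        omega
      · have k3 := hK c
        have := q2.2.2 c h1 h2
        rw [if_neg (by omega)] at k1
        split_ifs at k3 with h5
        · have := q1.2.2 c h5.1 h5.2
          omega
        · omega

/-- The converse of `IsUpDiamond.exists_isTop`. Without a parent relation each pair survives the
flip of the other. For a parent and a child, flipping one of them or making a mixed flip turns the
two left ends, and also the two right ends, into pairs that give the links. -/
theorem isUpDiamond_of_isTop {lam lam1 lam' lam2 : YoungDiagram} {a1 b1 a2 b2 : ℤ}
    (hp1 : IsPair lam a1 b1) (hp2 : IsPair lam a2 b2) (hne : a1 ≠ a2)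
    (hf1 : IsFlip lam lam1 a1 b1) (hf2 : IsFlip lam lam2 a2 b2)
    (ht : IsTop lam lam' a1 b1 a2 b2) : IsUpDiamond lam lam1 lam' lam2 := by
  have n1 := hp1.ends_ne hp2
  have n2 := hp2.ends_ne hp1
  have n3 := hp2.ends_ne hp2
  have n4 := hp1.ends_ne hp1
  have n5 : b1 ≠ b2 := fun h => hne (hp1.left_unique (h ▸ hp2))
  have v11 := hf1.1
  have v12 := hf1.2.1
  have v13 : phi lam1 a2 = -1 := by rw [hf1.2.2 _ hne.symm n2, hp2.1]
  have v14 : phi lam1 b2 = 1 := by rw [hf1.2.2 _ n1.symm n5.symm, hp2.2.1]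
  have v21 := hf2.1
  have v22 := hf2.2.1
  have v23 : phi lam2 a1 = -1 := by rw [hf2.2.2 _ hne n1, hp1.1]
  have v24 : phi lam2 b1 = 1 := by rw [hf2.2.2 _ n2.symm n5, hp1.2.1]
  have sep : ∀ {mu nu : YoungDiagram} (x : ℤ), phi mu x = 1 → phi nu x = -1 → mu ≠ nu := by
    rintro mu nu x h1 h2 rfl
    rw [h1] at h2
    norm_num at h2
  have d01 : lam ≠ lam1 := (sep a1 v11 hp1.1).symm
  have d02 : lam ≠ lam2 := (sep a2 v21 hp2.1).symm
  have d12 : lam1 ≠ lam2 := sep a1 v11 v23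
  have fin : lam ≠ lam' → lam1 ≠ lam' → lam' ≠ lam2 → Linked lam1 lam' → Linked lam' lam2 →
      IsUpDiamond lam lam1 lam' lam2 := by
    intro e1 e2 e3 e4 e5
    refine ⟨⟨?_, Or.inl ⟨a1, b1, hp1, hf1⟩, e4, e5, Or.inr ⟨a2, b2, hp2, hf2⟩⟩,
      ⟨a1, b1, hp1, hf1⟩, ⟨a2, b2, hp2, hf2⟩⟩
    simp [d01, d02, d12, e1, e2, e3]
  rcases ht with ⟨c1, c2, h1, h2, h3, h4, h5⟩ | ⟨hc, hf'⟩
  · refine fin (sep a1 h1 hp1.1).symm (sep a2 h3 v13).symm (sep a1 h1 v23)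
      (Or.inl ⟨a2, b2, hp1.flip_of_not_isChild hp2 hne hf1 c1, h3, h4, fun c g1 g2 => ?_⟩)
      (Or.inr ⟨a1, b1, hp2.flip_of_not_isChild hp1 hne.symm hf2 c2, h1, h2, fun c g1 g2 => ?_⟩)
    · by_cases e1 : c = a1
      · rw [e1, h1, v11]
      by_cases e2 : c = b1
      · rw [e2, h2, v12]
      rw [h5 c e1 e2 g1 g2, hf1.2.2 c e1 e2]
    · by_cases e1 : c = a2
      · rw [e1, h3, v21]
      by_cases e2 : c = b2
      · rw [e2, h4, v22]
      rw [h5 c g1 g2 e1 e2, hf2.2.2 c e1 e2]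
  · -- by symmetry the first pair is the child
    have main : ∀ {mu1 mu2 : YoungDiagram} {a b a' b' : ℤ}, IsChild lam a b a' b' →
        IsFlip lam mu1 a b → IsFlip lam mu2 a' b' →
        (IsFlip lam lam' a' b ∨ IsFlip lam lam' a b') →
        lam ≠ lam' ∧ mu1 ≠ lam' ∧ lam' ≠ mu2 ∧ Linked mu1 lam' ∧ Linked lam' mu2 := by
      rintro mu1 mu2 a b a' b' ⟨hp, hp', hlt, hlt', hh⟩ g1 g2 hf
      have q := isPair_iff.1 hp
      have q' := isPair_iff.1 hp'
      have s1 := height_succ lam a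
      have s2 := height_succ lam b
      rw [hp.1] at s1
      rw [hp.2.1] at s2
      have m1 := hp.ends_ne hp'
      have m2 := hp'.ends_ne hp
      obtain ⟨K, hK⟩ := g1.exists_height q.1 hp.1 hp.2.1
      have u1 : phi mu1 a' = -1 := by rw [g1.2.2 _ (by omega) (by omega), hp'.1]
      have u2 : phi mu1 b' = 1 := by rw [g1.2.2 _ (by omega) (by omega), hp'.2.1]
      have u3 : phi mu2 a = -1 := by rw [g2.2.2 _ (by omega) (by omega), hp.1]
      have u4 : phi mu2 b = 1 := by rw [g2.2.2 _ (by omega) (by omega), hp.2.1]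
      rcases hf with hf | hf
      · obtain ⟨L, hL⟩ := hf.exists_height (by omega) hp'.1 hp.2.1
        have w1 : phi lam' a = -1 := by rw [hf.2.2 _ (by omega) (by omega), hp.1]
        have w2 : phi lam' b' = 1 := by rw [hf.2.2 _ (by omega) (by omega), hp'.2.1]
        refine ⟨(sep a' hf.1 hp'.1).symm, sep a g1.1 w1, sep b' w2 g2.2.1,
          Or.inl ⟨a', a, isPair_iff.2 ⟨hlt, ?_, fun c h1 h2 => ?_⟩, hf.1, w1, fun c h1 h2 => ?_⟩,
          Or.inl ⟨b, b', isPair_iff.2 ⟨hlt', ?_, fun c h1 h2 => ?_⟩, u4, g2.2.1,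
            fun c h1 h2 => ?_⟩⟩
        · have k1 := hK (a + 1)
          have k2 := hK a'
          rw [if_pos (by omega)] at k1
          rw [if_neg (by omega)] at k2
          omega
        · have k1 := hK c
          have k2 := hK a'
          rw [if_neg (by omega)] at k1 k2
          have := q'.2.2 c h1 (by omega)
          omega
        · by_cases e : c = b
          · rw [e, hf.2.1, g1.2.1]
          · rw [hf.2.2 c h1 e, g1.2.2 c h2 e]
        · have k1 := hL (b' + 1)
          have k2 := hL b
          rw [if_neg (by omega)] at k1
          rw [if_pos (by omega)] at k2
          omega
        · have k1 := hL c
          have k2 := hL b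
          rw [if_neg (by omega)] at k1
          rw [if_pos (by omega)] at k2
          have := q'.2.2 c (by omega) (by omega)
          omega
        · by_cases e : c = a'
          · rw [e, g2.1, hf.1]
          · rw [g2.2.2 c e h2, hf.2.2 c e h1]
      · obtain ⟨L, hL⟩ := hf.exists_height (by omega) hp.1 hp'.2.1
        have w1 : phi lam' a' = -1 := by rw [hf.2.2 _ (by omega) (by omega), hp'.1]
        have w2 : phi lam' b = 1 := by rw [hf.2.2 _ (by omega) (by omega), hp.2.1]
        refine ⟨(sep a hf.1 hp.1).symm, (sep b w2 g1.2.1).symm, (sep a' g2.1 w1).symm,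
          Or.inl ⟨b, b', isPair_iff.2 ⟨hlt', ?_, fun c h1 h2 => ?_⟩, w2, hf.2.1,
            fun c h1 h2 => ?_⟩,
          Or.inl ⟨a', a, isPair_iff.2 ⟨hlt, ?_, fun c h1 h2 => ?_⟩, g2.1, u3,
            fun c h1 h2 => ?_⟩⟩
        · have k1 := hK (b' + 1)
          have k2 := hK b
          rw [if_neg (by omega)] at k1
          rw [if_pos (by omega)] at k2
          omega
        · have k1 := hK c
          have k2 := hK b
          rw [if_neg (by omega)] at k1
          rw [if_pos (by omega)] at k2
          have := q'.2.2 c (by omega) (by omega)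
          omega
        · by_cases e : c = a
          · rw [e, hf.1, g1.1]
          · rw [hf.2.2 c e h2, g1.2.2 c e h1]
        · have k1 := hL (a + 1)
          have k2 := hL a'
          rw [if_pos (by omega)] at k1
          rw [if_neg (by omega)] at k2
          omega
        · have k1 := hL c
          have k2 := hL a'
          rw [if_neg (by omega)] at k1 k2
          have := q'.2.2 c h1 (by omega)
          omega
        · by_cases e : c = b'
          · rw [e, g2.2.1, hf.2.1]
          · rw [g2.2.2 c h1 e, hf.2.2 c h2 e]
    rcases hc with hc | hc
    · obtain ⟨e1, e2, e3, e4, e5⟩ := main hc hf1 hf2 hf'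
      exact fin e1 e2 e3 e4 e5
    · obtain ⟨e1, e2, e3, e4, e5⟩ := main hc hf2 hf1 hf'.symm
      exact fin e1 e3.symm e2.symm e5.symm e4.symm

end GrassConormal

namespace GrassConormal

/-! ### Noncrossing matchings of the integers -/

/-- A perfect noncrossing matching of opening and closing positions. -/
structure Matching (op : ℤ → Prop) (s par : ℤ → ℤ) : Prop where
  invol : ∀ a, s (s a) = a
  lt : ∀ a, op a → a < s a
  gt : ∀ a, ¬ op a → s a < a
  op_s : ∀ a, op (s a) ↔ ¬ op a
  nested : ∀ a c, op a → op c → a < c → s a < c ∨ s c < s a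
  op_par : ∀ a, op a → op (par a)
  par_lt : ∀ a, op a → par a < a
  lt_par : ∀ a, op a → s a < s (par a)
  between : ∀ a e, op a → op e → par a < e → e < a → s e < a

variable {op : ℤ → Prop} {s par : ℤ → ℤ}

/-- For the placement p ↦ s (π p), a position (i, s e) is uncovered exactly if i < s e, s e < s (π
i) and π⁻¹ e < i. The crossing lemmas solve these inequalities; for π = 1 they describe two crossing
pairs. -/
theorem Matching.cross_none (M : Matching op s par) {i e : ℤ} (hi : op i) (he : op e)
    (h1 : i < s e) (h2 : s e < s i) (h3 : e < i) : False := by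
  have := M.nested e i he hi h3
  omega

theorem Matching.cross_single (M : Matching op s par) {a i e : ℤ} (ha : op a) (hi : op i)
    (he : op e) (h1 : i < s e) (h2 : s e < s (Equiv.swap (par a) a i))
    (h3 : Equiv.swap (par a) a e < i) : i = a ∧ e = a := by
  have p1 := M.par_lt a ha
  have p2 := M.lt_par a ha
  have := M.lt a ha
  have := M.nested e i he hi
  have := M.nested e a he ha
  have := M.nested a e ha he
  have := M.nested i a hi ha
  have := M.nested a i ha hi
  have := M.nested e _ he (M.op_par a ha)
  have := M.nested _ e (M.op_par a ha) he
  have := M.nested i _ hi (M.op_par a ha)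
  have := M.nested _ i (M.op_par a ha) hi
  have := M.between a i ha hi
  have := M.between a e ha he
  rw [Equiv.swap_apply_def] at h2 h3
  split_ifs at h2 h3 <;> subst_vars <;> omega

/-- The order of the inequalities among `i`, `e` and the ends of the exchanged pairs decides
everything, so the noncrossing conditions among these few pairs suffice. -/
theorem Matching.cross_double (M : Matching op s par) {a b i e : ℤ} (ha : op a) (hb : op b)
    (hab : a < b) (hc : a ≠ par b) (hi : op i)
    (he : op e) (h1 : i < s e)
    (h2 : s e < s (Equiv.swap (par b) b (Equiv.swap (par a) a i)))
    (h3 : Equiv.swap (par a) a (Equiv.swap (par b) b e) < i) : i = a ∧ e = a ∨ i = b ∧ e = b := by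
  have p1 := M.par_lt a ha
  have p2 := M.lt_par a ha
  have := M.lt a ha
  have p1 := M.par_lt b hb
  have p2 := M.lt_par b hb
  have := M.lt b hb
  have := M.nested a b ha hb hab
  have := M.nested e i he hi
  have := M.nested e a he ha
  have := M.nested a e ha he
  have := M.nested i a hi ha
  have := M.nested a i ha hi
  have := M.nested e _ he (M.op_par a ha)
  have := M.nested _ e (M.op_par a ha) he
  have := M.nested i _ hi (M.op_par a ha)
  have := M.nested _ i (M.op_par a ha) hi
  have := M.between a i ha hi
  have := M.between a e ha he
  have := M.nested e b he hb
  have := M.nested b e hb he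
  have := M.nested i b hi hb
  have := M.nested b i hb hi
  have := M.nested e _ he (M.op_par b hb)
  have := M.nested _ e (M.op_par b hb) he
  have := M.nested i _ hi (M.op_par b hb)
  have := M.nested _ i (M.op_par b hb) hi
  have := M.between b i hb hi
  have := M.between b e hb he
  have := M.between b a hb ha
  have := M.between b (par a) hb (M.op_par a ha)
  have := M.between a (par b) ha (M.op_par b hb)
  have := M.nested _ _ (M.op_par a ha) (M.op_par b hb)
  have := M.nested _ _ (M.op_par b hb) (M.op_par a ha)
  have := M.nested _ _ (M.op_par b hb) ha
  have := M.nested _ _ ha (M.op_par b hb)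
  have := M.nested _ _ (M.op_par a ha) hb
  rw [Equiv.swap_apply_def, Equiv.swap_apply_def (par a) a i] at h2
  rw [Equiv.swap_apply_def, Equiv.swap_apply_def (par b) b e] at h3
  split_ifs at h2 h3 <;> subst_vars <;> grind

/-- The exchanges of a pair with its parent and of the parent with the grandparent do not commute.
This order and the one in `cross_upper` produce the two tops over a parent and a child. -/
theorem Matching.cross_lower (M : Matching op s par) {a b i e : ℤ} (haa : par b = a) (hb : op b) (hi : op i)
    (he : op e) (h1 : i < s e)
    (h2 : s e < s (Equiv.swap a b (Equiv.swap (par a) a i)))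
    (h3 : Equiv.swap (par a) a (Equiv.swap a b e) < i) :
    i = b ∧ e = b ∨ i = a ∧ e = b := by
  have ha : op a := haa ▸ M.op_par b hb
  have p1 := M.par_lt a ha
  have p2 := M.lt_par a ha
  have := M.lt a ha
  have p1 := M.par_lt b hb
  have p2 := M.lt_par b hb
  have := M.lt b hb
  have := M.nested e i he hi
  have := M.nested e a he ha
  have := M.nested a e ha he
  have := M.nested i a hi ha
  have := M.nested a i ha hi
  have := M.nested e _ he (M.op_par a ha)
  have := M.nested _ e (M.op_par a ha) he
  have := M.nested i _ hi (M.op_par a ha)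
  have := M.nested _ i (M.op_par a ha) hi
  have := M.between a i ha hi
  have := M.between a e ha he
  have := M.nested e b he hb
  have := M.nested b e hb he
  have := M.nested i b hi hb
  have := M.nested b i hb hi
  have := M.between b i hb hi
  have := M.between b e hb he
  rw [Equiv.swap_apply_def, Equiv.swap_apply_def (par a) a i] at h2
  rw [Equiv.swap_apply_def, Equiv.swap_apply_def a b e] at h3
  split_ifs at h2 h3 <;> subst_vars <;> grind

theorem Matching.cross_upper (M : Matching op s par) {a b i e : ℤ} (haa : par b = a) (hb : op b) (hi : op i)
    (he : op e) (h1 : i < s e)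
    (h2 : s e < s (Equiv.swap (par a) a (Equiv.swap a b i)))
    (h3 : Equiv.swap a b (Equiv.swap (par a) a e) < i) :
    i = b ∧ e = b ∨ i = b ∧ e = a := by
  have ha : op a := haa ▸ M.op_par b hb
  have p1 := M.par_lt a ha
  have p2 := M.lt_par a ha
  have := M.lt a ha
  have p1 := M.par_lt b hb
  have p2 := M.lt_par b hb
  have := M.lt b hb
  have := M.nested e i he hi
  have := M.nested e a he ha
  have := M.nested a e ha he
  have := M.nested i a hi ha
  have := M.nested a i ha hi
  have := M.nested e _ he (M.op_par a ha)
  have := M.nested _ e (M.op_par a ha) he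
  have := M.nested i _ hi (M.op_par a ha)
  have := M.nested _ i (M.op_par a ha) hi
  have := M.between a i ha hi
  have := M.between a e ha he
  have := M.nested e b he hb
  have := M.nested b e hb he
  have := M.nested i b hi hb
  have := M.nested b i hb hi
  have := M.between b i hb hi
  have := M.between b e hb he
  rw [Equiv.swap_apply_def, Equiv.swap_apply_def a b i] at h2
  rw [Equiv.swap_apply_def, Equiv.swap_apply_def (par a) a e] at h3
  split_ifs at h2 h3 <;> subst_vars <;> grind

/-! The permutations of the opening positions that describe the rook placements of codimension
one and two. -/

/-- `π` moves the matching `s` to another matching `s ∘ π`. -/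
structure IsShift (op : ℤ → Prop) (s : ℤ → ℤ) (π : Equiv.Perm ℤ) : Prop where
  op_iff : ∀ i, op (π i) ↔ op i
  lt : ∀ i, op i → i < s (π i)

theorem Matching.op_swap (M : Matching op s par) {a : ℤ} (ha : op a) (i : ℤ) :
    op (Equiv.swap (par a) a i) ↔ op i := by
  have := M.op_par a ha
  rw [Equiv.swap_apply_def]
  split_ifs <;> subst_vars <;> simp [*]

theorem Matching.isShift_single (M : Matching op s par) {a : ℤ} (ha : op a) :
    IsShift op s (Equiv.swap (par a) a) := by
  refine ⟨M.op_swap ha, fun i hi => ?_⟩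
  have p1 := M.par_lt a ha
  have p2 := M.lt_par a ha
  have := M.lt a ha
  have := M.lt i hi
  rw [Equiv.swap_apply_def]
  split_ifs <;> subst_vars <;> omega

/-- The order of the factors matters if `a` and `b` have a common parent: row `a` then receives the
column `s b`, which lies to its right because `a < b`, while the opposite order would send row `b`
to `s a`. -/
theorem Matching.isShift_double (M : Matching op s par) {a b : ℤ} (ha : op a) (hb : op b)
    (hab : a < b) : IsShift op s (Equiv.swap (par b) b * Equiv.swap (par a) a) := by
  refine ⟨fun i => by rw [Equiv.Perm.mul_apply, M.op_swap hb, M.op_swap ha], fun i hi => ?_⟩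
  have p1 := M.par_lt a ha
  have p2 := M.lt_par a ha
  have := M.lt a ha
  have p1 := M.par_lt b hb
  have p2 := M.lt_par b hb
  have := M.lt b hb
  have := M.nested a b ha hb hab
  have := M.lt i hi
  rw [Equiv.Perm.mul_apply, Equiv.swap_apply_def, Equiv.swap_apply_def (par a) a i]
  split_ifs <;> subst_vars <;> grind

theorem Matching.isShift_upper (M : Matching op s par) {b : ℤ} (hb : op b) :
    IsShift op s (Equiv.swap (par (par b)) (par b) * Equiv.swap (par b) b) := by
  have ha := M.op_par b hb
  refine ⟨fun i => by rw [Equiv.Perm.mul_apply, M.op_swap ha, M.op_swap hb], fun i hi => ?_⟩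
  have p1 := M.par_lt _ ha
  have p2 := M.lt_par _ ha
  have := M.lt _ ha
  have p1 := M.par_lt b hb
  have p2 := M.lt_par b hb
  have := M.lt b hb
  have := M.lt i hi
  rw [Equiv.Perm.mul_apply, Equiv.swap_apply_def, Equiv.swap_apply_def (par b) b i]
  split_ifs <;> subst_vars <;> grind

/-- The permutation `π` preserves the interval of the pair of `x`. -/
def PreservesInterval (op : ℤ → Prop) (s : ℤ → ℤ) (x : ℤ) (π : Equiv.Perm ℤ) : Prop :=
  ∀ i, op i → (x ≤ π i ∧ π i ≤ s x ↔ x ≤ i ∧ i ≤ s x)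

/-- The parent is the nearest enclosing pair, so the interval of a pair other than that of `a`
contains both `a` and `par a` or neither. -/
theorem Matching.preservesInterval_swap (M : Matching op s par) {a x : ℤ} (ha : op a)
    (hx : op x) (hxa : x ≠ a) : PreservesInterval op s x (Equiv.swap (par a) a) := by
  intro i hi
  have p1 := M.par_lt a ha
  have p2 := M.lt_par a ha
  have := M.lt a ha
  have := M.between a x ha hx
  have := M.nested x a hx ha
  have := M.nested x _ hx (M.op_par a ha)
  have : s (par a) ≠ x := by
    rintro rfl
    exact (M.op_s _).1 hx (M.op_par a ha)
  have h3 : s x ≠ par a := by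
    intro h
    exact (M.op_s _).1 (h ▸ M.op_par a ha) hx
  have h4 : s x ≠ a := by
    rintro rfl
    exact (M.op_s _).1 ha hx
  rw [Equiv.swap_apply_def]
  split_ifs <;> subst_vars <;> grind

theorem Matching.preservesInterval_mul (M : Matching op s par) {a b x : ℤ} (ha : op a) (hb : op b)
    (hx : op x) (hxa : x ≠ a) (hxb : x ≠ b) :
    PreservesInterval op s x (Equiv.swap (par b) b * Equiv.swap (par a) a) := by
  intro i hi
  rw [Equiv.Perm.mul_apply, M.preservesInterval_swap hb hx hxb _ ((M.op_swap ha i).2 hi),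
    M.preservesInterval_swap ha hx hxa _ hi]

/-- Pairs in the interval of the pair of `x`. -/
theorem Matching.s_mem_interval (M : Matching op s par) {x i : ℤ} (hx : op x) (hi : op i)
    (h1 : x ≤ i) (h2 : i ≤ s x) : x ≤ s i ∧ s i ≤ s x := by
  have := M.lt i hi
  rcases h1.eq_or_lt with rfl | h1
  · omega
  · have := M.nested x i hx hi h1
    have h4 : s x ≠ i := by
      rintro rfl
      exact (M.op_s _).1 hi hx
    omega

end GrassConormal

namespace GrassConormal

/-! ### Rook placements -/

variable {n : ℕ}

/-- The positions of the matrix entries of the elements of the conormal space. -/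
def Pos (I : Set (Fin n)) (p q : Fin n) : Prop := p ∈ I ∧ q ∉ I ∧ p < q

/-- A rook placement. -/
structure IsRook (I : Set (Fin n)) (w : Fin n → Fin n → Prop) : Prop where
  pos : ∀ {p q}, w p q → Pos I p q
  right_unique : ∀ {p q q'}, w p q → w p q' → q = q'
  left_unique : ∀ {p p' q}, w p q → w p' q → p = p'

/-- The positions that have no rook weakly to the left and no rook weakly below. -/
def Uncov (I : Set (Fin n)) (w : Fin n → Fin n → Prop) : Set (Fin n × Fin n) :=
  {x | Pos I x.1 x.2 ∧ (∀ q ≤ x.2, ¬ w x.1 q) ∧ ∀ p, x.1 ≤ p → ¬ w p x.2}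

/-- The rooks in rows `≥ i` and columns `< j`. -/
def arcs (w : Fin n → Fin n → Prop) (i j : ℕ) : Set (Fin n × Fin n) :=
  {x | w x.1 x.2 ∧ i ≤ (x.1 : ℕ) ∧ (x.2 : ℕ) < j}

/-- The number of rooks in rows `≥ i` and columns `< j`. -/
noncomputable def count (w : Fin n → Fin n → Prop) (i j : ℕ) : ℕ := (arcs w i j).ncard

/-! ### Counts and uncovered positions as complete invariants of rook placements -/

variable {I : Set (Fin n)} {w w' : Fin n → Fin n → Prop}

/-- Induction on the distance q - p to the diagonal. The positions weakly to the left of and below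
(p, q), other than (p, q) itself, are nearer to the diagonal. -/
theorem rook_eq_of_step
    (h : ∀ p q : Fin n, (∀ p' q' : Fin n, (q' : ℤ) - p' < q - p → (w p' q' ↔ w' p' q')) →
      p < q → (w p q ↔ w' p q)) (hw : IsRook I w) (hw' : IsRook I w') : w = w' := by
  have key : ∀ d : ℕ, ∀ p q : Fin n, (q : ℤ) - p < d → (w p q ↔ w' p q) := by
    intro d
    induction d with
    | zero =>
      intro p q hd
      constructor
      · intro hpq
        have := (hw.pos hpq).2.2
        omega
      · intro hpq
        have := (hw'.pos hpq).2.2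
        omega
    | succ d ih =>
      intro p q hd
      rcases lt_or_ge p q with hlt | hge
      · exact h p q (fun p' q' hlt => ih p' q' (by push_cast at hd; omega)) hlt
      · constructor
        · intro hpq
          exact absurd (hw.pos hpq).2.2 (not_lt.2 hge)
        · intro hpq
          exact absurd (hw'.pos hpq).2.2 (not_lt.2 hge)
  funext p q
  exact propext (key ((q : ℤ) - p + 1).toNat p q (by omega))

theorem count_lt_of_agree {p q : Fin n}
    (h : ∀ p' q' : Fin n, (q' : ℤ) - p' < q - p → (w p' q' ↔ w' p' q'))
    (hpq : w p q) (hpq' : ¬ w' p q) :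
    count w' p (q + 1) < count w p (q + 1) := by
  apply Set.ncard_lt_ncard _ (Set.toFinite _)
  constructor
  · rintro ⟨p', q'⟩ ⟨h1, h2, h3⟩
    simp only at h1 h2 h3
    refine ⟨?_, h2, h3⟩
    by_cases he : p' = p ∧ q' = q
    · obtain ⟨rfl, rfl⟩ := he
      exact absurd h1 hpq'
    · refine (h p' q' ?_).2 h1
      have : (p' : ℕ) ≠ p ∨ (q' : ℕ) ≠ q := by
        by_contra hh
        push Not at hh
        exact he ⟨Fin.ext hh.1, Fin.ext hh.2⟩
      omega
  · intro hsub
    exact hpq' (hsub (show (p, q) ∈ arcs w p (q + 1) from ⟨hpq, le_rfl, Nat.lt_succ_self _⟩)).1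

theorem rook_eq_of_count (hw : IsRook I w) (hw' : IsRook I w')
    (h : ∀ i j, count w i j = count w' i j) : w = w' := by
  refine rook_eq_of_step (fun p q ih _ => ?_) hw hw'
  constructor
  · intro hpq
    by_contra hpq'
    have := count_lt_of_agree ih hpq hpq'
    rw [h] at this
    exact lt_irrefl _ this
  · intro hpq
    by_contra hpq'
    have := count_lt_of_agree (fun p' q' hlt => (ih p' q' hlt).symm) hpq hpq'
    rw [h] at this
    exact lt_irrefl _ this

/-- A rook of `w` covering (p, q) from the left or from below would be shared with `w'` by induction
and would conflict with the rook of `w'` at (p, q). So (p, q) would be uncovered in `w`, hence in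
`w'`, which has a rook there. -/
theorem rook_imp_of_uncov (hw' : IsRook I w') (h : Uncov I w ⊆ Uncov I w')
    {p q : Fin n}
    (ih : ∀ p' q' : Fin n, (q' : ℤ) - p' < q - p → (w p' q' ↔ w' p' q')) (hpq : w' p q) :
    w p q := by
  by_contra hne
  have hcov : (p, q) ∉ Uncov I w := by
    intro hu
    exact (h hu).2.1 q le_rfl hpq
  apply hcov
  refine ⟨hw'.pos hpq, fun q' hq' hw1 => ?_, fun p' hp' hw1 => ?_⟩
  · simp only at hw1 hq'
    have hlt : q' < q := lt_of_le_of_ne hq' (by rintro rfl; exact hne hw1)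
    have := (ih p q' (by omega)).1 hw1
    exact hlt.ne (hw'.right_unique this hpq)
  · simp only at hw1 hp'
    have hlt : p < p' := lt_of_le_of_ne hp' (by rintro rfl; exact hne hw1)
    have := (ih p' q (by omega)).1 hw1
    exact hlt.ne' (hw'.left_unique this hpq)

/-- A rook placement is determined by its uncovered positions. -/
theorem rook_eq_of_uncov (hw : IsRook I w) (hw' : IsRook I w') (h : Uncov I w = Uncov I w') :
    w = w' := by
  refine rook_eq_of_step (fun p q ih _ => ⟨fun hpq => ?_, fun hpq => ?_⟩) hw hw'
  · exact rook_imp_of_uncov hw h.ge (fun p' q' hlt => (ih p' q' hlt).symm) hpq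
  · exact rook_imp_of_uncov hw' h.le ih hpq

/-- Uncovered positions force the rooks of `w'` into `w`, counts force the rooks of `w` into `w'`.
This is the form in which the density criterion for orbits is verified. -/
theorem rook_eq_of_uncov_subset (hw : IsRook I w) (hw' : IsRook I w')
    (h : Uncov I w ⊆ Uncov I w') (hc : ∀ i j, count w i j ≤ count w' i j) : w = w' := by
  refine rook_eq_of_step (fun p q ih _ => ⟨fun hpq => ?_, fun hpq => ?_⟩) hw hw'
  · by_contra hpq'
    exact absurd (hc p (q + 1)) (not_le.2 (count_lt_of_agree ih hpq hpq'))
  · exact rook_imp_of_uncov hw' h ih hpq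

/-- Equal counts with and without row `p` exclude rooks to the left, and with and without column `q`
rooks below. Being uncovered is thus visible in the ranks. -/
theorem mem_uncov_of_count {p q : Fin n} (hpos : Pos I p q)
    (h1 : count w (p + 1) (q + 1) = count w p (q + 1)) (h2 : count w p q = count w p (q + 1)) :
    (p, q) ∈ Uncov I w := by
  refine ⟨hpos, fun q' hq' hw1 => ?_, fun p' hp' hw1 => ?_⟩
  · simp only at hw1 hq'
    have hsub : arcs w (p + 1) (q + 1) ⊆ arcs w p (q + 1) :=
      fun x hx => ⟨hx.1, by have := hx.2.1; omega, hx.2.2⟩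
    have := Set.eq_of_subset_of_ncard_le hsub h1.ge (Set.toFinite _)
    have hm : (p, q') ∈ arcs w p (q + 1) := ⟨hw1, le_rfl, Nat.lt_succ_of_le hq'⟩
    rw [← this] at hm
    have := hm.2.1
    simp at this
  · simp only at hw1 hp'
    have hsub : arcs w p q ⊆ arcs w p (q + 1) :=
      fun x hx => ⟨hx.1, hx.2.1, by have := hx.2.2; omega⟩
    have := Set.eq_of_subset_of_ncard_le hsub h2.ge (Set.toFinite _)
    have hm : (p', q) ∈ arcs w p (q + 1) := ⟨hw1, hp', Nat.lt_succ_self _⟩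
    rw [← this] at hm
    have := hm.2.2
    simp at this

/-! ### Intervals filled by rooks -/

/-- The rows that meet the interval from `e` to `f`. -/
def opens (I : Set (Fin n)) (e f : Fin n) : Set (Fin n) := {p | p ∈ I ∧ e ≤ p ∧ p ≤ f}

/-- The columns that meet the interval from `e` to `f`. -/
def closes (I : Set (Fin n)) (e f : Fin n) : Set (Fin n) := {q | q ∉ I ∧ e ≤ q ∧ q ≤ f}

/-- Rooks in rows from `e` on and columns up to `f` lie above the diagonal, hence inside the
interval. Equality means that every row of the interval is matched inside it, a condition inherited
by placements with larger counts. -/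
theorem count_le_opens (hw : IsRook I w) (e f : Fin n) :
    count w e (f + 1) ≤ (opens I e f).ncard := by
  refine Set.ncard_le_ncard_of_injOn Prod.fst ?_ ?_ (Set.toFinite _)
  · rintro ⟨p, q⟩ ⟨h1, h2, h3⟩
    simp only at h1 h2 h3
    have := (hw.pos h1).2.2
    exact ⟨(hw.pos h1).1, h2, by simp only; omega⟩
  · rintro ⟨p, q⟩ ⟨h1, h2, h3⟩ ⟨p', q'⟩ ⟨h1', h2', h3'⟩ he
    simp only at h1 h1' he
    subst he
    rw [hw.right_unique h1 h1']

theorem exists_of_opens_le (hw : IsRook I w) {e f : Fin n}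
    (h : (opens I e f).ncard ≤ count w e (f + 1)) {p : Fin n} (hp : p ∈ opens I e f) :
    ∃ q ≤ f, w p q := by
  have himg : Prod.fst '' arcs w e (f + 1) = opens I e f := by
    apply Set.eq_of_subset_of_ncard_le _ _ (Set.toFinite _)
    · rintro _ ⟨⟨p, q⟩, ⟨h1, h2, h3⟩, rfl⟩
      simp only at h1 h2 h3
      have := (hw.pos h1).2.2
      exact ⟨(hw.pos h1).1, h2, by simp only; omega⟩
    · rw [Set.InjOn.ncard_image]
      · exact h
      · rintro ⟨p, q⟩ ⟨h1, h2, h3⟩ ⟨p', q'⟩ ⟨h1', h2', h3'⟩ he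
        simp only at h1 h1' he
        subst he
        rw [hw.right_unique h1 h1']
  rw [← himg] at hp
  obtain ⟨⟨p, q⟩, ⟨h1, h2, h3⟩, rfl⟩ := hp
  exact ⟨q, Nat.le_of_lt_succ h3, h1⟩

theorem opens_le_count {e f : Fin n} (h : ∀ p ∈ opens I e f, ∃ q ≤ f, w p q) :
    (opens I e f).ncard ≤ count w e (f + 1) := by
  choose! g hg using h
  refine Set.ncard_le_ncard_of_injOn (fun p => (p, g p)) ?_ ?_ (Set.toFinite _)
  · intro p hp
    exact ⟨(hg p hp).2, hp.2.1, Nat.lt_succ_of_le (hg p hp).1⟩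
  · intro p _ p' _ he
    exact congrArg Prod.fst he

theorem exists_of_closes_le (hw : IsRook I w) {e f : Fin n}
    (h : (closes I e f).ncard ≤ count w e (f + 1)) {q : Fin n} (hq : q ∈ closes I e f) :
    ∃ p, e ≤ p ∧ w p q := by
  have himg : Prod.snd '' arcs w e (f + 1) = closes I e f := by
    apply Set.eq_of_subset_of_ncard_le _ _ (Set.toFinite _)
    · rintro _ ⟨⟨p, q⟩, ⟨h1, h2, h3⟩, rfl⟩
      simp only at h1 h2 h3
      have := (hw.pos h1).2.2
      exact ⟨(hw.pos h1).2.1, by simp only; omega, by simp only; omega⟩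
    · rw [Set.InjOn.ncard_image]
      · exact h
      · rintro ⟨p, q⟩ ⟨h1, h2, h3⟩ ⟨p', q'⟩ ⟨h1', h2', h3'⟩ he
        simp only at h1 h1' he
        subst he
        rw [hw.left_unique h1 h1']
  rw [← himg] at hq
  obtain ⟨⟨p, q⟩, ⟨h1, h2, h3⟩, rfl⟩ := hq
  exact ⟨p, h2, h1⟩

theorem closes_le_count {e f : Fin n} (h : ∀ q ∈ closes I e f, ∃ p, e ≤ p ∧ w p q) :
    (closes I e f).ncard ≤ count w e (f + 1) := by
  choose! g hg using h
  refine Set.ncard_le_ncard_of_injOn (fun q => (g q, q)) ?_ ?_ (Set.toFinite _)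
  · intro q hq
    exact ⟨(hg q hq).2, (hg q hq).1, Nat.lt_succ_of_le hq.2.2⟩
  · intro p _ p' _ he
    exact congrArg Prod.snd he

/-- If `(e, f)` is uncovered, the rooks do not fill the interval from `e` to `f`. -/
theorem count_lt_opens_of_mem_uncov (hw : IsRook I w) {e f : Fin n} (h : (e, f) ∈ Uncov I w) :
    count w e (f + 1) < (opens I e f).ncard := by
  refine lt_of_le_of_ne (count_le_opens hw e f) fun he => ?_
  obtain ⟨q, hq, hwq⟩ := exists_of_opens_le hw he.ge (p := e) ⟨h.1.1, le_rfl, h.1.2.2.le⟩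
  exact h.2.1 q hq hwq

/-! ### Rook placements from matchings -/

variable {op : ℤ → Prop} {s par : ℤ → ℤ} {π : Equiv.Perm ℤ}

/-- The matching `s` of the integers restricts to the word of `I`. -/
structure MatchingOn (I : Set (Fin n)) (op : ℤ → Prop) (s par : ℤ → ℤ) : Prop
    extends Matching op s par where
  mem_iff : ∀ p : Fin n, p ∈ I ↔ op p

/-- The rook placement given by a permutation of the opening positions. -/
def rookOf (I : Set (Fin n)) (s : ℤ → ℤ) (π : Equiv.Perm ℤ) (p q : Fin n) : Prop :=
  Pos I p q ∧ s (π p) = q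

theorem MatchingOn.isRook_rookOf (M : MatchingOn I op s par) : IsRook I (rookOf I s π) where
  pos h := h.1
  right_unique h h' := by
    have := h.2.symm.trans h'.2
    exact Fin.ext (by omega)
  left_unique {p p' q} h h' := by
    have h1 := h.2.trans h'.2.symm
    have h2 := congrArg s h1
    rw [M.invol, M.invol] at h2
    have := π.injective h2
    exact Fin.ext (by omega)

theorem MatchingOn.rookOf_of_lt (M : MatchingOn I op s par) (hπ : IsShift op s π) {p : Fin n}
    (hp : p ∈ I) (h : s (π p) < n) : ∃ q : Fin n, (q : ℤ) = s (π p) ∧ rookOf I s π p q := by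
  have h1 := (M.mem_iff p).1 hp
  have h2 := hπ.lt p h1
  refine ⟨⟨(s (π p)).toNat, by omega⟩, ?_, ⟨hp, ?_, ?_⟩, ?_⟩
  · simp only
    omega
  · rw [M.mem_iff]
    have : ((⟨(s (π p)).toNat, by omega⟩ : Fin n) : ℤ) = s (π p) := by simp only; omega
    rw [this, M.op_s, hπ.op_iff, not_not]
    exact h1
  · rw [Fin.lt_def]
    simp only
    omega
  · simp only
    omega

theorem MatchingOn.rookOf_of_ge (M : MatchingOn I op s par) (hπ : IsShift op s π) {q : Fin n}
    (hq : q ∉ I) (h : 0 ≤ π.symm (s q)) :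
    ∃ p : Fin n, (p : ℤ) = π.symm (s q) ∧ rookOf I s π p q := by
  have h1 : op (s q) := (M.op_s _).2 (fun h => hq ((M.mem_iff q).2 h))
  have h2 : op (π.symm (s q)) := by rw [← hπ.op_iff, Equiv.apply_symm_apply]; exact h1
  have h3 := hπ.lt _ h2
  rw [Equiv.apply_symm_apply, M.invol] at h3
  have e : ((⟨(π.symm (s q)).toNat, by omega⟩ : Fin n) : ℤ) = π.symm (s q) := by simp only; omega
  refine ⟨⟨(π.symm (s q)).toNat, by omega⟩, e, ⟨?_, hq, ?_⟩, ?_⟩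
  · rw [M.mem_iff, e]
    exact h2
  · rw [Fin.lt_def]
    simp only
    omega
  · rw [e, Equiv.apply_symm_apply, M.invol]

/-- Stated for placements that merely contain `rookOf`, so that an arbitrary placement can be
compared with one of the model placements. -/
theorem MatchingOn.lt_of_mem_uncov (M : MatchingOn I op s par) (hπ : IsShift op s π)
    (hsub : ∀ p q, rookOf I s π p q → w p q) {p q : Fin n} (h : (p, q) ∈ Uncov I w) :
    (q : ℤ) < s (π p) ∧ π.symm (s q) < p := by
  obtain ⟨⟨hp, hq, hpq⟩, h1, h2⟩ := h
  simp only at hp hq hpq h1 h2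
  constructor
  · by_contra hle
    obtain ⟨q', hq', hw⟩ := M.rookOf_of_lt hπ hp (by omega)
    exact h1 q' (by omega) (hsub _ _ hw)
  · by_contra hle
    obtain ⟨p', hp', hw⟩ := M.rookOf_of_ge hπ hq (by omega)
    exact h2 p' (by omega) (hsub _ _ hw)

theorem MatchingOn.mem_uncov_rookOf (M : MatchingOn I op s par) {p q : Fin n} (hpos : Pos I p q)
    (h1 : (q : ℤ) < s (π p)) (h2 : π.symm (s q) < p) : (p, q) ∈ Uncov I (rookOf I s π) := by
  refine ⟨hpos, fun q' hq' hw => ?_, fun p' hp' hw => ?_⟩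
  · simp only at hq' hw
    have := hw.2
    omega
  · simp only at hp' hw
    have h3 := hw.2
    have h4 : π p' = s q := by rw [← h3, M.invol]
    rw [← h4, Equiv.symm_apply_apply] at h2
    omega

/-- Neither `π` nor `s` leads out of the interval, so its rows receive columns from it. -/
theorem MatchingOn.fill_opens (M : MatchingOn I op s par) (hπ : IsShift op s π) {e f : Fin n}
    (he : e ∈ I) (hf : s e = f) (hpi : PreservesInterval op s e π) :
    ∀ p ∈ opens I e f, ∃ q ≤ f, rookOf I s π p q := by
  rintro p ⟨hp, h1, h2⟩
  have hop := (M.mem_iff p).1 hp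
  have hin := (hpi p hop).2 ⟨by omega, by omega⟩
  have := M.s_mem_interval ((M.mem_iff e).1 he) ((hπ.op_iff _).2 hop) hin.1 hin.2
  obtain ⟨q, hq, hw⟩ := M.rookOf_of_lt hπ hp (by omega)
  exact ⟨q, by omega, hw⟩

theorem MatchingOn.fill_closes (M : MatchingOn I op s par) (hπ : IsShift op s π) {e f : Fin n}
    (he : e ∈ I) (hf : s e = f) (hpi : PreservesInterval op s e π) :
    ∀ q ∈ closes I e f, ∃ p, e ≤ p ∧ rookOf I s π p q := by
  rintro q ⟨hq, h1, h2⟩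
  have hop : ¬ op q := fun h => hq ((M.mem_iff q).2 h)
  have hope := (M.mem_iff e).1 he
  have hops : op (s q) := (M.op_s _).2 hop
  have hops' : op (π.symm (s q)) := by rw [← hπ.op_iff, Equiv.apply_symm_apply]; exact hops
  have hlt := M.gt _ hop
  have hin : (e : ℤ) ≤ s q ∧ s q ≤ s e := by
    refine ⟨?_, by omega⟩
    by_contra hlt'
    have := M.nested (s q) e hops hope (by omega)
    rw [M.invol] at this
    have : (q : ℤ) ≠ e := fun h => hop (h ▸ hope)
    omega
  have hin' := (hpi _ hops').1 (by rw [Equiv.apply_symm_apply]; exact hin)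
  obtain ⟨p, hp, hw⟩ := M.rookOf_of_ge hπ hq (by omega)
  exact ⟨p, by omega, hw⟩

/-! ### Rook placements with one or two uncovered positions -/

/-- `(i, j)` is an uncovered position, written with integers. -/
def UncovAt (I : Set (Fin n)) (w : Fin n → Fin n → Prop) (i j : ℤ) : Prop :=
  ∃ p q : Fin n, (p : ℤ) = i ∧ (q : ℤ) = j ∧ (p, q) ∈ Uncov I w

/-- `(i, j)` is a rook, written with integers. -/
def RookAt (w : Fin n → Fin n → Prop) (i j : ℤ) : Prop :=
  ∃ p q : Fin n, (p : ℤ) = i ∧ (q : ℤ) = j ∧ w p q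

theorem uncovAt_coe {p q : Fin n} : UncovAt I w p q ↔ (p, q) ∈ Uncov I w := by
  constructor
  · rintro ⟨p', q', h1, h2, h3⟩
    obtain rfl : p' = p := Fin.ext (by omega)
    obtain rfl : q' = q := Fin.ext (by omega)
    exact h3
  · intro h
    exact ⟨p, q, rfl, rfl, h⟩

theorem uncov_eq_of_uncovAt (h : ∀ i j, UncovAt I w i j ↔ UncovAt I w' i j) :
    Uncov I w = Uncov I w' := by
  ext ⟨p, q⟩
  rw [← uncovAt_coe, h, uncovAt_coe]

theorem MatchingOn.rookAt_spec (M : MatchingOn I op s par) (hw : IsRook I w) {i j : ℤ} (h : RookAt w i j) :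
    op i ∧ ¬ op j ∧ 0 ≤ i ∧ i < j ∧ j < n := by
  obtain ⟨p, q, rfl, rfl, h⟩ := h
  obtain ⟨h1, h2, h3⟩ := hw.pos h
  rw [M.mem_iff] at h1 h2
  exact ⟨h1, h2, by omega, by omega, by omega⟩

theorem rookAt_right (hw : IsRook I w) {i j j' : ℤ} (h : RookAt w i j) (h' : RookAt w i j') : j = j' := by
  obtain ⟨p, q, rfl, rfl, h⟩ := h
  obtain ⟨p', q', hp, rfl, h'⟩ := h'
  obtain rfl : p' = p := Fin.ext (by omega)
  rw [hw.right_unique h h']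

theorem rookAt_left (hw : IsRook I w) {i i' j : ℤ} (h : RookAt w i j) (h' : RookAt w i' j) : i = i' := by
  obtain ⟨p, q, rfl, rfl, h⟩ := h
  obtain ⟨p', q', rfl, hq, h'⟩ := h'
  obtain rfl : q' = q := Fin.ext (by omega)
  rw [hw.left_unique h h']

theorem MatchingOn.uncovAt_iff (M : MatchingOn I op s par) {i j : ℤ} : UncovAt I w i j ↔
    op i ∧ ¬ op j ∧ 0 ≤ i ∧ i < j ∧ j < n ∧ (∀ j' ≤ j, ¬ RookAt w i j') ∧
      ∀ i', i ≤ i' → ¬ RookAt w i' j := by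
  constructor
  · rintro ⟨p, q, rfl, rfl, ⟨h1, h2, h3⟩, h4, h5⟩
    simp only at h1 h2 h3 h4 h5
    rw [M.mem_iff] at h1 h2
    refine ⟨h1, h2, by omega, by omega, by omega, ?_, ?_⟩
    · rintro _ hle ⟨p', q', hp, rfl, h⟩
      obtain rfl : p' = p := Fin.ext (by omega)
      exact h4 q' (by omega) h
    · rintro _ hle ⟨p', q', rfl, hq, h⟩
      obtain rfl : q' = q := Fin.ext (by omega)
      exact h5 p' (by omega) h
  · rintro ⟨h1, h2, h3, h4, h5, h6, h7⟩
    have e1 : ((⟨i.toNat, by omega⟩ : Fin n) : ℤ) = i := by simp only; omega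
    have e2 : ((⟨j.toNat, by omega⟩ : Fin n) : ℤ) = j := by simp only; omega
    refine ⟨⟨i.toNat, by omega⟩, ⟨j.toNat, by omega⟩, e1, e2, ⟨?_, ?_, ?_⟩, ?_, ?_⟩
    · rw [M.mem_iff, e1]
      exact h1
    · rw [M.mem_iff, e2]
      exact h2
    · rw [Fin.lt_def]
      simp only
      omega
    · rintro q' hq' h
      simp only [Fin.le_def] at hq' h
      exact h6 q' (by omega) ⟨_, q', e1, rfl, h⟩
    · rintro p' hp' h
      simp only [Fin.le_def] at hp' h
      exact h7 p' (by omega) ⟨p', _, rfl, e2, h⟩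

/-- A pair which is not a rook is uncovered if everything inside is matched inside. -/
theorem MatchingOn.uncovAt_of_inside (M : MatchingOn I op s par) (hw : IsRook I w) {x : ℤ} (hx : op x) (h0 : 0 ≤ x) (hn : s x < n)
    (hxx : ¬ RookAt w x (s x))
    (hin : ∀ y, op y → x < y → s y < s x →
      (∃ j, RookAt w y j ∧ j < s x) ∧ ∃ i, RookAt w i (s y) ∧ x < i) :
    UncovAt I w x (s x) := by
  have hlt := M.lt x hx
  refine (M.uncovAt_iff).2 ⟨hx, fun h => (M.op_s x).1 h hx, h0, hlt, hn, ?_, ?_⟩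
  · intro j hj h
    obtain ⟨-, g2, g3, g4, g5⟩ := M.rookAt_spec hw h
    rcases hj.eq_or_lt with rfl | hj
    · exact hxx h
    have hop : op (s j) := (M.op_s j).2 g2
    have h1 := M.nested (s j) x hop hx
    have h2 := M.nested x (s j) hx hop
    rw [M.invol] at h1 h2
    have h3 : s j ≠ x := by
      rintro h
      have := congrArg s h
      rw [M.invol] at this
      omega
    have := M.gt j g2
    obtain ⟨-, i, hi, hxi⟩ := hin (s j) hop (by omega) (by rw [M.invol]; omega)
    rw [M.invol] at hi
    have := rookAt_left hw hi h
    omega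
  · intro i hi h
    obtain ⟨g1, g2, g3, g4, g5⟩ := M.rookAt_spec hw h
    rcases hi.eq_or_lt with rfl | hi
    · exact hxx h
    have := M.nested x i hx g1 hi
    obtain ⟨⟨j, hj, hjx⟩, -⟩ := hin i g1 hi (by omega)
    have := rookAt_right hw hj h
    omega

/-- Rooks at the pair of `a` and its parent when nothing there is uncovered. -/
theorem MatchingOn.rookAt_cross (M : MatchingOn I op s par) (hw : IsRook I w) {a : ℤ} (ha : op a) (haa : ¬ RookAt w a (s a))
    (hin : ∀ e, op e → e ≠ a → par a < e → s e < s (par a) → 0 ≤ e → s e < n →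
      RookAt w e (s e)) :
    (0 ≤ par a → s a < n → ¬ UncovAt I w (par a) (s a) → RookAt w (par a) (s a)) ∧
      (0 ≤ a → s (par a) < n → ¬ UncovAt I w a (s (par a)) → RookAt w a (s (par a))) := by
  have p0 := M.op_par a ha
  have p1 := M.par_lt a ha
  have p2 := M.lt_par a ha
  have p3 := M.lt a ha
  have ns : ∀ x, op x → ¬ op (s x) := fun x hx h => (M.op_s x).1 h hx
  constructor
  · intro h0 hn hu
    rw [M.uncovAt_iff] at hu
    by_contra hcon
    refine hu ⟨p0, ns a ha, h0, by omega, hn, fun j hj h => ?_, fun i hi h => ?_⟩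
    -- A rook covering the crossing position would sit in the column of a pair inside the parent,
    -- and such a column is already taken by the rook of its own pair.
    · obtain ⟨-, g2, g3, g4, g5⟩ := M.rookAt_spec hw h
      rcases hj.eq_or_lt with rfl | hj
      · exact hcon h
      have hop : op (s j) := (M.op_s j).2 g2
      have h1 := M.nested (s j) (par a) hop p0
      have h2 := M.nested (par a) (s j) p0 hop
      rw [M.invol] at h1 h2
      have h3 : s j ≠ par a := by
        rintro h
        have := congrArg s h
        rw [M.invol] at this
        omega
      have h4 : s j ≠ a := by
        rintro h
        have := congrArg s h
        rw [M.invol] at this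
        omega
      have := M.gt j g2
      have hr := hin (s j) hop h4 (by omega) (by rw [M.invol]; omega) (by omega)
        (by rw [M.invol]; omega)
      rw [M.invol] at hr
      exact h3 (rookAt_left hw hr h)
    · obtain ⟨g1, g2, g3, g4, g5⟩ := M.rookAt_spec hw h
      rcases hi.eq_or_lt with rfl | hi
      · exact hcon h
      have hia : i ≠ a := by
        rintro rfl
        exact haa h
      have h1 := M.between a i ha g1 hi
      have h2 := M.nested a i ha g1
      have hr := hin i g1 hia hi (by omega) (by omega) (by omega)
      have h3 := rookAt_right hw hr h
      have := congrArg s h3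
      rw [M.invol, M.invol] at this
      exact hia this
  · intro h0 hn hu
    rw [M.uncovAt_iff] at hu
    by_contra hcon
    refine hu ⟨ha, ns _ p0, h0, by omega, hn, fun j hj h => ?_, fun i hi h => ?_⟩
    · obtain ⟨-, g2, g3, g4, g5⟩ := M.rookAt_spec hw h
      rcases hj.eq_or_lt with rfl | hj
      · exact hcon h
      have hop : op (s j) := (M.op_s j).2 g2
      have h1 := M.nested (s j) (par a) hop p0
      have h2 := M.nested (par a) (s j) p0 hop
      have h5 := M.between a (s j) ha hop
      rw [M.invol] at h1 h2 h5
      have h3 : s j ≠ par a := by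
        rintro h
        have := congrArg s h
        rw [M.invol] at this
        omega
      have h4 : s j ≠ a := by
        rintro h'
        have := congrArg s h'
        rw [M.invol] at this
        rw [this] at h
        exact haa h
      have := M.gt j g2
      have hr := hin (s j) hop h4 (by omega) (by rw [M.invol]; omega) (by omega)
        (by rw [M.invol]; omega)
      rw [M.invol] at hr
      exact h4 (rookAt_left hw hr h)
    · obtain ⟨g1, g2, g3, g4, g5⟩ := M.rookAt_spec hw h
      rcases hi.eq_or_lt with rfl | hi
      · exact hcon h
      have h2 := M.nested (par a) i p0 g1 (by omega)
      have hr := hin i g1 (by omega) (by omega) (by omega) (by omega) (by omega)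
      have h3 := rookAt_right hw hr h
      have := congrArg s h3
      rw [M.invol, M.invol] at this
      omega

theorem MatchingOn.exists_shortest (M : MatchingOn I op s par) {D : ℤ → Prop} (hD : ∃ x, D x) (hop : ∀ x, D x → op x) :
    ∃ x, D x ∧ ∀ y, D y → s x - x ≤ s y - y := by
  obtain ⟨x, hx, hmin⟩ := WellFounded.has_min (measure fun x : ℤ => (s x - x).toNat).wf
    {x | D x} hD
  refine ⟨x, hx, fun y hy => ?_⟩
  have h1 : ¬ ((s y - y).toNat < (s x - x).toNat) := hmin y hy
  have := M.lt x (hop x hx)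
  have := M.lt y (hop y hy)
  omega

/-- A shortest pair in the range that is not a rook. -/
theorem MatchingOn.exists_first (M : MatchingOn I op s par) (hw : IsRook I w) (hne : ∃ i j, UncovAt I w i j) :
    ∃ a, op a ∧ 0 ≤ a ∧ s a < n ∧ ¬ RookAt w a (s a) ∧ UncovAt I w a (s a) ∧
      ∀ y, op y → a < y → s y < s a → RookAt w y (s y) := by
  have hex : ∃ x, op x ∧ 0 ≤ x ∧ s x < n ∧ ¬ RookAt w x (s x) := by
    by_contra hno
    push Not at hno
    obtain ⟨i, j, hij⟩ := hne
    obtain ⟨h1, h2, h3, h4, h5, h6, h7⟩ := (M.uncovAt_iff).1 hij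
    have hop : op (s j) := (M.op_s j).2 h2
    have hlt := M.gt j h2
    -- If all pairs in the range were rooks, the partners of `i` and `j` would have to lie beyond
    -- (i, j) for that position to be uncovered, so the two pairs would cross.
    refine M.cross_none h1 hop (by rw [M.invol]; exact h4) ?_ ?_
    · rw [M.invol]
      by_contra hle
      exact h6 (s i) (by omega) (hno i h1 h3 (by omega))
    · by_contra hle
      have := hno (s j) hop (by omega) (by rw [M.invol]; exact h5)
      rw [M.invol] at this
      exact h7 (s j) (by omega) this
  obtain ⟨a, ⟨h1, h2, h3, h4⟩, hmin⟩ := M.exists_shortest hex fun x hx => hx.1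
  have hin : ∀ y, op y → a < y → s y < s a → RookAt w y (s y) := by
    intro y hy hay hya
    by_contra hno
    have := hmin y ⟨hy, by omega, by omega, hno⟩
    omega
  refine ⟨a, h1, h2, h3, h4, M.uncovAt_of_inside hw h1 h2 h3 h4 fun y hy hay hya => ?_, hin⟩
  exact ⟨⟨_, hin y hy hay hya, hya⟩, ⟨_, hin y hy hay hya, hay⟩⟩

/-- The uncovered sets with two elements. -/
theorem MatchingOn.classify_two (M : MatchingOn I op s par) (hw : IsRook I w) {x y : Fin n × Fin n} (hxy : x ≠ y) (hU : Uncov I w = {x, y}) :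
    ∃ a b, op a ∧ op b ∧
      ((a < b ∧ a ≠ par b ∧ 0 ≤ a ∧ s a < n ∧ 0 ≤ b ∧ s b < n ∧
          ∀ i j, UncovAt I w i j ↔ (i = a ∧ j = s a) ∨ (i = b ∧ j = s b)) ∨
        (par b = a ∧ 0 ≤ a ∧ s b < n ∧
          ∀ i j, UncovAt I w i j ↔ (i = b ∧ j = s b) ∨ (i = a ∧ j = s b)) ∨
        (par b = a ∧ 0 ≤ b ∧ s a < n ∧
          ∀ i j, UncovAt I w i j ↔ (i = b ∧ j = s b) ∨ (i = b ∧ j = s a))) := by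
  have hUx : UncovAt I w x.1 x.2 := uncovAt_coe.2 (by rw [hU]; simp)
  have hUy : UncovAt I w y.1 y.2 := uncovAt_coe.2 (by rw [hU]; simp)
  have two : ∀ i j, UncovAt I w i j → (i = x.1 ∧ j = x.2) ∨ (i = y.1 ∧ j = y.2) := by
    rintro _ _ ⟨p, q, rfl, rfl, h⟩
    rw [hU] at h
    rcases h with h | h
    · left
      rw [← h]
      exact ⟨rfl, rfl⟩
    · right
      rw [Set.mem_singleton_iff] at h
      rw [← h]
      exact ⟨rfl, rfl⟩
  have hne : (x.1 : ℤ) ≠ y.1 ∨ (x.2 : ℤ) ≠ y.2 := by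
    by_contra hcon
    push Not at hcon
    exact hxy (Prod.ext (Fin.ext (by omega)) (Fin.ext (by omega)))
  have exhaust : ∀ {i j i' j' : ℤ}, UncovAt I w i j → UncovAt I w i' j' → (i ≠ i' ∨ j ≠ j') →
      ∀ u v, UncovAt I w u v ↔ (u = i ∧ v = j) ∨ (u = i' ∧ v = j') := by
    intro i j i' j' h h' hd u v
    have t1 := two _ _ h
    have t2 := two _ _ h'
    constructor
    · intro hu
      have t3 := two _ _ hu
      omega
    · rintro (⟨rfl, rfl⟩ | ⟨rfl, rfl⟩)
      · exact h
      · exact h'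
  obtain ⟨a, ha, ha0, han, haa, hau, hain⟩ := M.exists_first hw ⟨_, _, hUx⟩
  have p0 := M.op_par a ha
  have p1 := M.par_lt a ha
  have p2 := M.lt_par a ha
  have p3 := M.lt a ha
  -- The shortest pair that is not a rook is uncovered. If one of its two crossings with the parent
  -- is also uncovered, the set is complete.
  by_cases hB1 : UncovAt I w (par a) (s a)
  · have h := (M.uncovAt_iff).1 hB1
    exact ⟨par a, a, p0, ha, Or.inr (Or.inl ⟨rfl, h.2.2.1, han,
      exhaust hau hB1 (Or.inl (by omega))⟩)⟩
  by_cases hB2 : UncovAt I w a (s (par a))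
  · have h := (M.uncovAt_iff).1 hB2
    exact ⟨par a, a, p0, ha, Or.inr (Or.inr ⟨rfl, ha0, h.2.2.2.2.1,
      exhaust hau hB2 (Or.inr (by omega))⟩)⟩
  -- The pair of `par a` is left out: when the crossings of `a` and its parent are rooks, it is not
  -- a rook although nothing else is uncovered.
  by_cases hD : ∃ b, op b ∧ 0 ≤ b ∧ s b < n ∧ ¬ RookAt w b (s b) ∧ b ≠ a ∧ b ≠ par a
  · obtain ⟨b, ⟨hb, hb0, hbn, hbb, hba, hbp⟩, hmin⟩ := M.exists_shortest hD fun x hx => hx.1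
    have q3 := M.lt b hb
    have hin : ∀ e, op e → e ≠ a → e ≠ par a → b < e → s e < s b → RookAt w e (s e) := by
      intro e he h1 h2 h3 h4
      by_contra hno
      have := hmin e ⟨he, by omega, by omega, hno, h1, h2⟩
      omega
    by_cases hnest : b < a ∧ s a < s b
    -- An interval containing the pair of `a` strictly contains its parent as well, and there the
    -- two crossed rooks replace the missing pairs.
    · have r1 := M.between a b ha hb
      have r2 := M.nested b (par a) hb p0
      have hbpa : b < par a := by omega
      have hpab : s (par a) < s b := by omega
      obtain ⟨k1, k2⟩ := M.rookAt_cross hw ha haa fun e he hea h1 h2 _ _ =>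
        hin e he hea (by omega) (by omega) (by omega)
      have k1 := k1 (by omega) han hB1
      have k2 := k2 ha0 (by omega) hB2
      have hub : UncovAt I w b (s b) := by
        refine M.uncovAt_of_inside hw hb hb0 hbn hbb fun y hy h1 h2 => ?_
        by_cases hya : y = a
        · subst hya
          exact ⟨⟨_, k2, hpab⟩, ⟨_, k1, hbpa⟩⟩
        by_cases hyp : y = par a
        · subst hyp
          exact ⟨⟨_, k1, by omega⟩, ⟨_, k2, by omega⟩⟩
        · have := hin y hy hya hyp h1 h2
          exact ⟨⟨_, this, h2⟩, ⟨_, this, h1⟩⟩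
      exact ⟨b, a, hb, ha, Or.inl ⟨by omega, by omega, hb0, hbn, ha0, han,
        exhaust hub hau (Or.inl (by omega))⟩⟩
    · have hub : UncovAt I w b (s b) := by
        refine M.uncovAt_of_inside hw hb hb0 hbn hbb fun y hy h1 h2 => ?_
        have := hin y hy (by rintro rfl; omega) (by rintro rfl; omega) h1 h2
        exact ⟨⟨_, this, h2⟩, ⟨_, this, h1⟩⟩
      rcases lt_or_gt_of_ne hba with hlt | hlt
      · exact ⟨b, a, hb, ha, Or.inl ⟨hlt, hbp, hb0, hbn, ha0, han,
          exhaust hub hau (Or.inl (by omega))⟩⟩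
      · refine ⟨a, b, ha, hb, Or.inl ⟨hlt, ?_, ha0, han, hb0, hbn,
          exhaust hau hub (Or.inl (by omega))⟩⟩
        -- A child of `a` would lie inside the pair of `a`, where all pairs are rooks by minimality.
        rintro rfl
        exact hbb (hain b hb hlt (M.lt_par b hb))
  · exfalso
    push Not at hD
    have hall : ∀ e, op e → e ≠ a → e ≠ par a → 0 ≤ e → s e < n → RookAt w e (s e) := by
      intro e he h1 h2 h3 h4
      by_contra hno
      exact h2 (hD e he h3 h4 hno h1)
    obtain ⟨k1, k2⟩ := M.rookAt_cross hw ha haa fun e he hea h1 h2 h3 h4 =>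
      hall e he hea (by omega) h3 h4
    -- Now `w` contains the placement of a single exchange, which leaves only (a, s a) uncovered, so
    -- a second uncovered position is impossible.
    have hsub : ∀ p q, rookOf I s (Equiv.swap (par a) a) p q → w p q := by
      rintro p q ⟨⟨hp, hq, hpq⟩, he⟩
      have hop := (M.mem_iff p).1 hp
      have : RookAt w p q := by
        rw [← he]
        rw [Equiv.swap_apply_def] at he ⊢
        split_ifs at he ⊢ with h1 h2
        · rw [h1]
          exact k1 (by omega) (by omega) hB1
        · rw [h2]
          exact k2 (by omega) (by omega) hB2
        · exact hall _ hop h2 h1 (by omega) (by omega)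
      obtain ⟨p', q', h1, h2, h3⟩ := this
      obtain rfl : p' = p := Fin.ext (by omega)
      obtain rfl : q' = q := Fin.ext (by omega)
      exact h3
    have only : ∀ i j, UncovAt I w i j → i = a ∧ j = s a := by
      rintro _ _ ⟨p, q, rfl, rfl, h⟩
      obtain ⟨⟨hp, hq, hpq⟩, -⟩ := id h
      simp only at hp hq hpq
      obtain ⟨h1, h2⟩ := M.lt_of_mem_uncov (M.isShift_single ha) hsub h
      have hq' : ¬ op q := fun h => hq ((M.mem_iff q).2 h)
      have := M.cross_single ha ((M.mem_iff p).1 hp) ((M.op_s q).2 hq')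
        (by rw [M.invol]; omega) (by rw [M.invol]; exact h1)
        (by rw [Equiv.symm_swap] at h2; exact h2)
      refine ⟨this.1, ?_⟩
      have h3 := congrArg s this.2
      rw [M.invol] at h3
      exact h3
    have o1 := only _ _ hUx
    have o2 := only _ _ hUy
    omega

end GrassConormal

namespace GrassConormal

/-! ### Block diagonal upper triangular matrices and their action on off-diagonal blocks -/

open Matrix

variable {n : ℕ} {I : Set (Fin n)}

/-- Invertible upper triangular matrices preserving the spans of the basis vectors with index in
`I` and with index outside `I`. -/
structure IsLevi (I : Set (Fin n)) (g : Matrix (Fin n) (Fin n) ℂ) : Prop where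
  tri : g.BlockTriangular id
  block : ∀ {p q}, g p q ≠ 0 → (p ∈ I ↔ q ∈ I)
  diag : ∀ p, g p p ≠ 0

/-- Matrices with support in the rows from `I` and the columns outside `I`. -/
def Blk (I : Set (Fin n)) (x : Matrix (Fin n) (Fin n) ℂ) : Prop :=
  ∀ p q, x p q ≠ 0 → p ∈ I ∧ q ∉ I

/-- Matrices with support in `Pos I`. -/
def SuppOn (I : Set (Fin n)) (x : Matrix (Fin n) (Fin n) ℂ) : Prop :=
  ∀ p q, x p q ≠ 0 → Pos I p q

theorem SuppOn.blk {x : Matrix (Fin n) (Fin n) ℂ} (h : SuppOn I x) : Blk I x :=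
  fun p q hpq => ⟨(h p q hpq).1, (h p q hpq).2.1⟩

theorem isUnit_iff_diag {g : Matrix (Fin n) (Fin n) ℂ} (h : g.BlockTriangular id) :
    IsUnit g ↔ ∀ p, g p p ≠ 0 := by
  rw [Matrix.isUnit_iff_isUnit_det, det_of_isUpperTriangular h, isUnit_iff_ne_zero,
    Finset.prod_ne_zero_iff]
  simp

theorem IsLevi.isUnit {g : Matrix (Fin n) (Fin n) ℂ} (h : IsLevi I g) : IsUnit g :=
  (isUnit_iff_diag h.tri).2 h.diag

theorem IsLevi.isUnit_det {g : Matrix (Fin n) (Fin n) ℂ} (h : IsLevi I g) : IsUnit g.det :=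
  (Matrix.isUnit_iff_isUnit_det g).1 h.isUnit

theorem exists_of_mul_apply_ne_zero {m : Type*} [Fintype m] {p q : Fin n} {g : Matrix (Fin n) m ℂ}
    {h : Matrix m (Fin n) ℂ} (hne : (g * h) p q ≠ 0) : ∃ a, g p a ≠ 0 ∧ h a q ≠ 0 := by
  rw [Matrix.mul_apply] at hne
  obtain ⟨a, -, ha⟩ := Finset.exists_ne_zero_of_sum_ne_zero hne
  exact ⟨a, left_ne_zero_of_mul ha, right_ne_zero_of_mul ha⟩

theorem isLevi_one : IsLevi I (1 : Matrix (Fin n) (Fin n) ℂ) where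
  tri := blockTriangular_one
  block := by
    intro p q h
    have : p = q := by
      by_contra hne
      exact h (Matrix.one_apply_ne hne)
    rw [this]
  diag := by simp

theorem IsLevi.mul {g h : Matrix (Fin n) (Fin n) ℂ} (hg : IsLevi I g) (hh : IsLevi I h) :
    IsLevi I (g * h) where
  tri := hg.tri.mul hh.tri
  block := by
    intro p q hne
    obtain ⟨a, h1, h2⟩ := exists_of_mul_apply_ne_zero hne
    rw [hg.block h1, hh.block h2]
  diag := (isUnit_iff_diag (hg.tri.mul hh.tri)).1 (hg.isUnit.mul hh.isUnit)

theorem blockTriangular_inv {g : Matrix (Fin n) (Fin n) ℂ} (hg : g.BlockTriangular id)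
    (hu : IsUnit g.det) : (g⁻¹).BlockTriangular id := by
  have := Matrix.invertibleOfIsUnitDet g hu
  exact blockTriangular_inv_of_blockTriangular hg

open Classical in
theorem IsLevi.inv {g : Matrix (Fin n) (Fin n) ℂ} (hg : IsLevi I g) : IsLevi I g⁻¹ where
  tri := blockTriangular_inv hg.tri hg.isUnit_det
  block := by
    -- Block diagonality is commutation with a diagonal matrix of signs, a property that passes to
    -- inverses.
    set D : Matrix (Fin n) (Fin n) ℂ := Matrix.diagonal (fun p => if p ∈ I then 1 else -1) with hD
    have hcomm : D * g = g * D := by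
      ext p q
      rw [hD, Matrix.diagonal_mul, Matrix.mul_diagonal]
      by_cases h : g p q = 0
      · simp [h]
      · simp only [hg.block h, mul_comm]
    have hcomm' : D * g⁻¹ = g⁻¹ * D := by
      calc D * g⁻¹ = g⁻¹ * g * D * g⁻¹ := by rw [Matrix.nonsing_inv_mul _ hg.isUnit_det, one_mul]
        _ = g⁻¹ * (g * D) * g⁻¹ := by simp only [mul_assoc]
        _ = g⁻¹ * D * (g * g⁻¹) := by rw [← hcomm]; simp only [mul_assoc]
        _ = g⁻¹ * D := by rw [Matrix.mul_nonsing_inv _ hg.isUnit_det, mul_one]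
    intro p q hne
    have h1 := congrFun (congrFun hcomm' p) q
    rw [hD, Matrix.diagonal_mul, Matrix.mul_diagonal, mul_comm] at h1
    have h2 := mul_left_cancel₀ hne h1
    by_cases hp : p ∈ I <;> by_cases hq : q ∈ I <;> simp [hp, hq] at h2 ⊢ <;> norm_num at h2
  diag := by
    refine (isUnit_iff_diag (blockTriangular_inv hg.tri hg.isUnit_det)).1 ?_
    rw [Matrix.isUnit_nonsing_inv_iff]
    exact hg.isUnit

theorem isLevi_compl {g : Matrix (Fin n) (Fin n) ℂ} : IsLevi Iᶜ g ↔ IsLevi I g :=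
  ⟨fun h => ⟨h.tri, fun hne => not_iff_not.1 (h.block hne), h.diag⟩,
    fun h => ⟨h.tri, fun hne => not_iff_not.2 (h.block hne), h.diag⟩⟩

/-- Two matrices are conjugate by a matrix in the Levi part. -/
def Rel (I : Set (Fin n)) (x y : Matrix (Fin n) (Fin n) ℂ) : Prop :=
  ∃ g, IsLevi I g ∧ g * x = y * g

theorem rel_compl {x y : Matrix (Fin n) (Fin n) ℂ} : Rel Iᶜ x y ↔ Rel I x y := by
  simp only [Rel, isLevi_compl]

theorem Rel.refl (x : Matrix (Fin n) (Fin n) ℂ) : Rel I x x := ⟨1, isLevi_one, by simp⟩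

theorem IsLevi.eq_conj {g x y : Matrix (Fin n) (Fin n) ℂ} (hg : IsLevi I g) (h : g * x = y * g) :
    y = g * x * g⁻¹ := by
  rw [h, mul_assoc, Matrix.mul_nonsing_inv _ hg.isUnit_det, mul_one]

theorem IsLevi.rel_conj {g : Matrix (Fin n) (Fin n) ℂ} (hg : IsLevi I g)
    (x : Matrix (Fin n) (Fin n) ℂ) : Rel I x (g * x * g⁻¹) :=
  ⟨g, hg, by rw [mul_assoc, Matrix.nonsing_inv_mul _ hg.isUnit_det, mul_one]⟩

theorem Rel.symm {x y : Matrix (Fin n) (Fin n) ℂ} (h : Rel I x y) : Rel I y x := by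
  obtain ⟨g, hg, h⟩ := h
  refine ⟨g⁻¹, hg.inv, ?_⟩
  rw [hg.eq_conj h, ← mul_assoc, ← mul_assoc, Matrix.nonsing_inv_mul _ hg.isUnit_det, one_mul]

theorem Rel.trans {x y z : Matrix (Fin n) (Fin n) ℂ} (h : Rel I x y) (h' : Rel I y z) :
    Rel I x z := by
  obtain ⟨g, hg, h⟩ := h
  obtain ⟨g', hg', h'⟩ := h'
  exact ⟨g' * g, hg'.mul hg, by rw [mul_assoc, h, ← mul_assoc, h', mul_assoc]⟩

theorem Blk.mul_mul {x g h : Matrix (Fin n) (Fin n) ℂ} (hx : Blk I x) (hg : IsLevi I g)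
    (hh : IsLevi I h) : Blk I (g * x * h) := by
  intro p q hne
  obtain ⟨b, h1, h2⟩ := exists_of_mul_apply_ne_zero hne
  obtain ⟨a, h3, h4⟩ := exists_of_mul_apply_ne_zero h1
  obtain ⟨h5, h6⟩ := hx a b h4
  exact ⟨(hg.block h3).2 h5, fun hq => h6 ((hh.block h2).2 hq)⟩

theorem SuppOn.mul_mul {x g h : Matrix (Fin n) (Fin n) ℂ} (hx : SuppOn I x) (hg : IsLevi I g)
    (hh : IsLevi I h) : SuppOn I (g * x * h) := by
  intro p q hne
  obtain ⟨b, h1, h2⟩ := exists_of_mul_apply_ne_zero hne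
  obtain ⟨a, h3, h4⟩ := exists_of_mul_apply_ne_zero h1
  obtain ⟨h5, h6, h7⟩ := hx a b h4
  refine ⟨(hg.block h3).2 h5, fun hq => h6 ((hh.block h2).2 hq), ?_⟩
  have e1 : p ≤ a := not_lt.1 fun hlt => h3 (hg.tri hlt)
  have e2 : b ≤ q := not_lt.1 fun hlt => h2 (hh.tri hlt)
  exact e1.trans_lt (h7.trans_le e2)

theorem SuppOn.rel {x y : Matrix (Fin n) (Fin n) ℂ} (hx : SuppOn I x) (h : Rel I x y) :
    SuppOn I y := by
  obtain ⟨g, hg, h⟩ := h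
  rw [hg.eq_conj h]
  exact hx.mul_mul hg hg.inv

theorem Blk.rel {x y : Matrix (Fin n) (Fin n) ℂ} (hx : Blk I x) (h : Rel I x y) :
    Blk I y := by
  obtain ⟨g, hg, h⟩ := h
  rw [hg.eq_conj h]
  exact hx.mul_mul hg hg.inv

open Classical in
/-- Left and right multiplications act independently on the off-diagonal block. -/
theorem Blk.rel_mul_mul {x L R : Matrix (Fin n) (Fin n) ℂ} (hx : Blk I x) (hL : IsLevi I L)
    (hR : IsLevi I R) : Rel I x (L * x * R) := by
  have hRi := hR.inv
  -- An off-diagonal block only sees the left factor on `I` and the right factor on the complement,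
  -- so the two factors can be glued into one conjugating matrix.
  set g : Matrix (Fin n) (Fin n) ℂ := Matrix.of fun p q => if p ∈ I then L p q else R⁻¹ p q with hg
  have hgI : ∀ p ∈ I, ∀ q, g p q = L p q := fun p hp q => by simp [hg, hp]
  have hgJ : ∀ p ∉ I, ∀ q, g p q = R⁻¹ p q := fun p hp q => by simp [hg, hp]
  have hy := hx.mul_mul hL hR
  refine ⟨g, ⟨?_, ?_, ?_⟩, ?_⟩
  · intro p q hlt
    by_cases hp : p ∈ I
    · rw [hgI p hp]
      exact hL.tri hlt
    · rw [hgJ p hp]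
      exact hRi.tri hlt
  · intro p q hne
    by_cases hp : p ∈ I
    · rw [hgI p hp] at hne
      exact hL.block hne
    · rw [hgJ p hp] at hne
      exact hRi.block hne
  · intro p
    by_cases hp : p ∈ I
    · rw [hgI p hp]
      exact hL.diag p
    · rw [hgJ p hp]
      exact hRi.diag p
  · have h1 : g * x = L * x := by
      ext p q
      by_cases hp : p ∈ I
      · simp only [Matrix.mul_apply, hgI p hp]
      · have e1 : (g * x) p q = 0 := by
          by_contra hne
          obtain ⟨a, h1, h2⟩ := exists_of_mul_apply_ne_zero hne
          rw [hgJ p hp] at h1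
          exact hp ((hRi.block h1).2 (hx a q h2).1)
        have e2 : (L * x) p q = 0 := by
          by_contra hne
          obtain ⟨a, h1, h2⟩ := exists_of_mul_apply_ne_zero hne
          exact hp ((hL.block h1).2 (hx a q h2).1)
        rw [e1, e2]
    have h2 : L * x * R * g = L * x * R * R⁻¹ := by
      ext p q
      simp only [Matrix.mul_apply (M := L * x * R)]
      refine Finset.sum_congr rfl fun a _ => ?_
      by_cases ha : (L * x * R) p a = 0
      · rw [ha, zero_mul, zero_mul]
      · rw [hgJ a (hy p a ha).2]
    rw [h1, h2, mul_assoc _ R, Matrix.mul_nonsing_inv _ hR.isUnit_det, mul_one]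

/-! ### Elimination -/

open Classical in
/-- The matrix with entries `1` at the positions in `w` and `0` elsewhere. -/
noncomputable def rookMat (w : Fin n → Fin n → Prop) : Matrix (Fin n) (Fin n) ℂ :=
  Matrix.of fun p q => if w p q then 1 else 0

theorem rookMat_ne_zero {w : Fin n → Fin n → Prop} {p q : Fin n} : rookMat w p q ≠ 0 ↔ w p q := by
  simp [rookMat]

theorem rookMat_of {w : Fin n → Fin n → Prop} {p q : Fin n} (h : w p q) : rookMat w p q = 1 := by
  simp [rookMat, h]

theorem rookMat_of_not {w : Fin n → Fin n → Prop} {p q : Fin n} (h : ¬ w p q) :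
    rookMat w p q = 0 := by
  simp [rookMat, h]

theorem IsRook.suppOn {w : Fin n → Fin n → Prop} (hw : IsRook I w) : SuppOn I (rookMat w) :=
  fun _ _ h => hw.pos (rookMat_ne_zero.1 h)

open Classical in
theorem Blk.rel_rookMat {x : Matrix (Fin n) (Fin n) ℂ} (hx : Blk I x)
    (hrow : ∀ p q q', x p q ≠ 0 → x p q' ≠ 0 → q = q') :
    Rel I x (rookMat fun p q => x p q ≠ 0) := by
  -- Each row is scaled by the inverse of its only non-zero entry; zero rows keep the factor 1, so
  -- that the diagonal matrix is invertible.
  set t : Fin n → ℂ := fun p => if h : ∃ q, x p q ≠ 0 then (x p h.choose)⁻¹ else 1 with ht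
  have ht' : ∀ p q, x p q ≠ 0 → t p = (x p q)⁻¹ := by
    intro p q hpq
    have h : ∃ q, x p q ≠ 0 := ⟨q, hpq⟩
    rw [ht]
    simp only [dif_pos h]
    rw [hrow p _ q h.choose_spec hpq]
  have hL : IsLevi I (Matrix.diagonal t) := by
    refine ⟨blockTriangular_diagonal t, ?_, ?_⟩
    · intro p q h
      have : p = q := by
        by_contra hne
        exact h (Matrix.diagonal_apply_ne _ hne)
      rw [this]
    · intro p
      rw [Matrix.diagonal_apply_eq]
      by_cases h : ∃ q, x p q ≠ 0
      · obtain ⟨q, hq⟩ := h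
        rw [ht' p q hq]
        exact inv_ne_zero hq
      · simp [ht, h]
  have := hx.rel_mul_mul hL isLevi_one
  convert this using 1
  rw [mul_one]
  ext p q
  rw [Matrix.diagonal_mul]
  by_cases h : x p q = 0
  · rw [rookMat_of_not (by simpa using h), h, mul_zero]
  · rw [rookMat_of h, ht' p q h, inv_mul_cancel₀ h]

theorem isLevi_one_add {d : Matrix (Fin n) (Fin n) ℂ} (htri : ∀ p q, d p q ≠ 0 → p ≤ q)
    (hblock : ∀ p q, d p q ≠ 0 → (p ∈ I ↔ q ∈ I)) (hdiag : ∀ p, d p p ≠ -1) :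
    IsLevi I (1 + d) where
  tri := by
    refine blockTriangular_one.add fun p q hlt => ?_
    by_contra hne
    exact absurd (htri p q hne) (not_le.2 hlt)
  block := by
    intro p q hne
    by_cases h : p = q
    · rw [h]
    · rw [Matrix.add_apply, Matrix.one_apply_ne h, zero_add] at hne
      exact hblock p q hne
  diag := by
    intro p h
    rw [Matrix.add_apply, Matrix.one_apply_eq] at h
    exact hdiag p (by linear_combination h)

/-- The columns with index less than `c` contain at most one non-zero entry, and the same holds for
the rows of these entries. -/
def Reduced (c : ℕ) (x : Matrix (Fin n) (Fin n) ℂ) : Prop :=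
  ∀ p q : Fin n, (q : ℕ) < c → x p q ≠ 0 → (∀ q', q' ≠ q → x p q' = 0) ∧ ∀ p', p' ≠ p → x p' q = 0

/-- The pivot is the lowest non-zero entry of column `c`: upper triangular operations clear the
entries above it and to its right, which are the only non-zero ones besides it in its column and
row. -/
theorem Blk.exists_reduced_succ {x : Matrix (Fin n) (Fin n) ℂ} (hx : Blk I x) {c : Fin n}
    (hc : Reduced c x) : ∃ y, Rel I x y ∧ Reduced (c + 1) y := by
  classical
  by_cases h0 : ∀ p, x p c = 0
  · refine ⟨x, Rel.refl x, fun p q hq hpq => hc p q ?_ hpq⟩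
    rcases Nat.lt_succ_iff_lt_or_eq.1 hq with h | h
    · exact h
    · rw [Fin.ext h] at hpq
      exact absurd (h0 p) hpq
  push Not at h0
  obtain ⟨p, hp, hmax⟩ : ∃ p, x p c ≠ 0 ∧ ∀ a, x a c ≠ 0 → a ≤ p := by
    have hne : (Finset.univ.filter fun a => x a c ≠ 0).Nonempty := by
      obtain ⟨a, ha⟩ := h0
      exact ⟨a, by simpa using ha⟩
    refine ⟨_, (Finset.mem_filter.1 (Finset.max'_mem _ hne)).2, fun a ha => ?_⟩
    exact Finset.le_max' _ _ (by simpa using ha)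
  -- An earlier non-zero entry of the pivot row would, in a reduced column, be alone in that row.
  have hrow : ∀ b < c, x p b = 0 := by
    intro b hb
    by_contra hne
    exact hp ((hc p b hb hne).1 c hb.ne')
  set u : Fin n → ℂ := fun a => if a = p then 0 else -(x a c / x p c) with hu
  set v : Fin n → ℂ := fun b => if b = c then 0 else -(x p b / x p c) with hv
  have hL : IsLevi I (1 + Matrix.of fun a k => if k = p then u a else 0) := by
    refine isLevi_one_add ?_ ?_ ?_
    · intro a b hne
      simp only [Matrix.of_apply, hu] at hne
      split_ifs at hne with h1 h2
      · simp at hne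
      · rw [h1]
        exact hmax a (fun h => by simp [h] at hne)
      · simp at hne
    · intro a b hne
      simp only [Matrix.of_apply, hu] at hne
      split_ifs at hne with h1 h2
      · simp at hne
      · rw [h1]
        exact iff_of_true (hx a c (fun h => by simp [h] at hne)).1 (hx p c hp).1
      · simp at hne
    · intro a
      simp only [Matrix.of_apply, hu]
      split_ifs <;> simp
  have hR : IsLevi I (1 + Matrix.of fun k b => if k = c then v b else 0) := by
    refine isLevi_one_add ?_ ?_ ?_
    · intro a b hne
      simp only [Matrix.of_apply, hv] at hne
      split_ifs at hne with h1 h2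
      · simp at hne
      · rw [h1]
        by_contra hlt
        rw [hrow b (not_le.1 hlt)] at hne
        simp at hne
      · simp at hne
    · intro a b hne
      simp only [Matrix.of_apply, hv] at hne
      split_ifs at hne with h1 h2
      · simp at hne
      · rw [h1]
        exact iff_of_false (hx p c hp).2 (hx p b (fun h => by simp [h] at hne)).2
      · simp at hne
    · intro a
      simp only [Matrix.of_apply, hv]
      split_ifs <;> simp
  set y := (1 + Matrix.of fun a k => if k = p then u a else 0) * x *
    (1 + Matrix.of fun k b => if k = c then v b else 0) with hy
  have hyab : ∀ a b, y a b = x a b + u a * x p b + (x a c + u a * x p c) * v b := by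
    intro a b
    simp [hy, add_mul, mul_add, Matrix.mul_apply]
  have hne : ∀ a b, a ≠ p → b ≠ c → y a b = x a b - x a c / x p c * x p b := by
    intro a b ha hb
    rw [hyab]
    simp only [hu, hv, if_neg ha, if_neg hb]
    field_simp
    ring
  have hac : ∀ a, a ≠ p → y a c = 0 := by
    intro a ha
    rw [hyab]
    simp only [hu, hv, if_neg ha, if_true]
    field_simp
    ring
  have hpb : ∀ b, b ≠ c → y p b = 0 := by
    intro b hb
    rw [hyab]
    simp only [hu, hv, if_neg hb, if_true]
    field_simp
    ring
  have hlow : ∀ a, ∀ b < c, y a b = x a b := by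
    intro a b hb
    by_cases ha : a = p
    · rw [ha, hpb b hb.ne, hrow b hb]
    · rw [hne a b ha hb.ne, hrow b hb]
      ring
  refine ⟨y, hx.rel_mul_mul hL hR, ?_⟩
  intro a b hb hab
  rcases Nat.lt_succ_iff_lt_or_eq.1 hb with hlt | heq
  · have hlt : b < c := hlt
    rw [hlow a b hlt] at hab
    obtain ⟨h1, h2⟩ := hc a b hlt hab
    have ha : a ≠ p := fun h => hab (by rw [h, hrow b hlt])
    refine ⟨fun q' hq' => ?_, fun p' hp' => by rw [hlow p' b hlt, h2 p' hp']⟩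
    by_cases hqc : q' = c
    · rw [hqc, hac a ha]
    · rw [hne a q' ha hqc, h1 q' hq', h1 c hlt.ne']
      ring
  · have hbc : b = c := Fin.ext heq
    have ha : a = p := by
      by_contra ha
      rw [hbc] at hab
      exact hab (hac a ha)
    rw [ha, hbc]
    exact ⟨fun q' hq' => hpb q' hq', fun p' hp' => hac p' hp'⟩

/-- Every matrix supported in the off-diagonal block is conjugate to a rook matrix. -/
theorem Blk.exists_rel_rookMat {x : Matrix (Fin n) (Fin n) ℂ} (hx : Blk I x) :
    ∃ w : Fin n → Fin n → Prop, Rel I x (rookMat w) ∧ (∀ p q q', w p q → w p q' → q = q') ∧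
      ∀ p p' q, w p q → w p' q → p = p' := by
  have key : ∀ c ≤ n, ∃ y, Rel I x y ∧ Reduced c y := by
    intro c
    induction c with
    | zero => exact fun _ => ⟨x, Rel.refl x, fun p q hq => absurd hq (Nat.not_lt_zero _)⟩
    | succ c ih =>
      intro hc
      obtain ⟨y, hy, hred⟩ := ih (by omega)
      obtain ⟨z, hz, hred'⟩ := (hx.rel hy).exists_reduced_succ (c := ⟨c, hc⟩) hred
      exact ⟨z, hy.trans hz, hred'⟩
  obtain ⟨y, hy, hred⟩ := key n le_rfl
  have hrow : ∀ p q q', y p q ≠ 0 → y p q' ≠ 0 → q = q' := by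
    intro p q q' h h'
    by_contra hne
    exact h' ((hred p q q.2 h).1 q' (Ne.symm hne))
  refine ⟨_, hy.trans ((hx.rel hy).rel_rookMat hrow), hrow, fun p p' q h h' => ?_⟩
  by_contra hne
  exact h' ((hred p q q.2 h).2 p' (Ne.symm hne))

theorem SuppOn.exists_rook {x : Matrix (Fin n) (Fin n) ℂ} (hx : SuppOn I x) :
    ∃ w, IsRook I w ∧ Rel I x (rookMat w) := by
  obtain ⟨w, hw, h1, h2⟩ := hx.blk.exists_rel_rookMat
  exact ⟨w, ⟨fun h => hx.rel hw _ _ (rookMat_ne_zero.2 h), h1 _ _ _, h2 _ _ _⟩, hw⟩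

end GrassConormal

namespace GrassConormal

open Matrix Filter Topology

variable {n : ℕ} {I : Set (Fin n)} {w w' : Fin n → Fin n → Prop}

/-! ### Ranks of the lower left regions -/

/-- The part of a matrix in the rows `≥ i` and the columns `< j`. -/
def reg (i j : ℕ) (x : Matrix (Fin n) (Fin n) ℂ) : Matrix (Fin n) (Fin n) ℂ :=
  Matrix.of fun p q => if i ≤ (p : ℕ) ∧ (q : ℕ) < j then x p q else 0

theorem reg_apply_of {i j : ℕ} {x : Matrix (Fin n) (Fin n) ℂ} {p q : Fin n} (hp : i ≤ (p : ℕ))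
    (hq : (q : ℕ) < j) : reg i j x p q = x p q := by
  simp [reg, hp, hq]

/-- Upper triangular factors carry entries up and to the right, so the lower left region of the
product depends only on that region of `x`. -/
theorem rank_reg_mul_mul_le (i j : ℕ) (x : Matrix (Fin n) (Fin n) ℂ)
    {g h : Matrix (Fin n) (Fin n) ℂ} (hg : g.BlockTriangular id) (hh : h.BlockTriangular id) :
    (reg i j (g * x * h)).rank ≤ (reg i j x).rank := by
  have key : reg i j (g * x * h) = reg i n g * reg i j x * reg 0 j h := by
    ext p q
    simp only [Matrix.mul_apply, reg, Matrix.of_apply, Finset.sum_mul]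
    by_cases hpq : i ≤ (p : ℕ) ∧ (q : ℕ) < j
    · rw [if_pos hpq]
      refine Finset.sum_congr rfl fun b _ => Finset.sum_congr rfl fun a _ => ?_
      by_cases ha : a < p
      · rw [show g p a = 0 from hg ha]
        simp
      by_cases hb : q < b
      · rw [show h b q = 0 from hh hb]
        simp
      have ha' : i ≤ (a : ℕ) := hpq.1.trans (not_lt.1 ha)
      have hb' : (b : ℕ) < j := lt_of_le_of_lt (not_lt.1 hb) hpq.2
      simp [hpq.1, hpq.2, ha', hb']
    · rw [if_neg hpq]
      symm
      refine Finset.sum_eq_zero fun b _ => Finset.sum_eq_zero fun a _ => ?_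
      by_cases h1 : i ≤ (p : ℕ)
      · have h2 : ¬ (q : ℕ) < j := fun h2 => hpq ⟨h1, h2⟩
        simp [h2]
      · simp [h1]
  rw [key]
  exact (Matrix.rank_mul_le_left _ _).trans (Matrix.rank_mul_le_right _ _)

theorem Rel.rank_reg {x y : Matrix (Fin n) (Fin n) ℂ} (h : Rel I x y) (i j : ℕ) :
    (reg i j x).rank = (reg i j y).rank := by
  have key : ∀ {x y : Matrix (Fin n) (Fin n) ℂ}, Rel I x y →
      (reg i j y).rank ≤ (reg i j x).rank := by
    rintro x y ⟨g, hg, h⟩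
    rw [hg.eq_conj h]
    exact rank_reg_mul_mul_le i j x hg.tri hg.inv.tri
  exact le_antisymm (key h.symm) (key h)

/-- The rows and the columns contain at most one rook. -/
structure IsPlacement (w : Fin n → Fin n → Prop) : Prop where
  right_unique : ∀ {p q q'}, w p q → w p q' → q = q'
  left_unique : ∀ {p p' q}, w p q → w p' q → p = p'

theorem IsRook.isPlacement (hw : IsRook I w) : IsPlacement w := ⟨hw.right_unique, hw.left_unique⟩

theorem card_le_rank_of_det_ne_zero {ι : Type*} [Fintype ι] [DecidableEq ι]
    (y : Matrix (Fin n) (Fin n) ℂ) (r c : ι → Fin n) (h : (y.submatrix r c).det ≠ 0) :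
    Fintype.card ι ≤ y.rank := by
  rw [← Matrix.rank_of_det_ne_zero h]
  exact Matrix.rank_submatrix_le y r c

theorem card_arcs (w : Fin n → Fin n → Prop) (i j : ℕ) [Fintype (arcs w i j)] :
    Fintype.card (arcs w i j) = count w i j := by
  rw [count, ← Nat.card_coe_set_eq, Nat.card_eq_fintype_card]

open Classical in
/-- The minor with the rows and the columns of the rooks in the given region. -/
noncomputable def rookMinor (w : Fin n → Fin n → Prop) (i j : ℕ) (y : Matrix (Fin n) (Fin n) ℂ) :
    ℂ :=
  (y.submatrix (fun s : arcs w i j => s.1.1) (fun s : arcs w i j => s.1.2)).det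

/-- This minor is continuous in `y` and equals 1 at the rook matrix of a placement, whence the lower
semicontinuity of the ranks. -/
theorem count_le_rank_of_rookMinor {i j : ℕ} {y : Matrix (Fin n) (Fin n) ℂ}
    (h : rookMinor w i j y ≠ 0) : count w i j ≤ (reg i j y).rank := by
  classical
  rw [← card_arcs w i j]
  refine card_le_rank_of_det_ne_zero _ (fun s : arcs w i j => s.1.1)
    (fun s : arcs w i j => s.1.2) ?_
  convert h using 1
  rw [rookMinor]
  congr 1
  ext s t
  exact reg_apply_of s.2.2.1 t.2.2.2

theorem IsPlacement.rookMat_submatrix (hw : IsPlacement w) (i j : ℕ) [DecidableEq (arcs w i j)] :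
    (rookMat w).submatrix (fun s : arcs w i j => s.1.1) (fun s : arcs w i j => s.1.2) = 1 := by
  ext s t
  rw [Matrix.submatrix_apply]
  by_cases hst : s = t
  · rw [hst, Matrix.one_apply_eq, rookMat_of t.2.1]
  · rw [Matrix.one_apply_ne hst, rookMat_of_not]
    intro h
    apply hst
    have h1 := hw.right_unique h s.2.1
    have h2 := hw.left_unique h t.2.1
    exact Subtype.ext (Prod.ext h2 h1.symm)

theorem IsPlacement.rookMinor_rookMat (hw : IsPlacement w) (i j : ℕ) :
    rookMinor w i j (rookMat w) = 1 := by
  classical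
  rw [rookMinor]
  convert Matrix.det_one (n := arcs w i j)
  exact hw.rookMat_submatrix i j

theorem IsPlacement.rank_reg (hw : IsPlacement w) (i j : ℕ) :
    (reg i j (rookMat w)).rank = count w i j := by
  classical
  apply le_antisymm
  · rw [count, Set.ncard_eq_toFinset_card' (arcs w i j)]
    refine (Matrix.rank_le_card_of_support_subset _ ((arcs w i j).toFinset.image Prod.fst)
      ?_).trans Finset.card_image_le
    intro p hp
    by_contra hne
    apply hp
    funext q
    simp only [Matrix.row, reg, Matrix.of_apply, Pi.zero_apply, ite_eq_right_iff]
    intro hpq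
    apply rookMat_of_not
    intro h
    apply hne
    simp only [Finset.coe_image, Set.coe_toFinset, Set.mem_image]
    exact ⟨(p, q), ⟨h, hpq⟩, rfl⟩
  · apply count_le_rank_of_rookMinor
    rw [hw.rookMinor_rookMat]
    exact one_ne_zero

theorem continuous_rookMinor (w : Fin n → Fin n → Prop) (i j : ℕ) :
    Continuous (rookMinor w i j) := by
  classical
  unfold rookMinor
  exact (continuous_id.matrix_submatrix _ _).matrix_det

theorem IsPlacement.count_le_of_mem_closure (hw : IsPlacement w) {i j r : ℕ}
    {A : Set (Matrix (Fin n) (Fin n) ℂ)} (hA : ∀ y ∈ A, (reg i j y).rank ≤ r)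
    (h : rookMat w ∈ closure A) : count w i j ≤ r := by
  have hopen : IsOpen {y | rookMinor w i j y ≠ 0} :=
    isOpen_ne_fun (continuous_rookMinor w i j) continuous_const
  obtain ⟨y, hy, hyA⟩ := mem_closure_iff.1 h _ hopen (by
    simp [hw.rookMinor_rookMat])
  exact (count_le_rank_of_rookMinor hy).trans (hA y hyA)

/-! ### Tangent spaces -/

theorem det_eq_apply_inr {T : Type*} [Fintype T] [DecidableEq T]
    (M : Matrix (T ⊕ Unit) (T ⊕ Unit) ℂ) (h1 : ∀ s, M (Sum.inl s) (Sum.inl s) = 1)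
    (h2 : ∀ s t, s ≠ t → M (Sum.inl s) (Sum.inl t) = 0)
    (h3 : ∀ s, M (Sum.inl s) (Sum.inr ()) = 0) : M.det = M (Sum.inr ()) (Sum.inr ()) := by
  have e : M = Matrix.fromBlocks 1 0 M.toBlocks₂₁ M.toBlocks₂₂ := by
    ext i j
    rcases i with s | s <;> rcases j with t | t
    · by_cases hst : s = t
      · simp [hst, h1]
      · simp [hst, h2 s t hst]
    · simpa using h3 s
    · rfl
    · rfl
  rw [e, Matrix.det_fromBlocks_zero₁₂, Matrix.det_one, one_mul]
  simp

/-- The minor on the rooks of the region, bordered by row `p` and column `q`, vanishes on `A` by the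
rank bound, and its linear term at the rook matrix is the entry (p, q). -/
theorem IsPlacement.apply_eq_zero_of_mem_tangentConeAt (hw : IsPlacement w) {p q : Fin n}
    {A : Set (Matrix (Fin n) (Fin n) ℂ)}
    (hA : ∀ y ∈ A, (reg p (q + 1) y).rank ≤ count w p (q + 1)) (hrow : ∀ q' ≤ q, ¬ w p q')
    (hcol : ∀ p', p ≤ p' → ¬ w p' q) {v : Matrix (Fin n) (Fin n) ℂ}
    (hv : v ∈ tangentConeAt ℂ A (rookMat w)) : v p q = 0 := by
  classical
  obtain ⟨α, F, hF, c, d, hd, hdA, hcd⟩ := exists_fun_of_mem_tangentConeAt hv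
  set T := arcs w p (q + 1)
  set r : T ⊕ Unit → Fin n := Sum.elim (fun s => s.1.1) (fun _ => p) with hr
  set k : T ⊕ Unit → Fin n := Sum.elim (fun s => s.1.2) (fun _ => q) with hk
  -- The border row is a separate argument. The rook matrix vanishes in it, so on points of `A` it
  -- contains only the difference from the rook matrix, and it can be rescaled before passing to the
  -- limit.
  set G : Matrix (Fin n) (Fin n) ℂ → Matrix (Fin n) (Fin n) ℂ → Matrix (T ⊕ Unit) (T ⊕ Unit) ℂ :=
    fun y u => Matrix.of fun i j => Sum.elim (fun s : T => y s.1.1 (k j)) (fun _ => u p (k j)) i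
    with hG
  have hkq : ∀ j, k j ≤ q := by
    rintro (s | s)
    · exact Nat.lt_succ_iff.1 s.2.2.2
    · exact le_rfl
  have hrp : ∀ i, p ≤ r i := by
    rintro (s | s)
    · exact s.2.2.1
    · exact le_rfl
  have hdet0 : ∀ᶠ a in F, (G (rookMat w + d a) (d a)).det = 0 := by
    filter_upwards [hdA] with a ha
    by_contra hne
    have e : G (rookMat w + d a) (d a) = (reg p (q + 1) (rookMat w + d a)).submatrix r k := by
      ext i j
      rw [Matrix.submatrix_apply, reg_apply_of (hrp i) (Nat.lt_succ_of_le (hkq j))]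
      rcases i with s | s
      · rfl
      · simp only [hG, hr, Matrix.of_apply, Sum.elim_inr, Matrix.add_apply]
        rw [rookMat_of_not (hrow _ (hkq j)), zero_add]
    rw [e] at hne
    have h1 := card_le_rank_of_det_ne_zero _ r k hne
    rw [Fintype.card_sum, Fintype.card_unit, card_arcs] at h1
    have := hA _ ha
    omega
  have hscale : ∀ a, (G (rookMat w + d a) (c a • d a)).det =
      c a * (G (rookMat w + d a) (d a)).det := by
    intro a
    have := Matrix.det_mul_column (Sum.elim (fun _ : T => (1 : ℂ)) (fun _ : Unit => c a))
      (G (rookMat w + d a) (d a))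
    simp only [Fintype.prod_sum_type, Sum.elim_inl, Sum.elim_inr, Finset.prod_const_one, one_mul,
      Finset.univ_unique, Finset.prod_singleton] at this
    rw [← this]
    congr 1
    ext i j
    rcases i with s | s <;> simp [hG]
  have hcont : Continuous fun z : Matrix (Fin n) (Fin n) ℂ × Matrix (Fin n) (Fin n) ℂ =>
      (G z.1 z.2).det := by
    refine Continuous.matrix_det (continuous_matrix fun i j => ?_)
    rcases i with s | s
    · exact continuous_fst.matrix_elem _ _
    · exact continuous_snd.matrix_elem _ _
  have hval : (G (rookMat w) v).det = v p q := by
    refine (det_eq_apply_inr _ (fun s => ?_) (fun s t hst => ?_) fun s => ?_).trans rfl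
    · exact rookMat_of s.2.1
    · refine rookMat_of_not fun h => hst (Subtype.ext (Prod.ext ?_ ?_))
      · exact hw.left_unique h t.2.1
      · exact (hw.right_unique h s.2.1).symm
    · exact rookMat_of_not (hcol _ s.2.2.1)
  obtain ⟨D, hD⟩ : ∃ D : Matrix (Fin n) (Fin n) ℂ → Matrix (Fin n) (Fin n) ℂ → ℂ,
    ∀ y u, (G y u).det = D y u := ⟨_, fun _ _ => rfl⟩
  simp only [hD] at hdet0 hscale hcont hval
  have hlim : Tendsto (fun a => D (rookMat w + d a) (c a • d a)) F (𝓝 (D (rookMat w) v)) := by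
    have h1 : Tendsto (fun a => (rookMat w + d a, c a • d a)) F (𝓝 (rookMat w, v)) := by
      refine Tendsto.prodMk_nhds ?_ hcd
      simpa using hd.const_add (rookMat w)
    exact (hcont.tendsto (rookMat w, v)).comp h1
  have hzero : D (rookMat w) v = 0 := by
    refine tendsto_nhds_unique hlim (tendsto_const_nhds.congr' ?_)
    filter_upwards [hdet0] with a ha
    rw [hscale, ha, mul_zero]
  rw [← hval, hzero]

theorem IsPlacement.apply_eq_zero_of_mem_tangentSpace (hw : IsPlacement w) {p q : Fin n}
    {A : Set (Matrix (Fin n) (Fin n) ℂ)}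
    (hA : ∀ y ∈ A, (reg p (q + 1) y).rank ≤ count w p (q + 1)) (hrow : ∀ q' ≤ q, ¬ w p q')
    (hcol : ∀ p', p ≤ p' → ¬ w p' q) {v : Matrix (Fin n) (Fin n) ℂ}
    (hv : v ∈ tangentSpace A (rookMat w)) : v p q = 0 := by
  have : tangentSpace A (rookMat w) ≤ LinearMap.ker (Matrix.entryLinearMap ℂ ℂ p q) := by
    refine Submodule.span_le.2 fun u hu => ?_
    exact hw.apply_eq_zero_of_mem_tangentConeAt hA hrow hcol hu
  exact this hv

/-- The value -1 is excluded because at a rook itself the operation multiplies the entry by 1 + t,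
which must remain non-zero. -/
theorem single_mem_tangentSpace {A : Set (Matrix (Fin n) (Fin n) ℂ)}
    {x u : Matrix (Fin n) (Fin n) ℂ} (h : ∀ t : ℂ, t ≠ -1 → x + t • u ∈ A) :
    u ∈ tangentSpace A x := by
  refine Submodule.subset_span (mem_tangentConeAt_of_add_smul_mem (l := 𝓝[≠] (0 : ℂ)) (c := id)
    tendsto_id ?_)
  have : ∀ᶠ t : ℂ in 𝓝[≠] 0, t ≠ -1 :=
    nhdsWithin_le_nhds (isOpen_ne.mem_nhds (by simp))
  filter_upwards [this] with t ht
  exact h t ht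

theorem map_mem_tangentConeAt {A A' : Set (Matrix (Fin n) (Fin n) ℂ)}
    {x v : Matrix (Fin n) (Fin n) ℂ}
    (f : Matrix (Fin n) (Fin n) ℂ →ₗ[ℂ] Matrix (Fin n) (Fin n) ℂ) (hf : Continuous f)
    (hA : ∀ y ∈ A, f y ∈ A') (hv : v ∈ tangentConeAt ℂ A x) : f v ∈ tangentConeAt ℂ A' (f x) := by
  obtain ⟨α, F, hF, c, d, hd, hdA, hcd⟩ := exists_fun_of_mem_tangentConeAt hv
  refine mem_tangentConeAt_of_seq F c (fun a => f (d a)) ?_ ?_ ?_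
  · have h := (hf.tendsto 0).comp hd
    rw [map_zero] at h
    exact h
  · filter_upwards [hdA] with a ha
    rw [← map_add]
    exact hA _ ha
  · have h := (hf.tendsto v).comp hcd
    simp only [Function.comp_def, map_smul] at h
    exact h

theorem map_tangentSpace_le {A A' : Set (Matrix (Fin n) (Fin n) ℂ)}
    {x : Matrix (Fin n) (Fin n) ℂ}
    (f : Matrix (Fin n) (Fin n) ℂ →ₗ[ℂ] Matrix (Fin n) (Fin n) ℂ) (hf : Continuous f)
    (hA : ∀ y ∈ A, f y ∈ A') : (tangentSpace A x).map f ≤ tangentSpace A' (f x) := by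
  rw [tangentSpace, Submodule.map_span, Submodule.span_le]
  rintro _ ⟨v, hv, rfl⟩
  exact Submodule.subset_span (map_mem_tangentConeAt f hf hA hv)

/-- Conjugation as a linear map. -/
noncomputable def conj (g : Matrix (Fin n) (Fin n) ℂ) :
    Matrix (Fin n) (Fin n) ℂ →ₗ[ℂ] Matrix (Fin n) (Fin n) ℂ :=
  LinearMap.mulRight ℂ g⁻¹ ∘ₗ LinearMap.mulLeft ℂ g

theorem conj_apply (g x : Matrix (Fin n) (Fin n) ℂ) : conj g x = g * x * g⁻¹ := rfl

theorem continuous_conj (g : Matrix (Fin n) (Fin n) ℂ) : Continuous (conj g) := by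
  have : Continuous fun x : Matrix (Fin n) (Fin n) ℂ => g * x * g⁻¹ := by fun_prop
  exact this

theorem IsLevi.conj_injective {g : Matrix (Fin n) (Fin n) ℂ} (hg : IsLevi I g) :
    Function.Injective (conj g) := by
  intro x y h
  simp only [conj_apply] at h
  have h1 := congrArg (fun z => g⁻¹ * z * g) h
  simpa [mul_assoc, Matrix.nonsing_inv_mul _ hg.isUnit_det,
    Matrix.nonsing_inv_mul_cancel_left _ _ hg.isUnit_det] using h1

/-- The orbit of a matrix under conjugation by the Levi part. -/
def orb (I : Set (Fin n)) (x : Matrix (Fin n) (Fin n) ℂ) : Set (Matrix (Fin n) (Fin n) ℂ) :=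
  {y | Rel I x y}

theorem finrank_tangentSpace_orb_le {x y z : Matrix (Fin n) (Fin n) ℂ} (h : Rel I y z) :
    Module.finrank ℂ (tangentSpace (orb I x) y) ≤ Module.finrank ℂ (tangentSpace (orb I x) z) := by
  obtain ⟨g, hg, h⟩ := h
  have h1 : (tangentSpace (orb I x) y).map (conj g) ≤ tangentSpace (orb I x) z := by
    rw [hg.eq_conj h]
    exact map_tangentSpace_le _ (continuous_conj g) fun a ha =>
      Rel.trans ha (hg.rel_conj a)
  rw [(Submodule.equivMapOfInjective (conj g) hg.conj_injective _).finrank_eq]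
  exact Submodule.finrank_mono h1

/-- The matrices with support in a given set of positions. -/
def coordSub (T : Set (Fin n × Fin n)) : Submodule ℂ (Matrix (Fin n) (Fin n) ℂ) where
  carrier := {x | ∀ p q, x p q ≠ 0 → (p, q) ∈ T}
  add_mem' := by
    intro x y hx hy p q h
    by_contra hT
    have h1 : x p q = 0 := by_contra fun h1 => hT (hx p q h1)
    have h2 : y p q = 0 := by_contra fun h2 => hT (hy p q h2)
    simp [h1, h2] at h
  zero_mem' := by
    intro p q h
    simp at h
  smul_mem' := by
    intro c x hx p q h
    exact hx p q (right_ne_zero_of_mul (by simpa using h))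

open Classical in
theorem finrank_coordSub (T : Set (Fin n × Fin n)) :
    Module.finrank ℂ (coordSub T) = T.ncard := by
  let e : coordSub T ≃ₗ[ℂ] (T → ℂ) :=
    { toFun := fun x t => x.1 t.1.1 t.1.2
      map_add' := fun _ _ => rfl
      map_smul' := fun _ _ => rfl
      invFun := fun f => ⟨Matrix.of fun p q => if h : (p, q) ∈ T then f ⟨(p, q), h⟩ else 0, by
        intro p q h
        by_contra hT
        simp [hT] at h⟩
      left_inv := by
        intro x
        ext p q
        by_cases h : (p, q) ∈ T
        · simp [h]
        · have : x.1 p q = 0 := by_contra fun h1 => h (x.2 p q h1)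
          simp [h, this]
      right_inv := by
        intro f
        ext t
        simp }
  rw [e.finrank_eq, Module.finrank_fintype_fun_eq_card, ← Nat.card_coe_set_eq,
    Nat.card_eq_fintype_card]

theorem coordSub_le_of_single {T : Set (Fin n × Fin n)}
    {N : Submodule ℂ (Matrix (Fin n) (Fin n) ℂ)}
    (h : ∀ p q, (p, q) ∈ T → Matrix.single p q 1 ∈ N) : coordSub T ≤ N := by
  intro x hx
  rw [Matrix.matrix_eq_sum_single x]
  refine Submodule.sum_mem _ fun p _ => Submodule.sum_mem _ fun q _ => ?_
  by_cases hpq : x p q = 0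
  · rw [hpq, Matrix.single_zero]
    exact Submodule.zero_mem _
  · have := N.smul_mem (x p q) (h p q (hx p q hpq))
    rwa [Matrix.smul_single, smul_eq_mul, mul_one] at this

/-- Elementary row operations applied to a rook matrix. -/
theorem IsPlacement.rel_add_single_of_row (hw : IsPlacement w) (hb : Blk I (rookMat w))
    {p p' q : Fin n} (hp : p ≤ p') (hpI : p ∈ I) (h : w p' q) {t : ℂ} (ht : t ≠ -1) :
    Rel I (rookMat w) (rookMat w + t • Matrix.single p q 1) := by
  have hL : IsLevi I (1 + t • Matrix.single p p' (1 : ℂ)) := by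
    refine isLevi_one_add ?_ ?_ ?_
    · intro a b hne
      rw [Matrix.smul_single, Matrix.single_apply] at hne
      split_ifs at hne with hab
      · rwa [← hab.1, ← hab.2]
      · exact absurd rfl hne
    · intro a b hne
      rw [Matrix.smul_single, Matrix.single_apply] at hne
      split_ifs at hne with hab
      · rw [← hab.1, ← hab.2]
        exact iff_of_true hpI (hb p' q (rookMat_ne_zero.2 h)).1
      · exact absurd rfl hne
    · intro a
      rw [Matrix.smul_single, Matrix.single_apply]
      split_ifs
      · simpa using ht
      · simp
  have := hb.rel_mul_mul hL isLevi_one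
  convert this using 1
  rw [mul_one, add_mul, one_mul, Matrix.smul_mul]
  congr 2
  ext a b
  by_cases ha : p = a
  · rw [← ha, Matrix.single_mul_apply_same, one_mul]
    by_cases hqb : q = b
    · rw [← hqb, Matrix.single_apply_same, rookMat_of h]
    · rw [Matrix.single_apply_of_ne _ _ _ _ _ (fun hh => hqb hh.2),
        rookMat_of_not (fun hh => hqb (hw.right_unique h hh))]
  · rw [Matrix.single_mul_apply_of_ne _ _ _ _ _ (Ne.symm ha),
      Matrix.single_apply_of_ne _ _ _ _ _ (fun hh => ha hh.1)]

/-- Elementary column operations applied to a rook matrix. -/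
theorem IsPlacement.rel_add_single_of_col (hw : IsPlacement w) (hb : Blk I (rookMat w))
    {p q q' : Fin n} (hq : q' ≤ q) (hqI : q ∉ I) (h : w p q') {t : ℂ} (ht : t ≠ -1) :
    Rel I (rookMat w) (rookMat w + t • Matrix.single p q 1) := by
  have hR : IsLevi I (1 + t • Matrix.single q' q (1 : ℂ)) := by
    refine isLevi_one_add ?_ ?_ ?_
    · intro a b hne
      rw [Matrix.smul_single, Matrix.single_apply] at hne
      split_ifs at hne with hab
      · rwa [← hab.1, ← hab.2]
      · exact absurd rfl hne
    · intro a b hne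
      rw [Matrix.smul_single, Matrix.single_apply] at hne
      split_ifs at hne with hab
      · rw [← hab.1, ← hab.2]
        exact iff_of_false (hb p q' (rookMat_ne_zero.2 h)).2 hqI
      · exact absurd rfl hne
    · intro a
      rw [Matrix.smul_single, Matrix.single_apply]
      split_ifs
      · simpa using ht
      · simp
  have := hb.rel_mul_mul isLevi_one hR
  convert this using 1
  rw [one_mul, mul_add, mul_one, Matrix.mul_smul]
  congr 2
  ext a b
  by_cases hb : q = b
  · rw [← hb, Matrix.mul_single_apply_same, mul_one]
    by_cases hpa : p = a
    · rw [← hpa, Matrix.single_apply_same, rookMat_of h]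
    · rw [Matrix.single_apply_of_ne _ _ _ _ _ (fun hh => hpa hh.1),
        rookMat_of_not (fun hh => hpa (hw.left_unique h hh))]
  · rw [Matrix.mul_single_apply_of_ne _ _ _ _ _ (Ne.symm hb),
      Matrix.single_apply_of_ne _ _ _ _ _ (fun hh => hb hh.2)]

/-- Elementary operations from a rook to the left or below give every covered coordinate direction,
and bordered minors exclude the uncovered ones. -/
theorem IsRook.tangentSpace_orb (hw : IsRook I w) :
    tangentSpace (orb I (rookMat w)) (rookMat w) =
      coordSub ({y | Pos I y.1 y.2} \ Uncov I w) := by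
  apply le_antisymm
  · intro v hv p q hpq
    have hpos : Pos I p q := by
      have hle : tangentSpace (orb I (rookMat w)) (rookMat w) ≤ coordSub {y | Pos I y.1 y.2} := by
        refine Submodule.span_le.2 fun u hu => ?_
        obtain ⟨α, F, hF, c, d, hd, hdA, hcd⟩ := exists_fun_of_mem_tangentConeAt hu
        have hclosed : IsClosed (coordSub {y | Pos I y.1 y.2} :
          Set (Matrix (Fin n) (Fin n) ℂ)) := Submodule.closed_of_finiteDimensional _
        refine hclosed.mem_of_tendsto hcd ?_
        filter_upwards [hdA] with a ha
        refine Submodule.smul_mem _ _ ?_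
        have h1 : rookMat w + d a ∈ coordSub {y | Pos I y.1 y.2} := hw.suppOn.rel ha
        have h2 : rookMat w ∈ coordSub {y | Pos I y.1 y.2} := hw.suppOn
        simpa using Submodule.sub_mem _ h1 h2
      exact hle hv p q hpq
    refine ⟨hpos, fun hu => hpq ?_⟩
    refine hw.isPlacement.apply_eq_zero_of_mem_tangentSpace (A := orb I (rookMat w)) ?_ hu.2.1
      hu.2.2 hv
    intro y hy
    rw [← Rel.rank_reg hy, hw.isPlacement.rank_reg]
  · refine coordSub_le_of_single fun p q hpq => ?_
    obtain ⟨hpos, hcov⟩ := hpq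
    have hcov' : (∃ q' ≤ q, w p q') ∨ ∃ p', p ≤ p' ∧ w p' q := by
      by_contra hne
      push Not at hne
      exact hcov ⟨hpos, hne.1, hne.2⟩
    refine single_mem_tangentSpace fun t ht => ?_
    rcases hcov' with ⟨q', hq', h⟩ | ⟨p', hp', h⟩
    · exact hw.isPlacement.rel_add_single_of_col hw.suppOn.blk hq' hpos.2.1 h ht
    · exact hw.isPlacement.rel_add_single_of_row hw.suppOn.blk hp' hpos.1 h ht

theorem IsRook.finrank_tangentSpace_orb (hw : IsRook I w) {y : Matrix (Fin n) (Fin n) ℂ}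
    (hy : Rel I (rookMat w) y) :
    Module.finrank ℂ (tangentSpace (orb I (rookMat w)) y) + (Uncov I w).ncard =
      {y : Fin n × Fin n | Pos I y.1 y.2}.ncard := by
  rw [← le_antisymm (finrank_tangentSpace_orb_le hy) (finrank_tangentSpace_orb_le hy.symm),
    hw.tangentSpace_orb, finrank_coordSub]
  exact Set.ncard_sdiff_add_ncard_of_subset (fun y hy => hy.1) (Set.toFinite _)

/-! ### Closures of orbits -/

theorem orb_eq_of_rel {x y : Matrix (Fin n) (Fin n) ℂ} (h : Rel I x y) : orb I x = orb I y :=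
  Set.ext fun _ => ⟨fun hz => h.symm.trans hz, fun hz => h.trans hz⟩

theorem mem_closure_of_rel {A : Set (Matrix (Fin n) (Fin n) ℂ)}
    (hA : ∀ y ∈ A, ∀ z, Rel I y z → z ∈ A) {x y : Matrix (Fin n) (Fin n) ℂ} (hx : x ∈ closure A)
    (h : Rel I x y) : y ∈ closure A := by
  obtain ⟨g, hg, h⟩ := h
  rw [hg.eq_conj h, ← conj_apply]
  exact map_mem_closure (continuous_conj g) hx fun z hz => hA z hz _ (hg.rel_conj z)

theorem mem_closure_orb_of_rel {x y z : Matrix (Fin n) (Fin n) ℂ} (hx : y ∈ closure (orb I x))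
    (h : Rel I y z) : z ∈ closure (orb I x) :=
  mem_closure_of_rel (fun _ ha _ hb => Rel.trans ha hb) hx h

theorem IsRook.count_le_of_mem_closure (hw : IsRook I w) (hw' : IsRook I w')
    (h : rookMat w ∈ closure (orb I (rookMat w'))) (i j : ℕ) : count w i j ≤ count w' i j := by
  refine hw.isPlacement.count_le_of_mem_closure (fun y hy => ?_) h
  rw [← Rel.rank_reg hy, hw'.isPlacement.rank_reg]

theorem mem_orb_self (x : Matrix (Fin n) (Fin n) ℂ) : x ∈ orb I x := Rel.refl x

theorem IsRook.eq_of_closure_orb_eq (hw : IsRook I w) (hw' : IsRook I w')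
    (h : closure (orb I (rookMat w)) = closure (orb I (rookMat w'))) : w = w' := by
  refine rook_eq_of_count hw hw' fun i j => le_antisymm ?_ ?_
  · exact hw.count_le_of_mem_closure hw' (h ▸ subset_closure (mem_orb_self _)) i j
  · exact hw'.count_le_of_mem_closure hw (h ▸ subset_closure (mem_orb_self _)) i j

/-- The matrices that vanish weakly to the left and weakly below the positions in `S`. -/
def clearAt (I : Set (Fin n)) (S : Set (Fin n × Fin n)) : Set (Matrix (Fin n) (Fin n) ℂ) :=
  {x | SuppOn I x ∧ ∀ y ∈ S, (∀ q ≤ y.2, x y.1 q = 0) ∧ ∀ p, y.1 ≤ p → x p y.2 = 0}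

/-- The vanishing conditions at (p, q) imply that ranks do not change when row `p` or column `q` is
dropped from the region, and ranks are invariant. -/
theorem IsRook.subset_uncov_of_rel {S : Set (Fin n × Fin n)} (hS : ∀ y ∈ S, Pos I y.1 y.2)
    (hw : IsRook I w) {x : Matrix (Fin n) (Fin n) ℂ} (hx : x ∈ clearAt I S)
    (h : Rel I x (rookMat w)) : S ⊆ Uncov I w := by
  rintro ⟨p, q⟩ hpq
  obtain ⟨h1, h2⟩ := hx.2 _ hpq
  simp only at h1 h2
  refine mem_uncov_of_count (hS _ hpq) ?_ ?_
  · rw [← hw.isPlacement.rank_reg, ← hw.isPlacement.rank_reg, ← h.rank_reg, ← h.rank_reg]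
    congr 1
    ext a b
    simp only [reg, Matrix.of_apply]
    by_cases ha : a = p
    · by_cases hb : (b : ℕ) < q + 1
      · rw [ha, h1 b (Nat.lt_succ_iff.1 hb)]
        simp
      · simp [hb]
    · have : (a : ℕ) ≠ p := fun h => ha (Fin.ext h)
      have e : ((p : ℕ) + 1 ≤ a) ↔ (p : ℕ) ≤ a := by omega
      simp only [e]
  · rw [← hw.isPlacement.rank_reg, ← hw.isPlacement.rank_reg, ← h.rank_reg, ← h.rank_reg]
    congr 1
    ext a b
    simp only [reg, Matrix.of_apply]
    by_cases hb : b = q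
    · by_cases ha : (p : ℕ) ≤ a
      · rw [hb, h2 a ha]
        simp
      · simp [ha]
    · have : (b : ℕ) ≠ q := fun h => hb (Fin.ext h)
      have e : ((b : ℕ) < q + 1) ↔ (b : ℕ) < q := by omega
      simp only [e]

theorem IsRook.rookMat_mem_clearAt {S : Set (Fin n × Fin n)} (hw : IsRook I w)
    (hS : S ⊆ Uncov I w) : rookMat w ∈ clearAt I S :=
  ⟨hw.suppOn, fun _ hy => ⟨fun q hq => rookMat_of_not ((hS hy).2.1 q hq),
    fun p hp => rookMat_of_not ((hS hy).2.2 p hp)⟩⟩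

theorem finite_det_line_eq_zero {ι : Type*} [Fintype ι] [DecidableEq ι] (a b : Matrix ι ι ℂ)
    (h : (a + b).det ≠ 0) : {t : ℂ | (a + t • b).det = 0}.Finite := by
  set P : Polynomial ℂ := (a.map (Polynomial.C (R := ℂ)) +
    (Polynomial.X : Polynomial ℂ) • b.map (Polynomial.C (R := ℂ))).det with hP
  have heval : ∀ t, P.eval t = (a + t • b).det := by
    intro t
    rw [hP, ← Polynomial.coe_evalRingHom, RingHom.map_det]
    congr 1
    ext i j
    simp
    ring
  have hne : P ≠ 0 := by
    intro h0
    apply h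
    have := heval 1
    rw [h0, Polynomial.eval_zero, one_smul] at this
    exact this.symm
  refine (Polynomial.finite_setOfPred_isRoot hne).subset fun t ht => ?_
  rw [Set.mem_ofPred_eq, Polynomial.IsRoot, heval]
  exact ht

theorem clearAt_line {S : Set (Fin n × Fin n)} {x y : Matrix (Fin n) (Fin n) ℂ}
    (hx : x ∈ clearAt I S) (hy : y ∈ clearAt I S) (t : ℂ) : x + t • (y - x) ∈ clearAt I S := by
  refine ⟨?_, fun z hz => ⟨fun q hq => ?_, fun p hp => ?_⟩⟩
  · have h1 : x ∈ coordSub {y | Pos I y.1 y.2} := hx.1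
    have h2 : y ∈ coordSub {y | Pos I y.1 y.2} := hy.1
    exact Submodule.add_mem _ h1 (Submodule.smul_mem _ _ (Submodule.sub_mem _ h2 h1))
  · simp [(hx.2 z hz).1 q hq, (hy.2 z hz).1 q hq]
  · simp [(hx.2 z hz).2 p hp, (hy.2 z hz).2 p hp]

/-- If `w` is the only rook placement, among those with the positions of `S` uncovered, whose counts
are at least those of `w`, then its orbit is dense in the space `clearAt I S`. -/
theorem IsRook.clearAt_subset_closure {S : Set (Fin n × Fin n)} (hw : IsRook I w)
    (hS : S ⊆ Uncov I w)
    (hmin : ∀ w', IsRook I w' → S ⊆ Uncov I w' → (∀ i j, count w i j ≤ count w' i j) → w' = w) :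
    clearAt I S ⊆ closure (orb I (rookMat w)) := by
  classical
  intro x hx
  -- On the line from `x` to the rook matrix all rook minors of `w` are non-zero outside a countable
  -- set of parameters. At the other parameters the counts are at least those of `w`, so the point
  -- lies in the orbit of `w`, and `x` is a limit of such points.
  set f : ℂ → Matrix (Fin n) (Fin n) ℂ := fun t => x + t • (rookMat w - x) with hf
  set Z : Set ℂ := ⋃ i : ℕ, ⋃ j : ℕ, {t | rookMinor w i j (f t) = 0} with hZ
  have hcount : Z.Countable := by
    refine Set.countable_iUnion fun i => Set.countable_iUnion fun j => Set.Finite.countable ?_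
    unfold rookMinor
    have h2 := finite_det_line_eq_zero
      (x.submatrix (fun s : arcs w i j => s.1.1) (fun s : arcs w i j => s.1.2))
      ((rookMat w - x).submatrix (fun s : arcs w i j => s.1.1) (fun s : arcs w i j => s.1.2))
      (by
        have e : x.submatrix (fun s : arcs w i j => s.1.1) (fun s : arcs w i j => s.1.2) +
            (rookMat w - x).submatrix (fun s : arcs w i j => s.1.1) (fun s : arcs w i j => s.1.2) =
            (rookMat w).submatrix (fun s : arcs w i j => s.1.1) (fun s : arcs w i j => s.1.2) := by
          ext a b
          simp
        rw [e, hw.isPlacement.rookMat_submatrix, Matrix.det_one]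
        exact one_ne_zero)
    convert h2 using 5 with t
    ext a b
    simp [hf]
  have hdense : (0 : ℂ) ∈ closure Zᶜ := hcount.dense_compl ℂ 0
  have hcont : Continuous f := by fun_prop
  have h0 : f 0 = x := by simp [hf]
  rw [← h0]
  refine map_mem_closure hcont hdense fun t ht => ?_
  have hft : f t ∈ clearAt I S := clearAt_line hx (hw.rookMat_mem_clearAt hS) t
  obtain ⟨w', hw', hrel⟩ := hft.1.exists_rook
  have hS' := hw'.subset_uncov_of_rel (fun y hy => (hS hy).1) hft hrel
  have : w' = w := by
    refine hmin w' hw' hS' fun i j => ?_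
    rw [← hw'.isPlacement.rank_reg, ← hrel.rank_reg]
    refine count_le_rank_of_rookMinor fun h => ht ?_
    exact Set.mem_iUnion.2 ⟨i, Set.mem_iUnion.2 ⟨j, h⟩⟩
  rw [this] at hrel
  exact hrel.symm

end GrassConormal

namespace GrassConormal

open Matrix Filter Topology

variable {n : ℕ} {I : Set (Fin n)} {w u : Fin n → Fin n → Prop}

/-! ### The dual space -/

/-- Matrices with support in the transposes of the positions in `Pos I`. -/
def SuppDual (I : Set (Fin n)) (ξ : Matrix (Fin n) (Fin n) ℂ) : Prop :=
  ∀ p q, ξ p q ≠ 0 → Pos I q p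

theorem SuppDual.blk {ξ : Matrix (Fin n) (Fin n) ℂ} (h : SuppDual I ξ) : Blk Iᶜ ξ :=
  fun p q hpq => ⟨(h p q hpq).2.1, fun hq => hq (h p q hpq).1⟩

open Classical in
/-- The projection onto the space of matrices with support in the transposes of the positions in
`Pos I`. -/
noncomputable def dtrunc (I : Set (Fin n)) :
    Matrix (Fin n) (Fin n) ℂ →ₗ[ℂ] Matrix (Fin n) (Fin n) ℂ where
  toFun x := Matrix.of fun p q => if Pos I q p then x p q else 0
  map_add' x y := by
    ext p q
    by_cases h : Pos I q p <;> simp [h]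
  map_smul' c x := by
    ext p q
    by_cases h : Pos I q p <;> simp [h]

theorem dtrunc_of {x : Matrix (Fin n) (Fin n) ℂ} {p q : Fin n} (h : Pos I q p) :
    dtrunc I x p q = x p q := by
  simp [dtrunc, h]

theorem dtrunc_of_not {x : Matrix (Fin n) (Fin n) ℂ} {p q : Fin n} (h : ¬ Pos I q p) :
    dtrunc I x p q = 0 := by
  simp [dtrunc, h]

theorem suppDual_dtrunc (x : Matrix (Fin n) (Fin n) ℂ) : SuppDual I (dtrunc I x) :=
  fun _ _ hne => by_contra fun h => hne (dtrunc_of_not h)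

theorem SuppDual.dtrunc_eq {x : Matrix (Fin n) (Fin n) ℂ} (hx : SuppDual I x) :
    dtrunc I x = x := by
  ext p q
  by_cases h : Pos I q p
  · exact dtrunc_of h
  · rw [dtrunc_of_not h]
    exact (by_contra fun hne => h (hx p q (Ne.symm hne)))

/-- Discarded entries never contribute to retained ones, so truncated multiplication is an action on
the dual space. -/
theorem dtrunc_mul_dtrunc_mul {g h : Matrix (Fin n) (Fin n) ℂ} (hg : IsLevi I g)
    (hh : IsLevi I h) (x : Matrix (Fin n) (Fin n) ℂ) :
    dtrunc I (g * dtrunc I x * h) = dtrunc I (g * x * h) := by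
  ext q p
  by_cases hpq : Pos I p q
  · rw [dtrunc_of hpq, dtrunc_of hpq]
    simp only [Matrix.mul_apply, Finset.sum_mul]
    refine Finset.sum_congr rfl fun b _ => Finset.sum_congr rfl fun a _ => ?_
    by_cases h1 : g q a = 0
    · simp [h1]
    by_cases h2 : h b p = 0
    · simp [h2]
    rw [dtrunc_of ⟨(hh.block h2).2 hpq.1, fun ha => hpq.2.1 ((hg.block h1).2 ha), ?_⟩]
    have e1 : q ≤ a := not_lt.1 fun hlt => h1 (hg.tri hlt)
    have e2 : b ≤ p := not_lt.1 fun hlt => h2 (hh.tri hlt)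
    exact e2.trans_lt (hpq.2.2.trans_le e1)
  · rw [dtrunc_of_not hpq, dtrunc_of_not hpq]

theorem continuous_dtrunc_conj (g : Matrix (Fin n) (Fin n) ℂ) :
    Continuous (dtrunc I ∘ₗ conj g) := by
  refine continuous_matrix fun p q => ?_
  by_cases h : Pos I q p
  · simp only [LinearMap.comp_apply, dtrunc_of h]
    exact (continuous_conj g).matrix_elem p q
  · simp only [LinearMap.comp_apply, dtrunc_of_not h]
    exact continuous_const

/-- The orbit of an element of the dual space. -/
def dorb (I : Set (Fin n)) (ξ : Matrix (Fin n) (Fin n) ℂ) : Set (Matrix (Fin n) (Fin n) ℂ) :=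
  {ξ' | ∃ g, IsLevi I g ∧ ξ' = dtrunc I (conj g ξ)}

theorem dtrunc_conj_mul {g h : Matrix (Fin n) (Fin n) ℂ} (hg : IsLevi I g)
    (x : Matrix (Fin n) (Fin n) ℂ) :
    dtrunc I (conj g (dtrunc I (conj h x))) = dtrunc I (conj (g * h) x) := by
  rw [conj_apply, dtrunc_mul_dtrunc_mul hg hg.inv, conj_apply, conj_apply, Matrix.mul_inv_rev]
  simp only [mul_assoc]

theorem conj_one (x : Matrix (Fin n) (Fin n) ℂ) : conj 1 x = x := by
  simp [conj_apply]

theorem SuppDual.dtrunc_conj_inv {ξ : Matrix (Fin n) (Fin n) ℂ} (hξ : SuppDual I ξ)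
    {g : Matrix (Fin n) (Fin n) ℂ} (hg : IsLevi I g) :
    dtrunc I (conj g⁻¹ (dtrunc I (conj g ξ))) = ξ := by
  rw [dtrunc_conj_mul hg.inv, Matrix.nonsing_inv_mul _ hg.isUnit_det, conj_one, hξ.dtrunc_eq]

theorem SuppDual.mem_dorb_self {ξ : Matrix (Fin n) (Fin n) ℂ} (hξ : SuppDual I ξ) :
    ξ ∈ dorb I ξ :=
  ⟨1, isLevi_one, by rw [conj_one, hξ.dtrunc_eq]⟩

theorem suppDual_of_mem_dorb {ξ ξ' : Matrix (Fin n) (Fin n) ℂ} (h : ξ' ∈ dorb I ξ) :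
    SuppDual I ξ' := by
  obtain ⟨g, hg, rfl⟩ := h
  exact suppDual_dtrunc _

theorem SuppDual.mem_dorb_symm {ξ ξ' : Matrix (Fin n) (Fin n) ℂ} (hξ : SuppDual I ξ)
    (h : ξ' ∈ dorb I ξ) : ξ ∈ dorb I ξ' := by
  obtain ⟨g, hg, rfl⟩ := h
  exact ⟨g⁻¹, hg.inv, (hξ.dtrunc_conj_inv hg).symm⟩

theorem mem_dorb_trans {ξ ξ' ξ'' : Matrix (Fin n) (Fin n) ℂ} (h : ξ' ∈ dorb I ξ)
    (h' : ξ'' ∈ dorb I ξ') : ξ'' ∈ dorb I ξ := by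
  obtain ⟨g, hg, rfl⟩ := h
  obtain ⟨g', hg', rfl⟩ := h'
  exact ⟨g' * g, hg'.mul hg, dtrunc_conj_mul hg' _⟩

theorem SuppDual.dorb_eq {ξ ξ' : Matrix (Fin n) (Fin n) ℂ} (hξ : SuppDual I ξ)
    (h : ξ' ∈ dorb I ξ) : dorb I ξ' = dorb I ξ :=
  Set.ext fun _ => ⟨fun hz => mem_dorb_trans h hz,
    fun hz => mem_dorb_trans (hξ.mem_dorb_symm h) hz⟩

theorem SuppDual.mem_dorb_of_rel {ξ ξ' : Matrix (Fin n) (Fin n) ℂ} (hξ' : SuppDual I ξ')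
    (h : Rel I ξ ξ') : ξ' ∈ dorb I ξ := by
  obtain ⟨g, hg, h⟩ := h
  exact ⟨g, hg, by rw [conj_apply, ← hg.eq_conj h, hξ'.dtrunc_eq]⟩

/-- For `j ≤ i` the region lies strictly below the diagonal, where nothing is discarded. Ranks are
invariants of the dual action only for such regions. -/
theorem Blk.reg_dtrunc {x : Matrix (Fin n) (Fin n) ℂ} (hx : Blk Iᶜ x) {i j : ℕ} (hij : j ≤ i) :
    reg i j (dtrunc I x) = reg i j x := by
  ext p q
  simp only [reg, Matrix.of_apply]
  by_cases hpq : i ≤ (p : ℕ) ∧ (q : ℕ) < j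
  · rw [if_pos hpq, if_pos hpq]
    by_cases h : Pos I q p
    · exact dtrunc_of h
    · rw [dtrunc_of_not h]
      by_contra hne
      obtain ⟨h1, h2⟩ := hx p q (Ne.symm hne)
      refine h ⟨not_not.1 h2, h1, ?_⟩
      have := hpq.1
      have := hpq.2
      exact Fin.lt_def.2 (by omega)
  · rw [if_neg hpq, if_neg hpq]

theorem SuppDual.rank_reg {ξ ξ' : Matrix (Fin n) (Fin n) ℂ} (hξ : SuppDual I ξ)
    (h : ξ' ∈ dorb I ξ) {i j : ℕ} (hij : j ≤ i) : (reg i j ξ').rank = (reg i j ξ).rank := by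
  obtain ⟨g, hg, rfl⟩ := h
  have hrel := hg.rel_conj ξ
  rw [conj_apply, ((hξ.blk).rel (rel_compl.2 hrel)).reg_dtrunc hij, ← hrel.rank_reg]

/-- The transposed relation. -/
def flip (u : Fin n → Fin n → Prop) : Fin n → Fin n → Prop := fun q p => u p q

theorem IsRook.suppDual (hu : IsRook I u) : SuppDual I (rookMat (flip u)) :=
  fun _ _ h => hu.pos (rookMat_ne_zero.1 h)

theorem IsRook.isPlacement_flip (hu : IsRook I u) : IsPlacement (flip u) :=
  ⟨fun h h' => hu.left_unique h h', fun h h' => hu.right_unique h h'⟩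

/-- Elimination takes place in the whole off-diagonal block and may create rooks outside the dual
space; truncation deletes them. -/
theorem SuppDual.exists_rook {ξ : Matrix (Fin n) (Fin n) ℂ} (hξ : SuppDual I ξ) :
    ∃ u, IsRook I u ∧ rookMat (flip u) ∈ dorb I ξ := by
  obtain ⟨w, hrel, h1, h2⟩ := hξ.blk.exists_rel_rookMat
  refine ⟨fun p q => w q p ∧ Pos I p q, ⟨fun h => h.2, fun h h' => h2 _ _ _ h.1 h'.1,
    fun h h' => h1 _ _ _ h.1 h'.1⟩, ?_⟩
  obtain ⟨g, hg, h⟩ := rel_compl.1 hrel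
  refine ⟨g, hg, ?_⟩
  rw [conj_apply, ← hg.eq_conj h]
  ext q p
  by_cases hpq : Pos I p q
  · rw [dtrunc_of hpq]
    by_cases hw : w q p
    · rw [rookMat_of hw, rookMat_of ⟨hw, hpq⟩]
    · rw [rookMat_of_not hw, rookMat_of_not fun h => hw h.1]
  · rw [dtrunc_of_not hpq, rookMat_of_not fun h => hpq h.2]

theorem trace_mul_eq_zero_of {x v : Matrix (Fin n) (Fin n) ℂ}
    (h : ∀ p q, x p q ≠ 0 → v q p = 0) : (x * v).trace = 0 := by
  simp only [Matrix.trace, Matrix.diag, Matrix.mul_apply]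
  refine Finset.sum_eq_zero fun p _ => Finset.sum_eq_zero fun q _ => ?_
  by_cases hpq : x p q = 0
  · rw [hpq, zero_mul]
  · rw [h p q hpq, mul_zero]

theorem SuppOn.trace_mul_dtrunc {x : Matrix (Fin n) (Fin n) ℂ} (hx : SuppOn I x)
    (v : Matrix (Fin n) (Fin n) ℂ) : (x * dtrunc I v).trace = (x * v).trace := by
  have : (x * (dtrunc I v - v)).trace = 0 := by
    refine trace_mul_eq_zero_of fun p q h => ?_
    rw [Matrix.sub_apply, dtrunc_of (hx p q h), sub_self]
  rwa [mul_sub, Matrix.trace_sub, sub_eq_zero] at this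

/-- The conormal space of the orbit of a rook matrix in the dual space. -/
theorem IsRook.annihilator_iff (hu : IsRook I u) {x : Matrix (Fin n) (Fin n) ℂ}
    (hx : SuppOn I x) :
    (∀ v ∈ tangentSpace (dorb I (rookMat (flip u))) (rookMat (flip u)), (x * v).trace = 0) ↔
      x ∈ clearAt I {y | u y.1 y.2} := by
  constructor
  · intro h
    refine ⟨hx, ?_⟩
    rintro ⟨a, b⟩ hab
    have hab : u a b := hab
    -- Directions of elementary operations are tangent to the orbit, so the entries of `x` paired
    -- with them vanish.
    have key : ∀ p q, Pos I p q → (∀ t : ℂ, t ≠ -1 →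
        Rel I (rookMat (flip u)) (rookMat (flip u) + t • Matrix.single q p 1)) → x p q = 0 := by
      intro p q hpq hrel
      have h1 := h (Matrix.single q p 1) (single_mem_tangentSpace fun t ht => ?_)
      · simpa [Matrix.trace_mul_single] using h1
      · refine SuppDual.mem_dorb_of_rel ?_ (hrel t ht)
        intro c d hcd
        by_cases hc : q = c ∧ p = d
        · rwa [← hc.1, ← hc.2]
        · apply hu.suppDual c d
          rwa [Matrix.add_apply, Matrix.smul_apply, Matrix.single_apply_of_ne _ _ _ _ _ hc,
            smul_zero, add_zero] at hcd
    constructor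
    · intro q hq
      by_contra hne
      have hpos := hx _ _ hne
      refine hne (key _ _ hpos fun t ht => rel_compl.1 ?_)
      exact hu.isPlacement_flip.rel_add_single_of_row hu.suppDual.blk hq hpos.2.1 hab ht
    · intro p hp
      by_contra hne
      have hpos := hx _ _ hne
      refine hne (key _ _ hpos fun t ht => rel_compl.1 ?_)
      exact hu.isPlacement_flip.rel_add_single_of_col hu.suppDual.blk hp (fun h => h hpos.1) hab ht
  · intro h v hv
    refine trace_mul_eq_zero_of fun p q hpq => ?_
    have hpos := hx p q hpq
    refine hu.isPlacement_flip.apply_eq_zero_of_mem_tangentSpace ?_ ?_ ?_ hv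
    · intro y hy
      rw [hu.suppDual.rank_reg hy (Nat.succ_le_of_lt hpos.2.2), hu.isPlacement_flip.rank_reg]
    · intro p' hp' hup
      exact hpq ((h.2 (p', q) hup).2 p hp')
    · intro q' hq' hup
      exact hpq ((h.2 (p, q') hup).1 q hq')

theorem trace_mul_conj (x g v : Matrix (Fin n) (Fin n) ℂ) :
    (x * (g * v * g⁻¹)).trace = (g⁻¹ * x * g * v).trace := by
  rw [← mul_assoc, Matrix.trace_mul_comm]
  simp only [mul_assoc]

theorem IsLevi.inv_inv {g : Matrix (Fin n) (Fin n) ℂ} (hg : IsLevi I g) : g⁻¹⁻¹ = g :=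
  Matrix.nonsing_inv_nonsing_inv g hg.isUnit_det

theorem mem_dorb_dtrunc_conj {g ξ y : Matrix (Fin n) (Fin n) ℂ} (hg : IsLevi I g)
    (hy : y ∈ dorb I ξ) : (dtrunc I ∘ₗ conj g) y ∈ dorb I ξ :=
  mem_dorb_trans hy ⟨g, hg, rfl⟩

/-- The dual cone of the orbit of a rook matrix in the dual space. -/
theorem IsRook.dualCone_dorb (hu : IsRook I u) (hw : IsRook I w)
    (hS : {y : Fin n × Fin n | u y.1 y.2} ⊆ Uncov I w)
    (hmin : ∀ w', IsRook I w' → {y : Fin n × Fin n | u y.1 y.2} ⊆ Uncov I w' →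
      (∀ i j, count w i j ≤ count w' i j) → w' = w) :
    closure {x | SuppOn I x ∧ ∃ ξ ∈ dorb I (rookMat (flip u)),
      ∀ v ∈ tangentSpace (dorb I (rookMat (flip u))) ξ, (x * v).trace = 0} =
    closure (orb I (rookMat w)) := by
  apply subset_antisymm
  · refine closure_minimal ?_ isClosed_closure
    rintro x ⟨hx, _, ⟨g, hg, rfl⟩, h⟩
    -- By equivariance every conormal space is a translate of the one at the rook matrix, which is
    -- `clearAt` and has the orbit of `w` as a dense subset.
    have hx' : SuppOn I (g⁻¹ * x * g) := hx.mul_mul hg.inv hg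
    have h1 : g⁻¹ * x * g ∈ clearAt I {y | u y.1 y.2} := by
      refine (hu.annihilator_iff hx').1 fun v hv => ?_
      rw [← trace_mul_conj, ← hx.trace_mul_dtrunc]
      exact h _ (map_tangentSpace_le (dtrunc I ∘ₗ conj g) (continuous_dtrunc_conj g)
        (fun y hy => mem_dorb_dtrunc_conj hg hy) (Submodule.mem_map_of_mem hv))
    have h2 := hw.clearAt_subset_closure hS hmin h1
    refine mem_closure_orb_of_rel h2 (Rel.symm ?_)
    have := hg.inv.rel_conj x
    rwa [hg.inv_inv] at this
  · refine closure_mono ?_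
    intro x hx
    refine ⟨hw.suppOn.rel hx, ?_⟩
    obtain ⟨g, hg, h⟩ := hx
    have hxe := hg.eq_conj h
    refine ⟨dtrunc I (conj g (rookMat (flip u))), ⟨g, hg, rfl⟩, fun v hv => ?_⟩
    have h1 := map_tangentSpace_le (dtrunc I ∘ₗ conj g⁻¹) (continuous_dtrunc_conj g⁻¹)
      (fun y hy => mem_dorb_dtrunc_conj hg.inv hy) (Submodule.mem_map_of_mem hv)
    simp only [LinearMap.comp_apply, hu.suppDual.dtrunc_conj_inv hg] at h1
    have h2 := (hu.annihilator_iff hw.suppOn).2 (hw.rookMat_mem_clearAt hS) _ h1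
    rw [hw.suppOn.trace_mul_dtrunc, conj_apply, trace_mul_conj, hg.inv_inv, ← hxe] at h2
    exact h2

/-! ### Counting along the diagonal -/

theorem ncard_lt_succ (T : Set (Fin n)) (m : Fin n) [Decidable (m ∈ T)] :
    {p | p ∈ T ∧ (p : ℕ) < m + 1}.ncard =
      {p | p ∈ T ∧ (p : ℕ) < m}.ncard + if m ∈ T then 1 else 0 := by
  by_cases h : m ∈ T
  · rw [if_pos h]
    have e : {p | p ∈ T ∧ (p : ℕ) < m + 1} = insert m {p | p ∈ T ∧ (p : ℕ) < m} := by
      ext p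
      simp only [Set.mem_insert_iff, Set.mem_ofPred_eq]
      constructor
      · rintro ⟨h1, h2⟩
        rcases Nat.lt_succ_iff_lt_or_eq.1 h2 with h3 | h3
        · exact Or.inr ⟨h1, h3⟩
        · exact Or.inl (Fin.ext h3)
      · rintro (rfl | ⟨h1, h2⟩)
        · exact ⟨h, Nat.lt_succ_self _⟩
        · exact ⟨h1, by omega⟩
    rw [e, Set.ncard_insert_of_notMem (fun hm => lt_irrefl _ hm.2) (Set.toFinite _)]
  · rw [if_neg h, add_zero]
    congr 1
    ext p
    simp only [Set.mem_ofPred_eq]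
    constructor
    · rintro ⟨h1, h2⟩
      refine ⟨h1, lt_of_le_of_ne (Nat.lt_succ_iff.1 h2) fun h3 => h ?_⟩
      rwa [← Fin.ext h3]
    · rintro ⟨h1, h2⟩
      exact ⟨h1, by omega⟩

/-- A rook of `u` with row less than `m` has its column either at least `m`, and is counted by
`count`, or less than `m`; a column less than `m` forces the row to be so. -/
theorem IsRook.count_flip_add (hu : IsRook I u) (m : ℕ) :
    count (flip u) m m + {q | (∃ p, u p q) ∧ (q : ℕ) < m}.ncard =
      {p | (∃ q, u p q) ∧ (p : ℕ) < m}.ncard := by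
  have e1 : {p | (∃ q, u p q) ∧ (p : ℕ) < m} =
      Prod.snd '' (arcs (flip u) m m ∪ {y | u y.2 y.1 ∧ (y.1 : ℕ) < m}) := by
    ext p
    simp only [Set.mem_image, Set.mem_union, Prod.exists, exists_eq_right]
    constructor
    · rintro ⟨⟨q, h⟩, hp⟩
      refine ⟨q, ?_⟩
      by_cases hq : (q : ℕ) < m
      · exact Or.inr ⟨h, hq⟩
      · exact Or.inl ⟨h, not_lt.1 hq, hp⟩
    · rintro ⟨q, h | h⟩
      · exact ⟨⟨q, h.1⟩, h.2.2⟩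
      · exact ⟨⟨q, h.1⟩, (Fin.lt_def.1 (hu.pos h.1).2.2).trans h.2⟩
  have e2 : {q | (∃ p, u p q) ∧ (q : ℕ) < m} = Prod.fst '' {y | u y.2 y.1 ∧ (y.1 : ℕ) < m} := by
    ext q
    simp
  have hinj : Set.InjOn (Prod.snd : Fin n × Fin n → Fin n) {y | u y.2 y.1} := by
    rintro ⟨q, p⟩ h ⟨q', p'⟩ h' (rfl : p = p')
    exact Prod.ext (hu.right_unique h h') rfl
  rw [e1, Set.InjOn.ncard_image (hinj.mono ?_), Set.ncard_union_eq ?_ (Set.toFinite _)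
    (Set.toFinite _), e2, Set.InjOn.ncard_image]
  · rfl
  · rintro ⟨q, p⟩ h ⟨q', p'⟩ h' (rfl : q = q')
    exact Prod.ext rfl (hu.left_unique h.1 h'.1)
  · rw [Set.disjoint_left]
    intro y h h'
    exact absurd h'.2 (not_lt.2 h.2.1)
  · rintro y (h | h)
    · exact h.1
    · exact h.1

/-- Differences of consecutive conditions localize them to single indices, where they determine
which rows and columns contain a rook. -/
theorem IsRook.count_flip_iff (hu : IsRook I u) {I' : Set (Fin n)} :
    (∀ m ≤ n, count (flip u) m m + {p | p ∈ I' ∧ (p : ℕ) < m}.ncard =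
      {p | p ∈ I ∧ (p : ℕ) < m}.ncard) ↔
    ∀ p, ((∃ q, u p q) ↔ p ∈ I ∧ p ∉ I') ∧ ((∃ q, u q p) ↔ p ∉ I ∧ p ∈ I') := by
  classical
  have hdom : ∀ p, (∃ q, u p q) → p ∈ I := fun p ⟨q, h⟩ => (hu.pos h).1
  have hran : ∀ p, (∃ q, u q p) → p ∉ I := fun p ⟨q, h⟩ => (hu.pos h).2.1
  have key : (∀ m ≤ n, count (flip u) m m + {p | p ∈ I' ∧ (p : ℕ) < m}.ncard =
      {p | p ∈ I ∧ (p : ℕ) < m}.ncard) ↔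
      ∀ m ≤ n, {p | p ∈ {p | ∃ q, u p q} ∧ (p : ℕ) < m}.ncard +
        {p | p ∈ I' ∧ (p : ℕ) < m}.ncard = {p | p ∈ I ∧ (p : ℕ) < m}.ncard +
        {q | q ∈ {q | ∃ p, u p q} ∧ (q : ℕ) < m}.ncard := by
    refine forall₂_congr fun m _ => ?_
    have := hu.count_flip_add m
    simp only [Set.mem_ofPred_eq]
    omega
  have hlocal : ∀ p : Fin n, (((∃ q, u p q) ↔ p ∈ I ∧ p ∉ I') ∧ ((∃ q, u q p) ↔ p ∉ I ∧ p ∈ I')) ↔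
      ((if p ∈ {p | ∃ q, u p q} then 1 else 0) + (if p ∈ I' then 1 else 0) =
        (if p ∈ I then 1 else 0) + if p ∈ {q | ∃ p, u p q} then 1 else 0) := by
    intro p
    have h1 := hdom p
    have h2 := hran p
    simp only [Set.mem_ofPred_eq]
    by_cases a : ∃ q, u p q <;> by_cases b : ∃ q, u q p <;> by_cases c : p ∈ I <;>
      by_cases d : p ∈ I' <;> simp_all
  rw [key]
  simp only [hlocal]
  constructor
  · intro h p
    have h1 := h p p.2.le
    have h2 := h (p + 1) p.2
    rw [ncard_lt_succ, ncard_lt_succ, ncard_lt_succ, ncard_lt_succ] at h2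
    omega
  · intro h m
    induction m with
    | zero => simp
    | succ m ih =>
      intro hm
      have h1 := ih (by omega)
      have h2 := h ⟨m, hm⟩
      have e : ∀ (T : Set (Fin n)) [Decidable ((⟨m, hm⟩ : Fin n) ∈ T)], {p | p ∈ T ∧ (p : ℕ) < m + 1}.ncard =
          {p | p ∈ T ∧ (p : ℕ) < m}.ncard + if (⟨m, hm⟩ : Fin n) ∈ T then 1 else 0 :=
        fun T _ => ncard_lt_succ T ⟨m, hm⟩
      rw [e, e, e, e]
      omega

end GrassConormal

namespace GrassConormal

open Matrix Filter Topology

/-! ### Coordinate subspaces -/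

section Coordinates

variable {n : ℕ}

theorem mem_span_single {T : Set (Fin n)} {v : Fin n → ℂ} :
    v ∈ Submodule.span ℂ ((fun p : Fin n => Pi.single p (1 : ℂ)) '' T) ↔ ∀ p ∉ T, v p = 0 := by
  constructor
  · intro h p hp
    have : Submodule.span ℂ ((fun p : Fin n => Pi.single p (1 : ℂ)) '' T) ≤
        LinearMap.ker (LinearMap.proj p : (Fin n → ℂ) →ₗ[ℂ] ℂ) := by
      refine Submodule.span_le.2 ?_
      rintro _ ⟨q, hq, rfl⟩
      have hne : p ≠ q := fun h => hp (h ▸ hq)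
      simp [hne]
    exact this h
  · intro h
    have : v = ∑ p, v p • (Pi.single p (1 : ℂ) : Fin n → ℂ) := by
      ext q
      simp [Finset.sum_apply, Pi.single_apply]
    rw [this]
    refine Submodule.sum_mem _ fun p _ => ?_
    by_cases hp : p ∈ T
    · exact Submodule.smul_mem _ _ (Submodule.subset_span ⟨p, hp, rfl⟩)
    · rw [h p hp, zero_smul]
      exact Submodule.zero_mem _

open Classical in
theorem finrank_span_single (T : Set (Fin n)) :
    Module.finrank ℂ (Submodule.span ℂ ((fun p : Fin n => Pi.single p (1 : ℂ)) '' T)) =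
      T.ncard := by
  let e : Submodule.span ℂ ((fun p : Fin n => Pi.single p (1 : ℂ)) '' T) ≃ₗ[ℂ] (T → ℂ) :=
    { toFun := fun x t => x.1 t.1
      map_add' := fun _ _ => rfl
      map_smul' := fun _ _ => rfl
      invFun := fun f => ⟨fun p => if h : p ∈ T then f ⟨p, h⟩ else 0,
        mem_span_single.2 fun p hp => by simp [hp]⟩
      left_inv := by
        intro x
        ext p
        by_cases h : p ∈ T
        · simp [h]
        · simp [h, mem_span_single.1 x.2 p h]
      right_inv := by
        intro f
        ext t
        simp }
  rw [e.finrank_eq, Module.finrank_fintype_fun_eq_card, ← Nat.card_coe_set_eq,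
    Nat.card_eq_fintype_card]

theorem finrank_span_single_inf_ker {T : Set (Fin n)} {A : Matrix (Fin n) (Fin n) ℂ}
    (hA : ∀ p q, A p q ≠ 0 → q ∈ T) :
    Module.finrank ℂ ↥(Submodule.span ℂ ((fun p : Fin n => Pi.single p (1 : ℂ)) '' T) ⊓
      LinearMap.ker A.mulVecLin) + A.rank = T.ncard := by
  classical
  set C := Submodule.span ℂ ((fun p : Fin n => Pi.single p (1 : ℂ)) '' T) with hC
  have h1 := LinearMap.finrank_range_add_finrank_ker (A.mulVecLin.domRestrict C)
  rw [finrank_span_single, LinearMap.range_domRestrict, LinearMap.ker_domRestrict] at h1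
  have h2 : C.map A.mulVecLin = LinearMap.range A.mulVecLin := by
    apply le_antisymm
    · exact LinearMap.map_le_range
    · rintro _ ⟨v, rfl⟩
      refine ⟨fun p => if p ∈ T then v p else 0, mem_span_single.2 fun p hp => by simp [hp], ?_⟩
      ext p
      simp only [Matrix.mulVecLin_apply, Matrix.mulVec, dotProduct]
      refine Finset.sum_congr rfl fun q _ => ?_
      by_cases hq : q ∈ T
      · simp [hq]
      · have : A p q = 0 := by_contra fun h => hq (hA p q h)
        simp [this]
  have h3 : Module.finrank ℂ ↥(C ⊓ LinearMap.ker A.mulVecLin) =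
      Module.finrank ℂ ↥(Submodule.comap C.subtype (LinearMap.ker A.mulVecLin)) := by
    rw [← Submodule.map_comap_subtype]
    exact (Submodule.equivMapOfInjective C.subtype C.injective_subtype _).finrank_eq.symm
  rw [h2] at h1
  rw [h3, ← h1, add_comm]
  rfl

end Coordinates

/-! ### The orbits in the conormal space -/

variable {k l : ℕ} {lam mu : YoungDiagram}

theorem mem_fixedPt {v : Fin (k + l) → ℂ} :
    v ∈ fixedPt k l lam ↔ ∀ p ∉ fixedIdx k l lam, v p = 0 := mem_span_single

theorem mem_conormal {A : Matrix (Fin (k + l)) (Fin (k + l)) ℂ} :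
    A ∈ conormal k l lam ↔ SuppOn (fixedIdx k l lam) A := by
  constructor
  · rintro ⟨h1, h2, h3⟩ p q hne
    have hq : q ∉ fixedIdx k l lam := by
      intro hq
      have := congrFun (h1 (Pi.single q 1) (mem_fixedPt.2 fun p hp => by
        have hne : p ≠ q := fun h => hp (h ▸ hq)
        simp [hne])) p
      rw [Matrix.mulVec_single_one] at this
      exact hne this
    have hp : p ∈ fixedIdx k l lam := by
      by_contra hp
      have := mem_fixedPt.1 (h2 (Pi.single q 1)) p hp
      rw [Matrix.mulVec_single_one] at this
      exact hne this
    refine ⟨hp, hq, ?_⟩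
    by_contra hlt
    have hqp : q < p := lt_of_le_of_ne (not_lt.1 hlt) fun h => hq (h ▸ hp)
    have := h3 (Matrix.single q p 1) (Matrix.blockTriangular_single hqp.le 1)
      (Matrix.trace_single_eq_of_ne _ _ _ hqp.ne)
    exact hne (by simpa [Matrix.trace_mul_single] using this)
  · intro h
    refine ⟨fun v hv => ?_, fun v => mem_fixedPt.2 fun p hp => ?_, fun b hb _ => ?_⟩
    · ext p
      rw [Matrix.mulVec, dotProduct]
      refine Finset.sum_eq_zero fun q _ => ?_
      by_cases hpq : A p q = 0
      · rw [hpq, zero_mul]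
      · rw [mem_fixedPt.1 hv q (h p q hpq).2.1, mul_zero]
    · rw [Matrix.mulVec, dotProduct]
      refine Finset.sum_eq_zero fun q _ => ?_
      have : A p q = 0 := by_contra fun hpq => hp (h p q hpq).1
      rw [this, zero_mul]
    · exact trace_mul_eq_zero_of fun p q hpq => hb (h p q hpq).2.2

theorem finrank_conormal : Module.finrank ℂ (conormal k l lam) =
    {y : Fin (k + l) × Fin (k + l) | Pos (fixedIdx k l lam) y.1 y.2}.ncard := by
  rw [← finrank_coordSub]
  have : conormal k l lam = coordSub {y | Pos (fixedIdx k l lam) y.1 y.2} :=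
    Submodule.ext fun A => mem_conormal
  rw [this]

theorem coe_inv_eq (g : Matrix.SpecialLinearGroup (Fin (k + l)) ℂ) :
    ((g⁻¹ : Matrix.SpecialLinearGroup (Fin (k + l)) ℂ) : Matrix (Fin (k + l)) (Fin (k + l)) ℂ) =
      (g : Matrix (Fin (k + l)) (Fin (k + l)) ℂ)⁻¹ := by
  symm
  apply Matrix.inv_eq_right_inv
  rw [← Matrix.SpecialLinearGroup.coe_mul, mul_inv_cancel, Matrix.SpecialLinearGroup.coe_one]

theorem map_fixedPt_le_iff {g : Matrix (Fin (k + l)) (Fin (k + l)) ℂ} :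
    (fixedPt k l lam).map (Matrix.toLin' g) ≤ fixedPt k l lam ↔
      ∀ p ∉ fixedIdx k l lam, ∀ q ∈ fixedIdx k l lam, g p q = 0 := by
  constructor
  · intro h p hp q hq
    have h1 : (Pi.single q 1 : Fin (k + l) → ℂ) ∈ fixedPt k l lam :=
      Submodule.subset_span ⟨q, hq, rfl⟩
    have h2 := mem_fixedPt.1 (h (Submodule.mem_map_of_mem h1)) p hp
    rwa [Matrix.toLin'_apply, Matrix.mulVec_single_one] at h2
  · rintro h _ ⟨v, hv, rfl⟩
    refine mem_fixedPt.2 fun p hp => ?_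
    rw [Matrix.toLin'_apply, Matrix.mulVec, dotProduct]
    refine Finset.sum_eq_zero fun q _ => ?_
    by_cases hq : q ∈ fixedIdx k l lam
    · rw [h p hp q hq, zero_mul]
    · rw [mem_fixedPt.1 hv q hq, mul_zero]

theorem inv_mem_borelStab {g : Matrix.SpecialLinearGroup (Fin (k + l)) ℂ}
    (hg : g ∈ borelStab k l lam) : g⁻¹ ∈ borelStab k l lam := by
  refine ⟨?_, ?_⟩
  · rw [coe_inv_eq]
    exact blockTriangular_inv hg.1 (by rw [g.2]; exact isUnit_one)
  · conv_lhs => rw [← hg.2]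
    rw [← Submodule.map_comp, ← Matrix.toLin'_mul, ← Matrix.SpecialLinearGroup.coe_mul,
      inv_mul_cancel, Matrix.SpecialLinearGroup.coe_one, Matrix.toLin'_one, Submodule.map_id]

open Classical in
/-- Only the diagonal blocks of an element of the stabilizer matter for its action. -/
theorem exists_isLevi_of_mem_borelStab {g : Matrix.SpecialLinearGroup (Fin (k + l)) ℂ}
    (hg : g ∈ borelStab k l lam) :
    ∃ h, IsLevi (fixedIdx k l lam) h ∧ ∀ A, SuppOn (fixedIdx k l lam) A →
      (g : Matrix (Fin (k + l)) (Fin (k + l)) ℂ) * A *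
        ((g⁻¹ : Matrix.SpecialLinearGroup (Fin (k + l)) ℂ) :
          Matrix (Fin (k + l)) (Fin (k + l)) ℂ) = h * A * h⁻¹ := by
  set I := fixedIdx k l lam with hI
  set G := (g : Matrix (Fin (k + l)) (Fin (k + l)) ℂ) with hG
  have hinv := inv_mem_borelStab hg
  have hb : ∀ p ∉ I, ∀ q ∈ I, G p q = 0 := map_fixedPt_le_iff.1 hg.2.le
  have hb' := map_fixedPt_le_iff.1 hinv.2.le
  have hdet : IsUnit G.det := by rw [hG, g.2]; exact isUnit_one
  -- The off-diagonal block of `g` is dropped: it maps the complement into `W`, which is killed by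
  -- conormal maps, and it cannot enter on the left since their image is already in `W`.
  set h : Matrix (Fin (k + l)) (Fin (k + l)) ℂ :=
    Matrix.of fun p q => if p ∈ I ↔ q ∈ I then G p q else 0 with hh
  have hlevi : IsLevi I h := by
    refine ⟨fun p q hlt => ?_, fun {p q} hne => ?_, fun p => ?_⟩
    · simp only [hh, Matrix.of_apply]
      rw [show G p q = 0 from hg.1 hlt, ite_self]
    · by_contra hpq
      simp [hh, hpq] at hne
    · have := (isUnit_iff_diag hg.1).1 ((Matrix.isUnit_iff_isUnit_det _).2 hdet) p
      simpa [hh] using this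
  refine ⟨h, hlevi, fun A hA => ?_⟩
  rw [coe_inv_eq, ← hG]
  have h1 : G * A = h * A := by
    ext p q
    rw [Matrix.mul_apply, Matrix.mul_apply]
    refine Finset.sum_congr rfl fun a _ => ?_
    by_cases ha : A a q = 0
    · rw [ha, mul_zero, mul_zero]
    · have haI := (hA a q ha).1
      by_cases hp : p ∈ I
      · simp [hh, hp, haI]
      · rw [hb p hp a haI]
        simp [hh, hp, haI]
  set A' := G * A * G⁻¹ with hA'
  have hcol : ∀ p q, A' p q ≠ 0 → q ∉ I := by
    intro p q hne hq
    obtain ⟨b, h2, h3⟩ := exists_of_mul_apply_ne_zero hne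
    obtain ⟨a, h4, h5⟩ := exists_of_mul_apply_ne_zero h2
    have := hb' b (hA a b h5).2.1 q hq
    rw [coe_inv_eq] at this
    exact h3 this
  have h2 : A' * G = A' * h := by
    ext p q
    rw [Matrix.mul_apply, Matrix.mul_apply]
    refine Finset.sum_congr rfl fun a _ => ?_
    by_cases ha : A' p a = 0
    · rw [ha, zero_mul, zero_mul]
    · have haI := hcol p a ha
      by_cases hq : q ∈ I
      · rw [hb a haI q hq]
        simp [hh, hq, haI]
      · simp [hh, hq, haI]
  have h3 : A' * G = G * A := by
    rw [hA', mul_assoc, Matrix.nonsing_inv_mul _ hdet, mul_one]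
  exact hlevi.eq_conj (by rw [← h1, ← h3, h2])

theorem exists_mem_borelStab_of_isLevi {h : Matrix (Fin (k + l)) (Fin (k + l)) ℂ}
    (hh : IsLevi (fixedIdx k l lam) h) :
    ∃ g ∈ borelStab k l lam, ∀ A : Matrix (Fin (k + l)) (Fin (k + l)) ℂ,
      (g : Matrix (Fin (k + l)) (Fin (k + l)) ℂ) * A *
        ((g⁻¹ : Matrix.SpecialLinearGroup (Fin (k + l)) ℂ) :
          Matrix (Fin (k + l)) (Fin (k + l)) ℂ) = h * A * h⁻¹ := by
  -- Conjugation ignores scalars, so a root of the determinant allows passage to determinant one;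
  -- the empty matrix already has determinant one.
  obtain ⟨c, hc⟩ : ∃ c : ℂ, c ^ (k + l) * h.det = 1 := by
    rcases Nat.eq_zero_or_pos (k + l) with h0 | h0
    · have : IsEmpty (Fin (k + l)) := by rw [h0]; infer_instance
      exact ⟨1, by simp⟩
    · obtain ⟨c, hc⟩ := IsAlgClosed.exists_pow_nat_eq (h.det)⁻¹ h0
      exact ⟨c, by rw [hc, inv_mul_cancel₀ hh.isUnit_det.ne_zero]⟩
  have hdet : (c • h).det = 1 := by
    rw [Matrix.det_smul, Fintype.card_fin, hc]
  set g : Matrix.SpecialLinearGroup (Fin (k + l)) ℂ := ⟨c • h, hdet⟩ with hg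
  have hle : (fixedPt k l lam).map (Matrix.toLin' (c • h)) ≤ fixedPt k l lam := by
    refine map_fixedPt_le_iff.2 fun p hp q hq => ?_
    have : h p q = 0 := by_contra fun hne => hp ((hh.block hne).2 hq)
    simp [this]
  have hinj : Function.Injective (Matrix.toLin' (c • h)) := by
    have hu : IsUnit (c • h) := (Matrix.isUnit_iff_isUnit_det _).2 (by rw [hdet]; exact isUnit_one)
    exact Matrix.mulVec_injective_iff_isUnit.2 hu
  refine ⟨g, ⟨?_, ?_⟩, fun A => ?_⟩
  · intro p q hlt
    have : h p q = 0 := hh.tri hlt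
    simp [hg, this]
  · refine Submodule.eq_of_le_of_finrank_eq hle ?_
    exact (Submodule.equivMapOfInjective _ hinj _).finrank_eq.symm
  · have e : (c • h) * A = (h * A * h⁻¹) * (c • h) := by
      rw [Matrix.smul_mul, Matrix.mul_smul, mul_assoc _ h⁻¹ h,
        Matrix.nonsing_inv_mul _ hh.isUnit_det, mul_one]
    rw [coe_inv_eq]
    change (c • h) * A * (c • h)⁻¹ = _
    rw [e, mul_assoc, Matrix.mul_nonsing_inv _ (by rw [hdet]; exact isUnit_one), mul_one]

theorem isOrbit_iff {O : Set (Matrix (Fin (k + l)) (Fin (k + l)) ℂ)} :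
    IsOrbit k l lam O ↔ ∃ x, SuppOn (fixedIdx k l lam) x ∧ O = orb (fixedIdx k l lam) x := by
  refine exists_congr fun x => ?_
  rw [mem_conormal]
  refine and_congr_right fun hx => ?_
  have : {A' | ∃ g ∈ borelStab k l lam, A' = (g : Matrix (Fin (k + l)) (Fin (k + l)) ℂ) * x *
      ((g⁻¹ : Matrix.SpecialLinearGroup (Fin (k + l)) ℂ) :
        Matrix (Fin (k + l)) (Fin (k + l)) ℂ)} = orb (fixedIdx k l lam) x := by
    ext A'
    constructor
    · rintro ⟨g, hg, rfl⟩
      obtain ⟨h, hh, he⟩ := exists_isLevi_of_mem_borelStab hg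
      rw [he x hx]
      exact hh.rel_conj x
    · rintro ⟨h, hh, he⟩
      obtain ⟨g, hg, hgh⟩ := exists_mem_borelStab_of_isLevi hh
      exact ⟨g, hg, by rw [hgh, hh.eq_conj he]⟩
  rw [this]

theorem isOrbit_iff_rook {O : Set (Matrix (Fin (k + l)) (Fin (k + l)) ℂ)} :
    IsOrbit k l lam O ↔
      ∃ w, IsRook (fixedIdx k l lam) w ∧ O = orb (fixedIdx k l lam) (rookMat w) := by
  rw [isOrbit_iff]
  constructor
  · rintro ⟨x, hx, rfl⟩
    obtain ⟨w, hw, hrel⟩ := hx.exists_rook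
    exact ⟨w, hw, orb_eq_of_rel hrel⟩
  · rintro ⟨w, hw, rfl⟩
    exact ⟨_, hw.suppOn, rfl⟩

theorem isCodimOrbit_orb_iff {w : Fin (k + l) → Fin (k + l) → Prop}
    (hw : IsRook (fixedIdx k l lam) w) {c : ℕ} :
    IsCodimOrbit k l lam c (orb (fixedIdx k l lam) (rookMat w)) ↔
      (Uncov (fixedIdx k l lam) w).ncard = c := by
  constructor
  · rintro ⟨-, h⟩
    have h1 := h _ (mem_orb_self _)
    have h2 := hw.finrank_tangentSpace_orb (Rel.refl _)
    rw [finrank_conormal] at h1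
    omega
  · rintro rfl
    refine ⟨isOrbit_iff_rook.2 ⟨w, hw, rfl⟩, fun y hy => ?_⟩
    rw [hw.finrank_tangentSpace_orb hy, finrank_conormal]

theorem isDualSpaceOrbit_iff {Q : Set (Matrix (Fin (k + l)) (Fin (k + l)) ℂ)} :
    IsDualSpaceOrbit k l lam Q ↔
      ∃ ξ, SuppDual (fixedIdx k l lam) ξ ∧ Q = dorb (fixedIdx k l lam) ξ := by
  set I := fixedIdx k l lam with hI
  refine exists_congr fun ξ => and_congr_right fun hξ => ?_
  -- The trace pairing is perfect, as elementary matrices show, so the dual action is truncated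
  -- conjugation.
  have key : ∀ h, IsLevi I h → ∀ ξ', SuppDual I ξ' →
      ((∀ A, SuppOn I A → (A * ξ').trace = (h⁻¹ * A * h * ξ).trace) ↔
        ξ' = dtrunc I (conj h ξ)) := by
    intro h hh ξ' hξ'
    constructor
    · intro hA
      ext q p
      by_cases hpq : Pos I p q
      · have hs : SuppOn I (Matrix.single p q 1) := by
          intro a b hab
          by_cases hc : p = a ∧ q = b
          · rwa [← hc.1, ← hc.2]
          · exact absurd (Matrix.single_apply_of_ne _ _ _ _ _ hc) hab
        have h1 := hA (Matrix.single p q 1) hs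
        rw [← trace_mul_conj] at h1
        rw [dtrunc_of hpq, conj_apply]
        simpa [Matrix.trace_single_mul] using h1
      · rw [dtrunc_of_not hpq]
        exact by_contra fun hne => hpq (hξ' q p hne)
    · rintro rfl A hA
      rw [hA.trace_mul_dtrunc, conj_apply, trace_mul_conj]
  have hconj : ∀ g ∈ borelStab k l lam, ∀ h, IsLevi I h →
      (∀ A, SuppOn I A → (g : Matrix (Fin (k + l)) (Fin (k + l)) ℂ) * A *
        ((g⁻¹ : Matrix.SpecialLinearGroup (Fin (k + l)) ℂ) :
          Matrix (Fin (k + l)) (Fin (k + l)) ℂ) = h * A * h⁻¹) →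
      ∀ A, SuppOn I A → ((g⁻¹ : Matrix.SpecialLinearGroup (Fin (k + l)) ℂ) :
          Matrix (Fin (k + l)) (Fin (k + l)) ℂ) * A *
          (g : Matrix (Fin (k + l)) (Fin (k + l)) ℂ) = h⁻¹ * A * h := by
    intro g hg h hh he A hA
    have h1 := he (h⁻¹ * A * h) (hA.mul_mul hh.inv hh)
    have hdet : IsUnit (g : Matrix (Fin (k + l)) (Fin (k + l)) ℂ).det := by
      rw [g.2]
      exact isUnit_one
    have h2 : h * (h⁻¹ * A * h) * h⁻¹ = A := by
      have e := hh.isUnit_det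
      rw [mul_assoc h⁻¹, ← mul_assoc h, Matrix.mul_nonsing_inv _ e, one_mul, mul_assoc,
        Matrix.mul_nonsing_inv _ e, mul_one]
    rw [h2, coe_inv_eq] at h1
    rw [coe_inv_eq]
    conv_lhs => rw [← h1]
    rw [← mul_assoc, ← mul_assoc, Matrix.nonsing_inv_mul _ hdet, one_mul, mul_assoc,
      Matrix.nonsing_inv_mul _ hdet, mul_one]
  have : {ξ' | ξ' ∈ conormalDual k l lam ∧ ∃ g ∈ borelStab k l lam, ∀ A ∈ conormal k l lam,
      (A * ξ').trace = (((g⁻¹ : Matrix.SpecialLinearGroup (Fin (k + l)) ℂ) :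
        Matrix (Fin (k + l)) (Fin (k + l)) ℂ) * A *
          (g : Matrix (Fin (k + l)) (Fin (k + l)) ℂ) * ξ).trace} = dorb I ξ := by
    ext ξ'
    constructor
    · rintro ⟨hξ', g, hg, hA⟩
      obtain ⟨h, hh, he⟩ := exists_isLevi_of_mem_borelStab hg
      refine ⟨h, hh, (key h hh ξ' hξ').1 fun A hAs => ?_⟩
      rw [hA A (mem_conormal.2 hAs), hconj g hg h hh he A hAs]
    · rintro ⟨h, hh, rfl⟩
      refine ⟨suppDual_dtrunc _, ?_⟩
      obtain ⟨g, hg, hgh⟩ := exists_mem_borelStab_of_isLevi hh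
      refine ⟨g, hg, fun A hA => ?_⟩
      have hAs := mem_conormal.1 hA
      rw [hconj g hg h hh (fun A _ => hgh A) A hAs]
      exact (key h hh _ (suppDual_dtrunc _)).2 rfl A hAs
  rw [this]

/-! ### The slices -/

/-- A point v + ξ v of the graph lies in ℂ^m exactly if v does and the components of ξ v from `m` on
vanish, because ξ does not affect the components in `I`. Rank and nullity then apply. -/
theorem SuppDual.finrank_graph {ξ : Matrix (Fin (k + l)) (Fin (k + l)) ℂ}
    (hξ : SuppDual (fixedIdx k l lam) ξ) (m : ℕ) :
    Module.finrank ℂ ↥((fixedPt k l lam).map (Matrix.toLin' (1 + ξ)) ⊓ stdFlag (k + l) m) +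
      (reg m m ξ).rank = {p | p ∈ fixedIdx k l lam ∧ (p : ℕ) < m}.ncard := by
  set I := fixedIdx k l lam with hI
  have hsq : ξ * ξ = 0 := by
    ext p q
    by_contra hne
    obtain ⟨a, h1, h2⟩ := exists_of_mul_apply_ne_zero hne
    exact (hξ a q h2).2.1 (hξ p a h1).1
  have hinj : Function.Injective (Matrix.toLin' (1 + ξ)) := by
    have hu : IsUnit (1 + ξ) := by
      refine ⟨⟨1 + ξ, 1 - ξ, ?_, ?_⟩, rfl⟩ <;> simp [add_mul, mul_add, sub_mul, mul_sub, hsq]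
    exact Matrix.mulVec_injective_iff_isUnit.2 hu
  rw [← finrank_span_single_inf_ker (T := {p | p ∈ I ∧ (p : ℕ) < m}) (A := reg m m ξ)]
  swap
  · intro p q hne
    simp only [reg, Matrix.of_apply, ne_eq, ite_eq_right_iff, Classical.not_imp] at hne
    exact ⟨(hξ p q hne.2).1, hne.1.2⟩
  congr 1
  set K := Submodule.span ℂ ((fun p : Fin (k + l) => Pi.single p (1 : ℂ)) ''
    {p | p ∈ I ∧ (p : ℕ) < m}) ⊓ LinearMap.ker (reg m m ξ).mulVecLin with hK
  have hval : ∀ v : Fin (k + l) → ℂ, Matrix.toLin' (1 + ξ) v = v + ξ.mulVec v := by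
    intro v
    rw [Matrix.toLin'_apply, Matrix.add_mulVec, Matrix.one_mulVec]
  have hξI : ∀ v : Fin (k + l) → ℂ, ∀ p ∈ I, ξ.mulVec v p = 0 := by
    intro v p hp
    rw [Matrix.mulVec, dotProduct]
    refine Finset.sum_eq_zero fun q _ => ?_
    have : ξ p q = 0 := by_contra fun hne => (hξ p q hne).2.1 hp
    rw [this, zero_mul]
  have hregv : ∀ v : Fin (k + l) → ℂ, (∀ p : Fin (k + l), m ≤ (p : ℕ) → v p = 0) →
      ∀ p : Fin (k + l), m ≤ (p : ℕ) → (reg m m ξ).mulVec v p = ξ.mulVec v p := by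
    intro v hv p hp
    rw [Matrix.mulVec, Matrix.mulVec, dotProduct, dotProduct]
    refine Finset.sum_congr rfl fun q _ => ?_
    by_cases hq : (q : ℕ) < m
    · rw [reg_apply_of hp hq]
    · rw [hv q (not_lt.1 hq), mul_zero, mul_zero]
  have hmap : (fixedPt k l lam).map (Matrix.toLin' (1 + ξ)) ⊓ stdFlag (k + l) m =
      K.map (Matrix.toLin' (1 + ξ)) := by
    apply le_antisymm
    · rintro _ ⟨⟨v, hv, rfl⟩, h2⟩
      refine ⟨v, ?_, rfl⟩
      have hv' := mem_fixedPt.1 hv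
      have h2' : ∀ p : Fin (k + l), m ≤ (p : ℕ) → v p + ξ.mulVec v p = 0 := by
        intro p hp
        have := mem_span_single.1 h2 p (not_lt.2 hp)
        rw [hval] at this
        exact this
      have hv0 : ∀ p : Fin (k + l), m ≤ (p : ℕ) → v p = 0 := by
        intro p hp
        by_cases hpI : p ∈ I
        · have := h2' p hp
          rwa [hξI v p hpI, add_zero] at this
        · exact hv' p hpI
      refine ⟨mem_span_single.2 fun p hp => ?_, ?_⟩
      · by_cases hpI : p ∈ I
        · exact hv0 p (not_lt.1 fun h => hp ⟨hpI, h⟩)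
        · exact hv' p hpI
      · rw [SetLike.mem_coe, LinearMap.mem_ker, Matrix.mulVecLin_apply]
        ext p
        by_cases hp : m ≤ (p : ℕ)
        · rw [hregv v hv0 p hp]
          have := h2' p hp
          rwa [hv0 p hp, zero_add] at this
        · rw [Matrix.mulVec, dotProduct]
          refine Finset.sum_eq_zero fun q _ => ?_
          simp [reg, hp]
    · rintro _ ⟨v, ⟨h1, h2⟩, rfl⟩
      have h1' := mem_span_single.1 h1
      rw [SetLike.mem_coe, LinearMap.mem_ker, Matrix.mulVecLin_apply] at h2
      have hv0 : ∀ p : Fin (k + l), m ≤ (p : ℕ) → v p = 0 :=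
        fun p hp => h1' p fun h => absurd h.2 (not_lt.2 hp)
      refine ⟨⟨v, mem_fixedPt.2 fun p hp => h1' p fun h => hp h.1, rfl⟩, ?_⟩
      refine mem_span_single.2 fun p hp => ?_
      have hp : m ≤ (p : ℕ) := not_lt.1 hp
      rw [hval, Pi.add_apply, hv0 p hp, zero_add, ← hregv v hv0 p hp, h2]
      rfl
  rw [hmap]
  exact (Submodule.equivMapOfInjective _ hinj _).finrank_eq.symm

theorem mem_slice_iff {ξ : Matrix (Fin (k + l)) (Fin (k + l)) ℂ} :
    ξ ∈ slice k l lam mu ↔ SuppDual (fixedIdx k l lam) ξ ∧ ∀ m ≤ k + l,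
      (reg m m ξ).rank + {p | p ∈ fixedIdx k l mu ∧ (p : ℕ) < m}.ncard =
        {p | p ∈ fixedIdx k l lam ∧ (p : ℕ) < m}.ncard := by
  refine and_congr_right fun hξ => forall₂_congr fun m _ => ?_
  have := SuppDual.finrank_graph hξ m
  omega

theorem SuppDual.mem_slice_of_mem_dorb {ξ ξ' : Matrix (Fin (k + l)) (Fin (k + l)) ℂ}
    (hξ : SuppDual (fixedIdx k l lam) ξ) (h : ξ' ∈ dorb (fixedIdx k l lam) ξ) :
    ξ' ∈ slice k l lam mu ↔ ξ ∈ slice k l lam mu := by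
  rw [mem_slice_iff, mem_slice_iff]
  refine and_congr (iff_of_true (suppDual_of_mem_dorb h) hξ) (forall₂_congr fun m _ => ?_)
  rw [hξ.rank_reg h le_rfl]

theorem IsRook.mem_slice_iff {u : Fin (k + l) → Fin (k + l) → Prop}
    (hu : IsRook (fixedIdx k l lam) u) :
    rookMat (flip u) ∈ slice k l lam mu ↔
      ∀ p, ((∃ q, u p q) ↔ p ∈ fixedIdx k l lam ∧ p ∉ fixedIdx k l mu) ∧
        ((∃ q, u q p) ↔ p ∉ fixedIdx k l lam ∧ p ∈ fixedIdx k l mu) := by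
  rw [GrassConormal.mem_slice_iff, ← hu.count_flip_iff]
  simp only [hu.isPlacement_flip.rank_reg, hu.suppDual, true_and]

end GrassConormal

namespace GrassConormal

open Matrix Filter Topology

/-! ### Open orbits in the slices -/

variable {n : ℕ}

/-- The rook placement with rooks at two given positions. -/
def twoRooks (a1 b1 a2 b2 : Fin n) : Fin n → Fin n → Prop :=
  fun p q => (p = a1 ∧ q = b1) ∨ (p = a2 ∧ q = b2)

/-- Two equal positions, or two positions such that the first one neither covers nor is covered by
the second one, the intervals between the row and the column index being disjoint or nested. -/
structure Noncrossing (I : Set (Fin n)) (a1 b1 a2 b2 : Fin n) : Prop where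
  pos₁ : Pos I a1 b1
  pos₂ : Pos I a2 b2
  or : (a1 = a2 ∧ b1 = b2) ∨ (a1 < a2 ∧ b1 < a2) ∨ (a1 < a2 ∧ b2 < b1)

variable {I : Set (Fin n)} {a1 b1 a2 b2 : Fin n}

theorem Noncrossing.ends (h : Noncrossing I a1 b1 a2 b2) :
    (a1 = a2 ∧ b1 = b2) ∨ (a1 < a2 ∧ b1 ≠ b2) := by
  have h2 := h.pos₂.2.2
  rcases h.or with h | h | h
  · exact Or.inl h
  · exact Or.inr ⟨h.1, (h.2.trans h2).ne⟩
  · exact Or.inr ⟨h.1, h.2.ne'⟩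

theorem Noncrossing.isRook (h : Noncrossing I a1 b1 a2 b2) : IsRook I (twoRooks a1 b1 a2 b2) := by
  have h1 := h.pos₁
  have h2 := h.pos₂
  have he := h.ends
  refine ⟨?_, ?_, ?_⟩
  · rintro p q (⟨rfl, rfl⟩ | ⟨rfl, rfl⟩)
    · exact h1
    · exact h2
  · rintro p q q' (⟨rfl, rfl⟩ | ⟨rfl, rfl⟩) (⟨h3, rfl⟩ | ⟨h3, rfl⟩)
    · rfl
    · rcases he with he | he
      · exact he.2
      · exact absurd h3 he.1.ne
    · rcases he with he | he
      · exact he.2.symm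
      · exact absurd h3 he.1.ne'
    · rfl
  · rintro p p' q (⟨rfl, rfl⟩ | ⟨rfl, rfl⟩) (⟨rfl, h3⟩ | ⟨rfl, h3⟩)
    · rfl
    · rcases he with he | he
      · exact he.1
      · exact absurd h3 he.2
    · rcases he with he | he
      · exact he.1.symm
      · exact absurd h3.symm he.2
    · rfl

/-- Rooks must lie above the diagonal, so disjoint intervals leave one placement with the given rows
and columns, while nested intervals also allow the crossed one. -/
theorem Noncrossing.eq_or_eq (h : Noncrossing I a1 b1 a2 b2) {u : Fin n → Fin n → Prop}
    (hu : IsRook I u) (hdom : ∀ p, (∃ q, u p q) ↔ p = a1 ∨ p = a2)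
    (hran : ∀ q, (∃ p, u p q) ↔ q = b1 ∨ q = b2) :
    u = twoRooks a1 b1 a2 b2 ∨ (a1 < a2 ∧ b2 < b1 ∧ u = twoRooks a1 b2 a2 b1) := by
  obtain ⟨c1, hc1⟩ := (hdom a1).2 (Or.inl rfl)
  obtain ⟨c2, hc2⟩ := (hdom a2).2 (Or.inr rfl)
  have hu' : u = twoRooks a1 c1 a2 c2 := by
    funext p q
    apply propext
    constructor
    · intro hpq
      rcases (hdom p).1 ⟨q, hpq⟩ with rfl | rfl
      · exact Or.inl ⟨rfl, hu.right_unique hpq hc1⟩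
      · exact Or.inr ⟨rfl, hu.right_unique hpq hc2⟩
    · rintro (⟨rfl, rfl⟩ | ⟨rfl, rfl⟩)
      · exact hc1
      · exact hc2
  have e1 := (hran c1).1 ⟨_, hc1⟩
  have e2 := (hran c2).1 ⟨_, hc2⟩
  have hp2 := (hu.pos hc2).2.2
  rcases h.or with h' | h' | h'
  · left
    obtain ⟨rfl, rfl⟩ := h'
    simp only [or_self] at e1 e2
    rw [hu', e1, e2]
  · left
    have e3 : c2 = b2 := by
      rcases e2 with e2 | e2
      · rw [e2] at hp2
        exact absurd (hp2.trans h'.2) (lt_irrefl _)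
      · exact e2
    have e4 : c1 = b1 := by
      rcases e1 with e1 | e1
      · exact e1
      · rw [e1, ← e3] at hc1
        exact absurd (hu.left_unique hc1 hc2) h'.1.ne
    rw [hu', e3, e4]
  · rcases e1 with e1 | e1
    · left
      have e3 : c2 = b2 := by
        rcases e2 with e2 | e2
        · rw [e1, ← e2] at hc1
          exact absurd (hu.left_unique hc1 hc2) h'.1.ne
        · exact e2
      rw [hu', e1, e3]
    · right
      have e3 : c2 = b1 := by
        rcases e2 with e2 | e2
        · exact e2
        · rw [e1, ← e2] at hc1
          exact absurd (hu.left_unique hc1 hc2) h'.1.ne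
      exact ⟨h'.1, h'.2, by rw [hu', e1, e3]⟩

theorem suppDual_add {x y : Matrix (Fin n) (Fin n) ℂ} (hx : SuppDual I x) (hy : SuppDual I y) :
    SuppDual I (x + y) := by
  intro p q hne
  by_contra hpq
  have h1 : x p q = 0 := by_contra fun h => hpq (hx p q h)
  have h2 : y p q = 0 := by_contra fun h => hpq (hy p q h)
  simp [h1, h2] at hne

theorem suppDual_single {p q : Fin n} (h : Pos I q p) (t : ℂ) :
    SuppDual I (Matrix.single p q t) := by
  intro a b hab
  by_cases hc : p = a ∧ q = b
  · rwa [← hc.1, ← hc.2]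
  · exact absurd (Matrix.single_apply_of_ne _ _ _ _ _ hc) hab

theorem isLevi_one_add_single {p q : Fin n} (h : p < q) (hI : p ∈ I ↔ q ∈ I) (t : ℂ) :
    IsLevi I (1 + Matrix.single p q t) := by
  have key : ∀ a b, Matrix.single p q t a b ≠ 0 → p = a ∧ q = b := by
    intro a b hab
    by_contra hc
    exact hab (Matrix.single_apply_of_ne _ _ _ _ _ hc)
  refine isLevi_one_add ?_ ?_ ?_
  · intro a b hab
    obtain ⟨rfl, rfl⟩ := key a b hab
    exact h.le
  · intro a b hab
    obtain ⟨rfl, rfl⟩ := key a b hab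
    exact hI
  · intro a
    rw [Matrix.single_apply_of_ne]
    · simp
    · rintro ⟨rfl, rfl⟩
      exact lt_irrefl _ h

theorem rookMat_flip_twoRooks (ha : a1 ≠ a2) :
    rookMat (flip (twoRooks a1 b1 a2 b2)) = Matrix.single b1 a1 1 + Matrix.single b2 a2 1 := by
  ext q p
  rw [Matrix.add_apply, Matrix.single_apply, Matrix.single_apply]
  by_cases h1 : b1 = q ∧ a1 = p
  · have h2 : ¬ (b2 = q ∧ a2 = p) := fun h2 => ha (h1.2.trans h2.2.symm)
    rw [if_pos h1, if_neg h2, rookMat_of (Or.inl ⟨h1.2.symm, h1.1.symm⟩), add_zero]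
  · rw [if_neg h1, zero_add]
    by_cases h2 : b2 = q ∧ a2 = p
    · rw [if_pos h2, rookMat_of (Or.inr ⟨h2.2.symm, h2.1.symm⟩)]
    · rw [if_neg h2, rookMat_of_not]
      rintro (h | h)
      · exact h1 ⟨h.2.symm, h.1.symm⟩
      · exact h2 ⟨h.2.symm, h.1.symm⟩

/-- The crossing placement is a degeneration of the nested one. -/
theorem Noncrossing.add_single_mem_dorb (h : Noncrossing I a1 b1 a2 b2) (ha : a1 < a2)
    (hb : b2 < b1) {t : ℂ} (ht : t ≠ 0) :
    rookMat (flip (twoRooks a1 b2 a2 b1)) + t • Matrix.single b1 a1 1 ∈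
      dorb I (rookMat (flip (twoRooks a1 b1 a2 b2))) := by
  obtain ⟨p1, q1, h1⟩ := h.pos₁
  obtain ⟨p2, q2, h2⟩ := h.pos₂
  have hpos12 : Pos I a1 b2 := ⟨p1, q2, ha.trans h2⟩
  have hpos21 : Pos I a2 b1 := ⟨p2, q1, h2.trans hb⟩
  have hx : rookMat (flip (twoRooks a1 b2 a2 b1)) + t • Matrix.single b1 a1 1 =
      Matrix.single b2 a1 1 + Matrix.single b1 a2 1 + Matrix.single b1 a1 t := by
    rw [rookMat_flip_twoRooks ha.ne, Matrix.smul_single, smul_eq_mul, mul_one]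
  rw [hx]
  set x := Matrix.single b2 a1 (1 : ℂ) + Matrix.single b1 a2 1 + Matrix.single b1 a1 t with hxd
  have hsx : SuppDual I x := suppDual_add (suppDual_add (suppDual_single hpos12 1)
    (suppDual_single hpos21 1)) (suppDual_single h.pos₁ t)
  -- The new entry at (b1, a1) is the pivot: it clears (b2, a1) and (b1, a2) and leaves the entry
  -- -t⁻¹ at (b2, a2).
  have hL : IsLevi I (1 + Matrix.single b2 b1 (-t⁻¹)) :=
    isLevi_one_add_single hb (iff_of_false q2 q1) _
  have hR : IsLevi I (1 + Matrix.single a1 a2 (-t⁻¹)) :=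
    isLevi_one_add_single ha (iff_of_true p1 p2) _
  have hrel := rel_compl.1 (hsx.blk.rel_mul_mul (isLevi_compl.2 hL) (isLevi_compl.2 hR))
  have hy : (1 + Matrix.single b2 b1 (-t⁻¹)) * x * (1 + Matrix.single a1 a2 (-t⁻¹)) =
      Matrix.single b1 a1 t + Matrix.single b2 a2 (-t⁻¹) := by
    have e1 : (1 + Matrix.single b2 b1 (-t⁻¹)) * x =
        Matrix.single b1 a2 1 + Matrix.single b1 a1 t + Matrix.single b2 a2 (-t⁻¹) := by
      rw [hxd, add_mul, one_mul, mul_add, mul_add, Matrix.single_mul_single_of_ne _ _ _ _ hb.ne',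
        Matrix.single_mul_single_same, Matrix.single_mul_single_same, mul_one, neg_mul,
        inv_mul_cancel₀ ht, zero_add]
      have : Matrix.single b2 a1 (-1 : ℂ) = - Matrix.single b2 a1 1 := by
        ext p q
        simp only [Matrix.single_apply, Matrix.neg_apply]
        split_ifs <;> simp
      rw [this]
      abel
    rw [e1, mul_add, mul_one, add_mul, add_mul, Matrix.single_mul_single_of_ne _ _ _ _ ha.ne',
      Matrix.single_mul_single_same, Matrix.single_mul_single_of_ne _ _ _ _ ha.ne', mul_neg,
      mul_inv_cancel₀ ht]
    have : Matrix.single b1 a2 (-1 : ℂ) = - Matrix.single b1 a2 1 := by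
      ext p q
      simp only [Matrix.single_apply, Matrix.neg_apply]
      split_ifs <;> simp
    rw [this]
    abel
  rw [hy] at hrel
  have hsy : SuppDual I (Matrix.single b1 a1 t + Matrix.single b2 a2 (-t⁻¹)) :=
    suppDual_add (suppDual_single h.pos₁ _) (suppDual_single h.pos₂ _)
  have hne : ∀ q p, (Matrix.single b1 a1 t + Matrix.single b2 a2 (-t⁻¹)) q p ≠ 0 ↔
      flip (twoRooks a1 b1 a2 b2) q p := by
    intro q p
    rw [Matrix.add_apply, Matrix.single_apply, Matrix.single_apply]
    constructor
    · intro hne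
      by_cases c1 : b1 = q ∧ a1 = p
      · exact Or.inl ⟨c1.2.symm, c1.1.symm⟩
      by_cases c2 : b2 = q ∧ a2 = p
      · exact Or.inr ⟨c2.2.symm, c2.1.symm⟩
      simp [c1, c2] at hne
    · rintro (⟨rfl, rfl⟩ | ⟨rfl, rfl⟩)
      · simp [ha.ne', ht]
      · simp [ha.ne, ht]
  have hrel2 := rel_compl.1 (hsy.blk.rel_rookMat (fun q p p' c c' =>
    h.isRook.isPlacement_flip.right_unique ((hne q p).1 c) ((hne q p').1 c')))
  have e : (fun q p => (Matrix.single b1 a1 t + Matrix.single b2 a2 (-t⁻¹)) q p ≠ 0) =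
      flip (twoRooks a1 b1 a2 b2) := by
    funext q p
    exact propext (hne q p)
  rw [e] at hrel2
  exact hsx.mem_dorb_of_rel (hrel.trans hrel2).symm

theorem continuous_reg (i j : ℕ) :
    Continuous (reg i j : Matrix (Fin n) (Fin n) ℂ → Matrix (Fin n) (Fin n) ℂ) := by
  refine continuous_matrix fun p q => ?_
  by_cases h : i ≤ (p : ℕ) ∧ (q : ℕ) < j
  · simp only [reg, Matrix.of_apply, if_pos h]
    exact continuous_id.matrix_elem p q
  · simp only [reg, Matrix.of_apply, if_neg h]
    exact continuous_const

theorem eq_zero_of_rank_eq_zero {x : Matrix (Fin n) (Fin n) ℂ} (h : x.rank = 0) : x = 0 := by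
  ext p q
  by_contra hne
  have := card_le_rank_of_det_ne_zero x (fun _ : Unit => p) (fun _ : Unit => q) (by simpa using hne)
  simp [h] at this

variable {k l : ℕ} {lam mu : YoungDiagram}

section OpenOrbit

variable {a1 b1 a2 b2 : Fin (k + l)}

theorem Noncrossing.mem_slice (h : Noncrossing (fixedIdx k l lam) a1 b1 a2 b2)
    (hmu : ∀ p, p ∈ fixedIdx k l mu ↔
      (p ∈ fixedIdx k l lam ∧ p ≠ a1 ∧ p ≠ a2) ∨ p = b1 ∨ p = b2) :
    rookMat (flip (twoRooks a1 b1 a2 b2)) ∈ slice k l lam mu := by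
  rw [h.isRook.mem_slice_iff]
  intro p
  obtain ⟨p1, q1, -⟩ := h.pos₁
  obtain ⟨p2, q2, -⟩ := h.pos₂
  have e1 : (∃ q, twoRooks a1 b1 a2 b2 p q) ↔ p = a1 ∨ p = a2 := by
    simp [twoRooks, exists_or]
  have e2 : (∃ q, twoRooks a1 b1 a2 b2 q p) ↔ p = b1 ∨ p = b2 := by
    simp [twoRooks, exists_or]
  rw [e1, e2, hmu]
  constructor
  · constructor
    · rintro (rfl | rfl)
      · refine ⟨p1, ?_⟩
        rintro (h | rfl | rfl)
        · exact h.2.1 rfl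
        · exact q1 p1
        · exact q2 p1
      · refine ⟨p2, ?_⟩
        rintro (h | rfl | rfl)
        · exact h.2.2 rfl
        · exact q1 p2
        · exact q2 p2
    · rintro ⟨hp, hn⟩
      by_contra hc
      push Not at hc
      exact hn (Or.inl ⟨hp, hc⟩)
  · constructor
    · rintro (rfl | rfl)
      · exact ⟨q1, Or.inr (Or.inl rfl)⟩
      · exact ⟨q2, Or.inr (Or.inr rfl)⟩
    · rintro ⟨hp, h | h⟩
      · exact absurd h.1 hp
      · exact h

theorem Noncrossing.of_mem_slice (h : Noncrossing (fixedIdx k l lam) a1 b1 a2 b2)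
    (hmu : ∀ p, p ∈ fixedIdx k l mu ↔
      (p ∈ fixedIdx k l lam ∧ p ≠ a1 ∧ p ≠ a2) ∨ p = b1 ∨ p = b2)
    {ξ : Matrix (Fin (k + l)) (Fin (k + l)) ℂ} (hξ : ξ ∈ slice k l lam mu) :
    ξ ∈ dorb (fixedIdx k l lam) (rookMat (flip (twoRooks a1 b1 a2 b2))) ∨
      (a1 < a2 ∧ b2 < b1 ∧
        ξ ∈ dorb (fixedIdx k l lam) (rookMat (flip (twoRooks a1 b2 a2 b1))) ∧
        IsRook (fixedIdx k l lam) (twoRooks a1 b2 a2 b1)) := by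
  have hs : SuppDual (fixedIdx k l lam) ξ := (GrassConormal.mem_slice_iff.1 hξ).1
  obtain ⟨u, hu, hmem⟩ := hs.exists_rook
  have h1 := hu.mem_slice_iff.1 ((hs.mem_slice_of_mem_dorb hmem).2 hξ)
  have h2 := h.isRook.mem_slice_iff.1 (h.mem_slice hmu)
  have e1 : ∀ p, (∃ q, twoRooks a1 b1 a2 b2 p q) ↔ p = a1 ∨ p = a2 := by
    simp [twoRooks, exists_or]
  have e2 : ∀ p, (∃ q, twoRooks a1 b1 a2 b2 q p) ↔ p = b1 ∨ p = b2 := by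
    simp [twoRooks, exists_or]
  have h3 := hs.mem_dorb_symm hmem
  rcases h.eq_or_eq hu (fun p => by rw [(h1 p).1, ← (h2 p).1, e1])
    (fun p => by rw [(h1 p).2, ← (h2 p).2, e2]) with rfl | ⟨c1, c2, rfl⟩
  · exact Or.inl h3
  · exact Or.inr ⟨c1, c2, h3, hu⟩

/-- The rank of the region with corner (b1, a1) separates the two orbits that the slice may contain:
the crossed placement has no rook there. -/
theorem Noncrossing.isOpenOrbit (h : Noncrossing (fixedIdx k l lam) a1 b1 a2 b2)
    (hmu : ∀ p, p ∈ fixedIdx k l mu ↔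
      (p ∈ fixedIdx k l lam ∧ p ≠ a1 ∧ p ≠ a2) ∨ p = b1 ∨ p = b2) :
    IsOpenOrbit k l lam mu
      (dorb (fixedIdx k l lam) (rookMat (flip (twoRooks a1 b1 a2 b2)))) := by
  refine ⟨isDualSpaceOrbit_iff.2 ⟨_, h.isRook.suppDual, rfl⟩,
    {y | reg b1 (a1 + 1) y ≠ 0}, isOpen_ne_fun (continuous_reg _ _) continuous_const, ?_⟩
  have hle : (a1 : ℕ) + 1 ≤ b1 := h.pos₁.2.2
  ext ξ
  constructor
  · intro hξ
    refine ⟨fun h0 => ?_, (h.isRook.suppDual.mem_slice_of_mem_dorb hξ).2 (h.mem_slice hmu)⟩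
    have h1 := h.isRook.suppDual.rank_reg hξ hle
    rw [h0, Matrix.rank_zero, h.isRook.isPlacement_flip.rank_reg, count, eq_comm,
      Set.ncard_eq_zero (Set.toFinite _)] at h1
    have : (b1, a1) ∈ arcs (flip (twoRooks a1 b1 a2 b2)) b1 (a1 + 1) :=
      ⟨Or.inl ⟨rfl, rfl⟩, le_rfl, Nat.lt_succ_self _⟩
    rw [h1] at this
    exact this
  · rintro ⟨hne, hξ⟩
    rcases h.of_mem_slice hmu hξ with h1 | ⟨ha, hb, h1, hu⟩
    · exact h1
    · exfalso
      have h2 := hu.suppDual.rank_reg h1 hle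
      have h3 : count (flip (twoRooks a1 b2 a2 b1)) b1 (a1 + 1) = 0 := by
        rw [count, Set.ncard_eq_zero (Set.toFinite _), Set.eq_empty_iff_forall_notMem]
        rintro ⟨q, p⟩ ⟨h4 | h4, h5, h6⟩
        · simp only at h4 h5 h6
          rw [h4.2] at h5
          exact absurd hb (not_lt.2 h5)
        · simp only at h4 h5 h6
          rw [h4.1] at h6
          exact absurd ha (not_lt.2 (Nat.lt_succ_iff.1 h6))
      rw [hu.isPlacement_flip.rank_reg, h3] at h2
      exact hne (eq_zero_of_rank_eq_zero h2)

/-- The crossed orbit is not open, being approached from within the slice by the nested one. -/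
theorem Noncrossing.eq_of_isOpenOrbit (h : Noncrossing (fixedIdx k l lam) a1 b1 a2 b2)
    (hmu : ∀ p, p ∈ fixedIdx k l mu ↔
      (p ∈ fixedIdx k l lam ∧ p ≠ a1 ∧ p ≠ a2) ∨ p = b1 ∨ p = b2)
    {Q : Set (Matrix (Fin (k + l)) (Fin (k + l)) ℂ)} (hQ : IsOpenOrbit k l lam mu Q) :
    Q = dorb (fixedIdx k l lam) (rookMat (flip (twoRooks a1 b1 a2 b2))) := by
  obtain ⟨hQ, U, hU, hQU⟩ := hQ
  obtain ⟨ξ, hs, rfl⟩ := isDualSpaceOrbit_iff.1 hQ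
  have hmem : ξ ∈ slice k l lam mu := by
    have := hs.mem_dorb_self
    rw [hQU] at this
    exact this.2
  rcases h.of_mem_slice hmu hmem with h1 | ⟨ha, hb, h1, hu⟩
  · exact h.isRook.suppDual.dorb_eq h1
  · have hC := hu.suppDual.mem_dorb_symm h1
    have hCU : rookMat (flip (twoRooks a1 b2 a2 b1)) ∈ U := by
      rw [hQU] at hC
      exact hC.1
    have hcont : Continuous fun t : ℂ =>
        rookMat (flip (twoRooks a1 b2 a2 b1)) + t • Matrix.single b1 a1 (1 : ℂ) := by fun_prop
    have hev : ∀ᶠ t : ℂ in 𝓝[≠] 0,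
        rookMat (flip (twoRooks a1 b2 a2 b1)) + t • Matrix.single b1 a1 (1 : ℂ) ∈ U := by
      refine nhdsWithin_le_nhds ((hU.preimage hcont).mem_nhds ?_)
      simpa using hCU
    obtain ⟨t, htU, ht⟩ := (hev.and self_mem_nhdsWithin).exists
    have h3 := h.add_single_mem_dorb ha hb ht
    have h4 : rookMat (flip (twoRooks a1 b2 a2 b1)) + t • Matrix.single b1 a1 (1 : ℂ) ∈
        dorb (fixedIdx k l lam) ξ := by
      rw [hQU]
      exact ⟨htU, (h.isRook.suppDual.mem_slice_of_mem_dorb h3).2 (h.mem_slice hmu)⟩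
    rw [← h.isRook.suppDual.dorb_eq h3, ← hs.dorb_eq h4]

/-- The orbit attached to `mu`. -/
theorem Noncrossing.isAttached_iff (h : Noncrossing (fixedIdx k l lam) a1 b1 a2 b2)
    (hmu : ∀ p, p ∈ fixedIdx k l mu ↔
      (p ∈ fixedIdx k l lam ∧ p ≠ a1 ∧ p ≠ a2) ∨ p = b1 ∨ p = b2)
    {w : Fin (k + l) → Fin (k + l) → Prop} (hw : IsRook (fixedIdx k l lam) w)
    (hS₁ : (a1, b1) ∈ Uncov (fixedIdx k l lam) w) (hS₂ : (a2, b2) ∈ Uncov (fixedIdx k l lam) w)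
    (hmin : ∀ w', IsRook (fixedIdx k l lam) w' → (a1, b1) ∈ Uncov (fixedIdx k l lam) w' →
      (a2, b2) ∈ Uncov (fixedIdx k l lam) w' → (∀ i j, count w i j ≤ count w' i j) → w' = w)
    {O : Set (Matrix (Fin (k + l)) (Fin (k + l)) ℂ)} :
    IsAttached k l lam mu O ↔ O = orb (fixedIdx k l lam) (rookMat w) := by
  have hset : {y : Fin (k + l) × Fin (k + l) | twoRooks a1 b1 a2 b2 y.1 y.2} ⊆
      Uncov (fixedIdx k l lam) w := by
    rintro ⟨p, q⟩ (⟨h1, h2⟩ | ⟨h1, h2⟩)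
    · simp only at h1 h2
      rwa [h1, h2]
    · simp only at h1 h2
      rwa [h1, h2]
  have hcone : dualCone k l lam
      (dorb (fixedIdx k l lam) (rookMat (flip (twoRooks a1 b1 a2 b2)))) =
      closure (orb (fixedIdx k l lam) (rookMat w)) := by
    rw [← h.isRook.dualCone_dorb hw hset (fun w' hw' hsub hc =>
      hmin w' hw' (hsub (Or.inl ⟨rfl, rfl⟩)) (hsub (Or.inr ⟨rfl, rfl⟩)) hc)]
    unfold dualCone
    simp only [mem_conormal]
  constructor
  · rintro ⟨hO, Q, hQ, hcl⟩
    obtain ⟨w', hw', rfl⟩ := isOrbit_iff_rook.1 hO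
    rw [h.eq_of_isOpenOrbit hmu hQ, hcone] at hcl
    rw [hw'.eq_of_closure_orb_eq hw hcl]
  · rintro rfl
    exact ⟨isOrbit_iff_rook.2 ⟨w, hw, rfl⟩, _, h.isOpenOrbit hmu, hcone.symm⟩

end OpenOrbit

end GrassConormal

namespace GrassConormal

open Matrix Filter Topology

/-! ### The rook placements of codimension one and two -/

variable {n : ℕ} {I : Set (Fin n)} {op : ℤ → Prop} {s par : ℤ → ℤ} {π : Equiv.Perm ℤ}
  {w w' : Fin n → Fin n → Prop}

theorem exists_fin {x : ℤ} (h0 : 0 ≤ x) (hn : x < n) : ∃ p : Fin n, (p : ℤ) = x :=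
  ⟨⟨x.toNat, by omega⟩, by simp only; omega⟩

theorem MatchingOn.pos_coe (M : MatchingOn I op s par) {p q : Fin n} (hp : op p) (hq : ¬ op q)
    (h : (p : ℤ) < q) : Pos I p q :=
  ⟨(M.mem_iff p).2 hp, fun h => hq ((M.mem_iff q).1 h), by omega⟩

theorem MatchingOn.uncovAt_rookOf (M : MatchingOn I op s par) (hπ : IsShift op s π) {i j : ℤ} :
    UncovAt I (rookOf I s π) i j ↔
      op i ∧ ¬ op j ∧ 0 ≤ i ∧ i < j ∧ j < n ∧ j < s (π i) ∧ π.symm (s j) < i := by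
  constructor
  · rintro ⟨p, q, rfl, rfl, h⟩
    obtain ⟨h1, h2⟩ := M.lt_of_mem_uncov hπ (fun _ _ h => h) h
    obtain ⟨hp, hq, hpq⟩ := h.1
    simp only at hp hq hpq
    rw [M.mem_iff] at hp hq
    exact ⟨hp, hq, by omega, by omega, by omega, h1, h2⟩
  · rintro ⟨h1, h2, h3, h4, h5, h6, h7⟩
    obtain ⟨p, rfl⟩ := exists_fin h3 (h4.trans h5)
    obtain ⟨q, rfl⟩ := exists_fin (h3.trans h4.le) h5
    exact uncovAt_coe.2 (M.mem_uncov_rookOf (M.pos_coe h1 h2 h4) h6 h7)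

theorem swap_mul_swap_symm_apply (a b c d x : ℤ) :
    (Equiv.swap a b * Equiv.swap c d).symm x = Equiv.swap c d (Equiv.swap a b x) := by
  change (Equiv.swap c d).symm ((Equiv.swap a b).symm x) = _
  rw [Equiv.symm_swap, Equiv.symm_swap]

theorem Matching.s_ne (M : Matching op s par) {a b : ℤ} (h : a ≠ b) : s a ≠ s b := fun he =>
  h (by rw [← M.invol a, he, M.invol])

theorem MatchingOn.uncovAt_single (M : MatchingOn I op s par) {a : ℤ} (ha : op a) (h0 : 0 ≤ a)
    (hn : s a < n) {i j : ℤ} :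
    UncovAt I (rookOf I s (Equiv.swap (par a) a)) i j ↔ i = a ∧ j = s a := by
  rw [M.uncovAt_rookOf (M.isShift_single ha)]
  constructor
  · rintro ⟨h1, h2, h3, h4, h5, h6, h7⟩
    rw [Equiv.symm_swap] at h7
    obtain ⟨h8, h9⟩ := M.cross_single ha h1 ((M.op_s j).2 h2) (by rwa [M.invol])
      (by rwa [M.invol]) h7
    exact ⟨h8, by rw [← h9, M.invol]⟩
  · rintro ⟨rfl, rfl⟩
    refine ⟨ha, fun h => (M.op_s _).1 h ha, h0, M.lt _ ha, hn, ?_, ?_⟩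
    · rw [Equiv.swap_apply_right]
      exact M.lt_par _ ha
    · rw [Equiv.symm_swap, M.invol, Equiv.swap_apply_right]
      exact M.par_lt _ ha

theorem MatchingOn.uncovAt_double (M : MatchingOn I op s par) {a b : ℤ} (ha : op a) (hb : op b)
    (hab : a < b) (hc : a ≠ par b) (ha0 : 0 ≤ a) (han : s a < n) (hb0 : 0 ≤ b) (hbn : s b < n)
    {i j : ℤ} :
    UncovAt I (rookOf I s (Equiv.swap (par b) b * Equiv.swap (par a) a)) i j ↔
      (i = a ∧ j = s a) ∨ (i = b ∧ j = s b) := by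
  rw [M.uncovAt_rookOf (M.isShift_double ha hb hab), swap_mul_swap_symm_apply,
    Equiv.Perm.mul_apply]
  constructor
  · rintro ⟨h1, h2, h3, h4, h5, h6, h7⟩
    rcases M.cross_double ha hb hab hc h1 ((M.op_s j).2 h2) (by rwa [M.invol])
      (by rwa [M.invol]) h7 with ⟨h8, h9⟩ | ⟨h8, h9⟩
    · exact Or.inl ⟨h8, by rw [← h9, M.invol]⟩
    · exact Or.inr ⟨h8, by rw [← h9, M.invol]⟩
  · have p1 := M.par_lt a ha
    have p2 := M.lt_par a ha
    have p3 := M.lt a ha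
    have p4 := M.par_lt b hb
    have p5 := M.lt_par b hb
    have p6 := M.lt b hb
    have p7 := M.between b a hb ha
    rintro (⟨rfl, rfl⟩ | ⟨rfl, rfl⟩)
    · refine ⟨ha, fun h => (M.op_s _).1 h ha, ha0, p3, han, ?_, ?_⟩
      · rw [Equiv.swap_apply_right, Equiv.swap_apply_def]
        split_ifs with h1 h2
        · have := M.between b i hb ha (by omega) hab
          omega
        · omega
        · exact p2
      · rw [M.invol, Equiv.swap_apply_of_ne_of_ne hc hab.ne, Equiv.swap_apply_right]
        exact p1
    · refine ⟨hb, fun h => (M.op_s _).1 h hb, hb0, p6, hbn, ?_, ?_⟩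
      · rw [Equiv.swap_apply_of_ne_of_ne (a := par a) (b := a) (by omega) (by omega),
          Equiv.swap_apply_right]
        exact p5
      · rw [M.invol, Equiv.swap_apply_right, Equiv.swap_apply_def]
        split_ifs with h1 h2
        · exact hab
        · exact absurd h2.symm hc
        · exact p4

theorem MatchingOn.uncovAt_lower (M : MatchingOn I op s par) {b : ℤ} (hb : op b)
    (h0 : 0 ≤ par b) (hn : s b < n) {i j : ℤ} :
    UncovAt I (rookOf I s (Equiv.swap (par b) b * Equiv.swap (par (par b)) (par b))) i j ↔
      (i = b ∧ j = s b) ∨ (i = par b ∧ j = s b) := by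
  have ha := M.op_par b hb
  have p4 := M.par_lt b hb
  rw [M.uncovAt_rookOf (M.isShift_double ha hb p4), swap_mul_swap_symm_apply,
    Equiv.Perm.mul_apply]
  constructor
  · rintro ⟨h1, h2, h3, h4, h5, h6, h7⟩
    rcases M.cross_lower rfl hb h1 ((M.op_s j).2 h2) (by rwa [M.invol])
      (by rwa [M.invol]) h7 with ⟨h8, h9⟩ | ⟨h8, h9⟩
    · exact Or.inl ⟨h8, by rw [← h9, M.invol]⟩
    · exact Or.inr ⟨h8, by rw [← h9, M.invol]⟩
  · have p1 := M.par_lt _ ha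
    have p2 := M.lt_par _ ha
    have p3 := M.lt _ ha
    have p5 := M.lt_par b hb
    have p6 := M.lt b hb
    rintro (⟨rfl, rfl⟩ | ⟨rfl, rfl⟩)
    · refine ⟨hb, fun h => (M.op_s _).1 h hb, by omega, p6, hn, ?_, ?_⟩
      · rw [Equiv.swap_apply_of_ne_of_ne (a := par (par i)) (by omega) (by omega),
          Equiv.swap_apply_right]
        exact p5
      · rw [M.invol, Equiv.swap_apply_right, Equiv.swap_apply_right]
        omega
    · refine ⟨ha, fun h => (M.op_s _).1 h hb, h0, by omega, hn, ?_, ?_⟩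
      · rw [Equiv.swap_apply_right, Equiv.swap_apply_of_ne_of_ne (by omega) (by omega)]
        omega
      · rw [M.invol, Equiv.swap_apply_right, Equiv.swap_apply_right]
        omega

theorem MatchingOn.uncovAt_upper (M : MatchingOn I op s par) {b : ℤ} (hb : op b)
    (h0 : 0 ≤ b) (hn : s (par b) < n) {i j : ℤ} :
    UncovAt I (rookOf I s (Equiv.swap (par (par b)) (par b) * Equiv.swap (par b) b)) i j ↔
      (i = b ∧ j = s b) ∨ (i = b ∧ j = s (par b)) := by
  have ha := M.op_par b hb
  have p4 := M.par_lt b hb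
  rw [M.uncovAt_rookOf (M.isShift_upper hb), swap_mul_swap_symm_apply, Equiv.Perm.mul_apply]
  constructor
  · rintro ⟨h1, h2, h3, h4, h5, h6, h7⟩
    rcases M.cross_upper rfl hb h1 ((M.op_s j).2 h2) (by rwa [M.invol])
      (by rwa [M.invol]) h7 with ⟨h8, h9⟩ | ⟨h8, h9⟩
    · exact Or.inl ⟨h8, by rw [← h9, M.invol]⟩
    · exact Or.inr ⟨h8, by rw [← h9, M.invol]⟩
  · have p1 := M.par_lt _ ha
    have p2 := M.lt_par _ ha
    have p3 := M.lt _ ha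
    have p5 := M.lt_par b hb
    have p6 := M.lt b hb
    rintro (⟨rfl, rfl⟩ | ⟨rfl, rfl⟩)
    · refine ⟨hb, fun h => (M.op_s _).1 h hb, h0, p6, by omega, ?_, ?_⟩
      · rw [Equiv.swap_apply_right, Equiv.swap_apply_right]
        omega
      · rw [M.invol, Equiv.swap_apply_of_ne_of_ne (a := par (par i)) (by omega) (by omega),
          Equiv.swap_apply_right]
        exact p4
    · refine ⟨hb, fun h => (M.op_s _).1 h ha, h0, by omega, hn, ?_, ?_⟩
      · rw [Equiv.swap_apply_right, Equiv.swap_apply_right]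
        omega
      · rw [M.invol, Equiv.swap_apply_right, Equiv.swap_apply_of_ne_of_ne (by omega) (by omega)]
        omega

/-- The rook placement `w` restricts to a perfect matching of the interval of every pair in the
range except possibly those of `a` and of `b`. -/
def FillsExcept (I : Set (Fin n)) (op : ℤ → Prop) (s : ℤ → ℤ) (a b : ℤ)
    (w : Fin n → Fin n → Prop) : Prop :=
  ∀ e f : Fin n, op e → s e = f → (e : ℤ) ≠ a → (e : ℤ) ≠ b →
    (∀ p ∈ opens I e f, ∃ q ≤ f, w p q) ∧ ∀ q ∈ closes I e f, ∃ p, e ≤ p ∧ w p q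

theorem MatchingOn.fillsExcept (M : MatchingOn I op s par) (hπ : IsShift op s π) {a b : ℤ}
    (h : ∀ x, op x → x ≠ a → x ≠ b → PreservesInterval op s x π) :
    FillsExcept I op s a b (rookOf I s π) := by
  intro e f he hf ha hb
  have hI := (M.mem_iff e).2 he
  exact ⟨M.fill_opens hπ hI hf (h _ he ha hb), M.fill_closes hπ hI hf (h _ he ha hb)⟩

/-- A filled interval has the largest possible count, so placements with larger counts fill it too.
-/
theorem FillsExcept.exists_of_count_le {a b : ℤ} (h : FillsExcept I op s a b w)
    (hw' : IsRook I w') (hc : ∀ i j, count w i j ≤ count w' i j) {e f : Fin n} (he : op e)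
    (hf : s e = f) (ha : (e : ℤ) ≠ a) (hb : (e : ℤ) ≠ b) (hpos : Pos I e f) :
    (∃ q ≤ f, w' e q) ∧ ∃ p, e ≤ p ∧ w' p f := by
  obtain ⟨h1, h2⟩ := h e f he hf ha hb
  exact ⟨exists_of_opens_le hw' ((opens_le_count h1).trans (hc _ _))
      ⟨hpos.1, le_rfl, hpos.2.2.le⟩,
    exists_of_closes_le hw' ((closes_le_count h2).trans (hc _ _))
      ⟨hpos.2.1, hpos.2.2.le, le_rfl⟩⟩

/-- If the inner pairs are filled, then a position above an uncovered pair being uncovered forces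
the pair to be uncovered. -/
theorem MatchingOn.uncov_of_above (M : MatchingOn I op s par) {a b : ℤ} {pa pb qb : Fin n}
    (h : FillsExcept I op s a b w) (hw' : IsRook I w')
    (hc : ∀ i j, count w i j ≤ count w' i j) (hb : (pb : ℤ) = b) (hqb : (qb : ℤ) = s b)
    (hopb : op b) (hlt : a < b) (ha : (pa : ℤ) = a) (hu : (pa, qb) ∈ Uncov I w') :
    (pb, qb) ∈ Uncov I w' := by
  have hab := M.lt b hopb
  have hopq : ¬ op (qb : ℤ) := by rw [hqb]; exact fun h => (M.op_s _).1 h hopb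
  have hpos : Pos I pb qb := M.pos_coe (by rwa [hb]) hopq (by omega)
  refine ⟨hpos, ?_, ?_⟩
  · intro q hq hwq
    simp only at hq hwq
    obtain ⟨-, hq2, hq3⟩ := hw'.pos hwq
    have hne : q ≠ qb := by
      rintro rfl
      exact hu.2.2 pb (by simp only; omega) hwq
    have hopq' : ¬ op (q : ℤ) := fun h => hq2 ((M.mem_iff q).2 h)
    have hope := (M.op_s _).2 hopq'
    have hlt' := M.gt _ hopq'
    have hbe : b < s q := by
      by_contra hle
      have h1 := M.nested (s q) b hope hopb
      rw [M.invol] at h1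
      have : s q ≠ b := by
        intro h
        apply hne
        have := congrArg s h
        rw [M.invol, ← hqb] at this
        exact Fin.ext (by omega)
      omega
    obtain ⟨e, he⟩ := exists_fin (n := n) (x := s q) (by omega) (by omega)
    obtain ⟨-, p, hp, hwp⟩ := h.exists_of_count_le hw' hc (e := e) (f := q) (by rwa [he])
      (by rw [he, M.invol]) (by omega) (by omega)
      (M.pos_coe (by rwa [he]) hopq' (by omega))
    have := hw'.left_unique hwp hwq
    subst this
    omega
  · intro p hp hwp
    simp only at hp hwp
    exact hu.2.2 p (by simp only; omega) hwp

/-- A rook of `w'` covering (pb, qb) from below would lie in a row whose own pair is inside that of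
`b`. That inner interval is filled, so the rook of the row lies in an earlier column. -/
theorem MatchingOn.uncov_of_right (M : MatchingOn I op s par) {a b : ℤ} {pb qa qb : Fin n}
    (h : FillsExcept I op s a b w) (hw' : IsRook I w')
    (hc : ∀ i j, count w i j ≤ count w' i j) (hb : (pb : ℤ) = b) (hqb : (qb : ℤ) = s b)
    (hopb : op b) (hab : a < b) (hlt : qb ≤ qa) (hu : (pb, qa) ∈ Uncov I w') :
    (pb, qb) ∈ Uncov I w' := by
  have hbs := M.lt b hopb
  have hopq : ¬ op (qb : ℤ) := by rw [hqb]; exact fun h => (M.op_s _).1 h hopb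
  have hpos : Pos I pb qb := M.pos_coe (by rwa [hb]) hopq (by omega)
  refine ⟨hpos, ?_, ?_⟩
  · intro q hq hwq
    simp only at hq hwq
    exact hu.2.1 q (hq.trans hlt) hwq
  · intro p hp hwp
    simp only at hp hwp
    obtain ⟨hp1, -, hp3⟩ := hw'.pos hwp
    have hne : p ≠ pb := by
      rintro rfl
      exact hu.2.1 qb hlt hwp
    have hopp := (M.mem_iff p).1 hp1
    have hbp : b < p := by
      have : (p : ℕ) ≠ pb := fun h => hne (Fin.ext h)
      omega
    have hn := M.nested b p hopb hopp hbp
    have hlt' := M.lt _ hopp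
    obtain ⟨f, hf⟩ := exists_fin (n := n) (x := s p) (by omega) (by omega)
    obtain ⟨⟨q, hq, hwq⟩, -⟩ := h.exists_of_count_le hw' hc (e := p) (f := f) hopp
      hf.symm (by omega) (by omega)
      (M.pos_coe hopp (by rw [hf]; exact fun h => (M.op_s _).1 h hopp) (by omega))
    have := hw'.right_unique hwq hwp
    subst this
    omega

/-! ### Degenerations by one elementary operation -/

/-- A degeneration of the orbits attached to a parent pair, by a column operation. -/
theorem IsRook.mem_of_col {C : Set (Matrix (Fin n) (Fin n) ℂ)} (hC : IsClosed C)
    (hrel : ∀ x ∈ C, ∀ y, Rel I x y → y ∈ C) {a b c d : Fin n} (hw : IsRook I w)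
    (hS : clearAt I {(a, d)} ⊆ C) (hab : a < b) (hcd : c < d) (hpos : Pos I b c)
    (hrow : ∀ q ≤ d, ¬ w a q) (hbd : w b d) (hcol : ∀ p, a ≤ p → ¬ w p c) : rookMat w ∈ C := by
  have hcont : Continuous fun t : ℂ => rookMat w + t • Matrix.single b c (1 : ℂ) := by fun_prop
  have hmem : ∀ t : ℂ, t ≠ 0 → rookMat w + t • Matrix.single b c (1 : ℂ) ∈ C := by
    intro t ht
    set y := rookMat w + t • Matrix.single b c (1 : ℂ) with hy
    have hyp : ∀ p q, ¬ (b = p ∧ c = q) → y p q = rookMat w p q := by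
      intro p q hpq
      rw [hy, Matrix.add_apply, Matrix.smul_apply, Matrix.single_apply_of_ne _ _ _ _ _ hpq,
        smul_zero, add_zero]
    have hybc : y b c = t := by
      rw [hy, Matrix.add_apply, Matrix.smul_apply, Matrix.single_apply_same,
        rookMat_of_not (hcol b hab.le), zero_add, smul_eq_mul, mul_one]
    have hys : SuppOn I y := by
      intro p q hne
      by_cases hpq : b = p ∧ c = q
      · rwa [← hpq.1, ← hpq.2]
      · rw [hyp p q hpq] at hne
        exact hw.suppOn p q hne
    -- The auxiliary entry `t` at (b, c) serves to clear the rook at (b, d), the only obstruction to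
    -- (a, d) being uncovered. Letting `t` tend to zero recovers the rook matrix.
    have hR : IsLevi I (1 + Matrix.single c d (-t⁻¹)) :=
      isLevi_one_add_single hcd (iff_of_false hpos.2.1 (hw.pos hbd).2.1) _
    have hyz := hys.blk.rel_mul_mul isLevi_one hR
    rw [one_mul] at hyz
    have hz : ∀ p q, (y * (1 + Matrix.single c d (-t⁻¹))) p q =
        y p q + if q = d then y p c * (-t⁻¹) else 0 := by
      intro p q
      rw [mul_add, mul_one, Matrix.add_apply]
      congr 1
      split_ifs with h
      · rw [h, Matrix.mul_single_apply_same]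
      · rw [Matrix.mul_single_apply_of_ne _ _ _ _ _ h]
    refine hrel _ (hS ⟨hys.rel hyz, ?_⟩) _ hyz.symm
    rintro _ rfl
    constructor
    · intro q hq
      have h1 : y a q = 0 := by
        rw [hyp a q fun h => hab.ne' h.1, rookMat_of_not (hrow q hq)]
      have h2 : y a c = 0 := by
        rw [hyp a c fun h => hab.ne' h.1, rookMat_of_not (hrow c hcd.le)]
      simp [hz, h1, h2]
    · intro p hp
      simp only at hp
      rw [hz, if_pos rfl, hyp p d fun h => hcd.ne h.2]
      by_cases hpb : p = b
      · rw [hpb, hybc, rookMat_of hbd, mul_neg, mul_inv_cancel₀ ht, add_neg_cancel]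
      · rw [hyp p c fun h => hpb h.1.symm, rookMat_of_not (hcol p hp),
          rookMat_of_not fun h => hpb (hw.left_unique h hbd), zero_mul, add_zero]
  have h0 : rookMat w + (0 : ℂ) • Matrix.single b c (1 : ℂ) ∈ closure C := by
    have hd : (0 : ℂ) ∈ closure {0}ᶜ := (dense_compl_singleton 0) 0
    exact map_mem_closure (f := fun t : ℂ => rookMat w + t • Matrix.single b c (1 : ℂ)) hcont hd
      (fun t ht => hmem t ht)
  rwa [zero_smul, add_zero, hC.closure_eq] at h0

/-- A degeneration of the orbits attached to a parent pair, by a row operation. -/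
theorem IsRook.mem_of_row {C : Set (Matrix (Fin n) (Fin n) ℂ)} (hC : IsClosed C)
    (hrel : ∀ x ∈ C, ∀ y, Rel I x y → y ∈ C) {a b c d : Fin n} (hw : IsRook I w)
    (hS : clearAt I {(a, d)} ⊆ C) (hab : a < b) (hcd : c < d) (hpos : Pos I b c)
    (hcol : ∀ p, a ≤ p → ¬ w p d) (hac : w a c) (hrow : ∀ q ≤ d, ¬ w b q) : rookMat w ∈ C := by
  have hcont : Continuous fun t : ℂ => rookMat w + t • Matrix.single b c (1 : ℂ) := by fun_prop
  have hmem : ∀ t : ℂ, t ≠ 0 → rookMat w + t • Matrix.single b c (1 : ℂ) ∈ C := by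
    intro t ht
    set y := rookMat w + t • Matrix.single b c (1 : ℂ) with hy
    have hyp : ∀ p q, ¬ (b = p ∧ c = q) → y p q = rookMat w p q := by
      intro p q hpq
      rw [hy, Matrix.add_apply, Matrix.smul_apply, Matrix.single_apply_of_ne _ _ _ _ _ hpq,
        smul_zero, add_zero]
    have hybc : y b c = t := by
      rw [hy, Matrix.add_apply, Matrix.smul_apply, Matrix.single_apply_same,
        rookMat_of_not (hrow c hcd.le), zero_add, smul_eq_mul, mul_one]
    have hys : SuppOn I y := by
      intro p q hne
      by_cases hpq : b = p ∧ c = q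
      · rwa [← hpq.1, ← hpq.2]
      · rw [hyp p q hpq] at hne
        exact hw.suppOn p q hne
    -- Row `b` with its auxiliary entry in column `c` clears the rook at (a, c).
    have hL : IsLevi I (1 + Matrix.single a b (-t⁻¹)) :=
      isLevi_one_add_single hab (iff_of_true (hw.pos hac).1 hpos.1) _
    have hyz := hys.blk.rel_mul_mul hL isLevi_one
    rw [mul_one] at hyz
    have hz : ∀ p q, ((1 + Matrix.single a b (-t⁻¹)) * y) p q =
        y p q + if p = a then (-t⁻¹) * y b q else 0 := by
      intro p q
      rw [add_mul, one_mul, Matrix.add_apply]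
      congr 1
      split_ifs with h
      · rw [h, Matrix.single_mul_apply_same]
      · rw [Matrix.single_mul_apply_of_ne _ _ _ _ _ h]
    refine hrel _ (hS ⟨hys.rel hyz, ?_⟩) _ hyz.symm
    rintro _ rfl
    constructor
    · intro q hq
      simp only at hq
      rw [hz, if_pos rfl, hyp a q fun h => hab.ne' h.1]
      by_cases hqc : q = c
      · rw [hqc, hybc, rookMat_of hac, neg_mul, inv_mul_cancel₀ ht, add_neg_cancel]
      · rw [hyp b q fun h => hqc h.2.symm, rookMat_of_not (hrow q hq),
          rookMat_of_not fun h => hqc (hw.right_unique h hac), mul_zero, add_zero]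
    · intro p hp
      have h1 : y p d = 0 := by
        rw [hyp p d fun h => hcd.ne h.2, rookMat_of_not (hcol p hp)]
      have h2 : y b d = 0 := by
        rw [hyp b d fun h => hcd.ne h.2, rookMat_of_not (hcol b hab.le)]
      simp [hz, h1, h2]
  have h0 : rookMat w + (0 : ℂ) • Matrix.single b c (1 : ℂ) ∈ closure C := by
    have hd : (0 : ℂ) ∈ closure {0}ᶜ := (dense_compl_singleton 0) 0
    exact map_mem_closure (f := fun t : ℂ => rookMat w + t • Matrix.single b c (1 : ℂ)) hcont hd
      (fun t ht => hmem t ht)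
  rwa [zero_smul, add_zero, hC.closure_eq] at h0

end GrassConormal

namespace GrassConormal

open Matrix Filter Topology

/-! ### The matching of a partition -/

variable {k l : ℕ} {lam lam' mu : YoungDiagram} {op : ℤ → Prop} {s par : ℤ → ℤ}

/-- The matching formed by the `λ`-pairs, shifted by `k`. -/
structure PairMatching (k l : ℕ) (lam : YoungDiagram) (op : ℤ → Prop) (s par : ℤ → ℤ) : Prop
    extends MatchingOn (fixedIdx k l lam) op s par where
  mem_Omega : lam ∈ Omega k l
  op_iff : ∀ x, op x ↔ phi lam (x - k) = -1
  isPair_iff : ∀ x y, IsPair lam (x - k) (y - k) ↔ op x ∧ s x = y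
  isChild_iff : ∀ x y, op x → op y →
    (IsChild lam (x - k) (s x - k) (y - k) (s y - k) ↔ par x = y)

theorem exists_pairMatching (hlam : lam ∈ Omega k l) :
    ∃ op s par, PairMatching k l lam op s par := by
  have hex : ∀ x : ℤ, ∃ y : ℤ, (phi lam (x - k) = -1 → IsPair lam (x - k) (y - k)) ∧
      (phi lam (x - k) ≠ -1 → IsPair lam (y - k) (x - k)) := by
    intro x
    by_cases hx : phi lam (x - k) = -1
    · obtain ⟨b, hb⟩ := IsPair.exists_right lam hlam _ hx
      exact ⟨b + k, fun _ => by rwa [add_sub_cancel_right], fun h => absurd hx h⟩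
    · obtain ⟨b, hb⟩ := IsPair.exists_left lam hlam _ (phi_eq_one_iff.2 hx)
      exact ⟨b + k, fun h => absurd h hx, fun _ => by rwa [add_sub_cancel_right]⟩
  choose s hs1 hs2 using hex
  have hop_s : ∀ x, phi lam (s x - k) = -1 ↔ ¬ phi lam (x - k) = -1 := by
    intro x
    by_cases hx : phi lam (x - k) = -1
    · have := (hs1 x hx).2.1
      rw [this]
      simp [hx]
    · have := (hs2 x hx).1
      simp [hx, this]
  have hpair : ∀ x y, IsPair lam (x - k) (y - k) ↔ phi lam (x - k) = -1 ∧ s x = y := by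
    intro x y
    constructor
    · intro h
      have := h.right_unique (hs1 x h.1)
      exact ⟨h.1, by omega⟩
    · rintro ⟨h, rfl⟩
      exact hs1 x h
  have hpar : ∀ x : ℤ, ∃ y : ℤ, phi lam (x - k) = -1 →
      IsChild lam (x - k) (s x - k) (y - k) (s y - k) := by
    intro x
    by_cases hx : phi lam (x - k) = -1
    · obtain ⟨a, b, h⟩ := exists_parent hlam (hs1 x hx)
      have h' : IsPair lam (a + k - k) (b + k - k) := by
        simpa only [add_sub_cancel_right] using h.2.1
      refine ⟨a + k, fun _ => ?_⟩
      rw [((hpair _ _).1 h').2, add_sub_cancel_right, add_sub_cancel_right]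
      exact h
    -- The parent is meaningful at left ends only; elsewhere its value is arbitrary.
    · exact ⟨0, fun h => absurd h hx⟩
  choose par hpar using hpar
  refine ⟨fun x => phi lam (x - k) = -1, s, par, ?_⟩
  exact
    { invol := by
        intro a
        by_cases ha : phi lam (a - k) = -1
        · have := (hs1 a ha).left_unique (hs2 (s a) fun h => (hop_s a).1 h ha)
          omega
        · have := (hs2 a ha).right_unique (hs1 (s a) ((hop_s a).2 ha))
          omega
      lt := fun a ha => by
        have := (hs1 a ha).2.2.1.1
        omega
      gt := fun a ha => by
        have := (hs2 a ha).2.2.1.1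
        omega
      op_s := hop_s
      nested := fun a c ha hc hac => by
        have := (hs1 a ha).disjoint_or_nested (hs1 c hc) (by omega)
        omega
      op_par := fun a ha => (hpar a ha).2.1.1
      par_lt := fun a ha => by
        have := (hpar a ha).2.2.1
        omega
      lt_par := fun a ha => by
        have := (hpar a ha).2.2.2.1
        omega
      between := fun a e ha he h1 h2 => by
        have := (hpar a ha).no_between (hs1 e he) (by omega) (by omega)
        omega
      mem_iff := fun p => Iff.rfl
      mem_Omega := hlam
      op_iff := fun x => Iff.rfl
      isPair_iff := hpair
      isChild_iff := by
        intro x y hx hy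
        constructor
        · intro h
          have := (h.unique (hpar x hx)).1
          omega
        · rintro rfl
          exact hpar x hx }

theorem PairMatching.isPair (M : PairMatching k l lam op s par) {a : ℤ} (ha : op a) :
    IsPair lam (a - k) (s a - k) := (M.isPair_iff _ _).2 ⟨ha, rfl⟩

theorem PairMatching.phi_s (M : PairMatching k l lam op s par) {a : ℤ} (ha : op a) :
    phi lam (s a - k) = 1 := (M.isPair ha).2.1

theorem mem_Omega_of_phi_ne (hlam : lam ∈ Omega k l)
    (h : ∀ c : ℤ, phi mu c ≠ phi lam c → -(k : ℤ) ≤ c ∧ c < l) : mu ∈ Omega k l := by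
  obtain ⟨h1, h2⟩ := mem_Omega_iff.1 hlam
  refine mem_Omega_iff.2 ⟨fun c hc => ?_, fun c hc => ?_⟩
  · by_contra hne
    have := h c (by rwa [h1 c hc])
    omega
  · by_contra hne
    have := h c (by rwa [h2 c hc])
    omega

/-- With `lt_of_phi_eq_neg_one` this converts membership of a flipped partition in `Omega` into
range conditions on the ends of the flip. -/
theorem nonneg_of_phi_eq_one (hmu : mu ∈ Omega k l) {x : ℤ} (h : phi mu (x - k) = 1) : 0 ≤ x := by
  by_contra hx
  have := (mem_Omega_iff.1 hmu).1 (x - k) (by omega)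
  omega

theorem lt_of_phi_eq_neg_one (hmu : mu ∈ Omega k l) {x : ℤ} (h : phi mu (x - k) = -1) :
    x < (k + l : ℕ) := by
  by_contra hx
  have := (mem_Omega_iff.1 hmu).2 (x - k) (by push_cast at hx; omega)
  omega

theorem IsFlip.mem_Omega (hlam : lam ∈ Omega k l) {a b : ℤ} (h : IsFlip lam mu (a - k) (b - k))
    (hab : a < b) (h0 : 0 ≤ a) (hn : b < (k + l : ℕ)) : mu ∈ Omega k l := by
  refine mem_Omega_of_phi_ne hlam fun c hc => ?_
  push_cast at hn
  by_cases h1 : c = a - k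
  · omega
  by_cases h2 : c = b - k
  · omega
  exact absurd (h.2.2 c h1 h2) hc

theorem IsFlip.mem_fixedIdx {a b : ℤ} (h : IsFlip lam mu (a - k) (b - k)) (p : Fin (k + l)) :
    p ∈ fixedIdx k l mu ↔ (p ∈ fixedIdx k l lam ∧ (p : ℤ) ≠ a) ∨ (p : ℤ) = b := by
  change phi mu ((p : ℤ) - k) = -1 ↔ (phi lam ((p : ℤ) - k) = -1 ∧ _) ∨ _
  by_cases h1 : (p : ℤ) = a
  · have hne : a ≠ b := by
      rintro rfl
      have := h.1.symm.trans h.2.1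
      omega
    rw [h1, h.1]
    simp [hne]
  by_cases h2 : (p : ℤ) = b
  · rw [h2, h.2.1]
    simp
  rw [h.2.2 _ (by omega) (by omega)]
  simp [h1, h2]

/-- The sign function of `λ'` is obtained by exchanging the signs at the ends of both `(a, b)` and
`(c, d)`. -/
def IsDoubleFlip (lam lam' : YoungDiagram) (a b c d : ℤ) : Prop :=
  phi lam' a = 1 ∧ phi lam' b = -1 ∧ phi lam' c = 1 ∧ phi lam' d = -1 ∧
    ∀ x, x ≠ a → x ≠ b → x ≠ c → x ≠ d → phi lam' x = phi lam x

theorem IsDoubleFlip.unique {lam'' : YoungDiagram} {a b c d : ℤ}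
    (h : IsDoubleFlip lam lam' a b c d) (h' : IsDoubleFlip lam lam'' a b c d) : lam' = lam'' := by
  apply phi_injective
  funext x
  by_cases h1 : x = a
  · rw [h1, h.1, h'.1]
  by_cases h2 : x = b
  · rw [h2, h.2.1, h'.2.1]
  by_cases h3 : x = c
  · rw [h3, h.2.2.1, h'.2.2.1]
  by_cases h4 : x = d
  · rw [h4, h.2.2.2.1, h'.2.2.2.1]
  rw [h.2.2.2.2 x h1 h2 h3 h4, h'.2.2.2.2 x h1 h2 h3 h4]

theorem IsDoubleFlip.mem_fixedIdx {a b c d : ℤ}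
    (h : IsDoubleFlip lam lam' (a - k) (b - k) (c - k) (d - k)) (p : Fin (k + l)) :
    p ∈ fixedIdx k l lam' ↔
      (p ∈ fixedIdx k l lam ∧ (p : ℤ) ≠ a ∧ (p : ℤ) ≠ c) ∨ (p : ℤ) = b ∨ (p : ℤ) = d := by
  change phi lam' ((p : ℤ) - k) = -1 ↔ (phi lam ((p : ℤ) - k) = -1 ∧ _) ∨ _
  obtain ⟨h1, h2, h3, h4, h5⟩ := h
  by_cases g2 : (p : ℤ) = b
  · rw [g2, h2]
    simp
  by_cases g4 : (p : ℤ) = d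
  · rw [g4, h4]
    simp
  by_cases g1 : (p : ℤ) = a
  · rw [g1, h1]
    rw [g1] at g2 g4
    simp [g2, g4]
  by_cases g3 : (p : ℤ) = c
  · rw [g3, h3]
    rw [g3] at g2 g4
    simp [g2, g4]
  rw [h5 _ (by omega) (by omega) (by omega) (by omega)]
  simp [g1, g2, g3, g4]

theorem PairMatching.exists_isDoubleFlip (M : PairMatching k l lam op s par) {a b : ℤ}
    (ha : op a) (hb : op b) (hab : a ≠ b) :
    ∃ lam', IsDoubleFlip lam lam' (a - k) (s a - k) (b - k) (s b - k) := by
  have h1 := M.lt a ha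
  have h2 := M.lt b hb
  have h3 : s a ≠ b := fun h => (M.op_s a).1 (h ▸ hb) ha
  have h4 : s b ≠ a := fun h => (M.op_s b).1 (h ▸ ha) hb
  have h5 := M.s_ne hab
  obtain ⟨nu, hnu⟩ := exists_isFlip lam (a - k) (s a - k) (by omega) ((M.op_iff a).1 ha)
    (M.phi_s ha)
  obtain ⟨lam', g⟩ := exists_isFlip nu (b - k) (s b - k) (by omega)
    (by rw [hnu.2.2 _ (by omega) (by omega)]; exact (M.op_iff b).1 hb)
    (by rw [hnu.2.2 _ (by omega) (by omega)]; exact M.phi_s hb)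
  refine ⟨lam', ?_, ?_, g.1, g.2.1, fun x g1 g2 g3 g4 => ?_⟩
  · rw [g.2.2 _ (by omega) (by omega), hnu.1]
  · rw [g.2.2 _ (by omega) (by omega), hnu.2.1]
  · rw [g.2.2 _ g3 g4, hnu.2.2 _ g1 g2]

theorem IsDoubleFlip.mem_Omega (hlam : lam ∈ Omega k l) {a b c d : ℤ}
    (h : IsDoubleFlip lam lam' (a - k) (b - k) (c - k) (d - k)) (hab : a < b) (hcd : c < d)
    (ha : 0 ≤ a) (hb : b < (k + l : ℕ)) (hc : 0 ≤ c) (hd : d < (k + l : ℕ)) :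
    lam' ∈ Omega k l := by
  refine mem_Omega_of_phi_ne hlam fun x hx => ?_
  push_cast at hb hd
  by_contra hcon
  exact hx (h.2.2.2.2 x (by omega) (by omega) (by omega) (by omega))

/-! ### Orbits of codimension one -/

section UncovAt

variable {n : ℕ} {I : Set (Fin n)} {w w' : Fin n → Fin n → Prop}

theorem uncov_subset_of_uncovAt (h : ∀ i j, UncovAt I w i j → UncovAt I w' i j) :
    Uncov I w ⊆ Uncov I w' := fun _ hx => uncovAt_coe.1 (h _ _ (uncovAt_coe.2 hx))

theorem ncard_uncov_eq_two {i j i' j' : ℤ}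
    (h : ∀ x y, UncovAt I w x y ↔ (x = i ∧ y = j) ∨ (x = i' ∧ y = j'))
    (hne : ¬ (i = i' ∧ j = j')) : (Uncov I w).ncard = 2 := by
  obtain ⟨p, q, rfl, rfl, h1⟩ := (h i j).2 (Or.inl ⟨rfl, rfl⟩)
  obtain ⟨p', q', rfl, rfl, h2⟩ := (h i' j').2 (Or.inr ⟨rfl, rfl⟩)
  rw [Set.ncard_eq_two]
  refine ⟨(p, q), (p', q'), fun he => hne ?_, ?_⟩
  · obtain ⟨rfl, rfl⟩ := Prod.mk.inj he
    exact ⟨rfl, rfl⟩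
  · ext ⟨x, y⟩
    rw [← uncovAt_coe, h]
    simp [Prod.ext_iff, Fin.ext_iff]

theorem ncard_uncov_eq_one {i j : ℤ} (h : ∀ x y, UncovAt I w x y ↔ x = i ∧ y = j) :
    (Uncov I w).ncard = 1 := by
  obtain ⟨p, q, rfl, rfl, h1⟩ := (h i j).2 ⟨rfl, rfl⟩
  rw [Set.ncard_eq_one]
  refine ⟨(p, q), ?_⟩
  ext ⟨x, y⟩
  rw [← uncovAt_coe, h]
  simp [Prod.ext_iff, Fin.ext_iff]

theorem MatchingOn.clearAt_subset_closure_single (M : MatchingOn I op s par) {x : ℤ}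
    (hx : op x) {p q : Fin n} (hp : (p : ℤ) = x) (hq : (q : ℤ) = s x) :
    clearAt I {(p, q)} ⊆ closure (orb I (rookMat (rookOf I s (Equiv.swap (par x) x)))) := by
  have hU := fun i j => M.uncovAt_single (i := i) (j := j) hx (by omega) (by omega)
  refine M.isRook_rookOf.clearAt_subset_closure ?_ fun w' hw' hS hc => ?_
  · rintro _ rfl
    exact uncovAt_coe.1 ((hU _ _).2 ⟨hp, hq⟩)
  · refine (rook_eq_of_uncov_subset M.isRook_rookOf hw' ?_ hc).symm
    refine uncov_subset_of_uncovAt fun i j hij => ?_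
    obtain ⟨rfl, rfl⟩ := (hU i j).1 hij
    exact ⟨p, q, hp, hq, hS rfl⟩

end UncovAt

theorem PairMatching.isAttached_single_iff (M : PairMatching k l lam op s par) {x : ℤ}
    (hx : op x) (h0 : 0 ≤ x) (hn : s x < (k + l : ℕ)) (hf : IsFlip lam mu (x - k) (s x - k))
    {P : Set (Matrix (Fin (k + l)) (Fin (k + l)) ℂ)} :
    IsAttached k l lam mu P ↔
      P = orb (fixedIdx k l lam)
        (rookMat (rookOf (fixedIdx k l lam) s (Equiv.swap (par x) x))) := by
  have hlt := M.lt x hx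
  have hU := fun i j => M.uncovAt_single (i := i) (j := j) hx h0 hn
  obtain ⟨p, q, hp, hq, hpq⟩ := (hU _ _).2 ⟨rfl, rfl⟩
  refine Noncrossing.isAttached_iff ⟨hpq.1, hpq.1, Or.inl ⟨rfl, rfl⟩⟩ (fun r => ?_)
    M.isRook_rookOf hpq hpq fun w' hw' hS _ hc => ?_
  · rw [hf.mem_fixedIdx, ← hq, ← hp]
    simp [Fin.ext_iff]
  · refine (rook_eq_of_uncov_subset M.isRook_rookOf hw' ?_ hc).symm
    refine uncov_subset_of_uncovAt fun i j hij => ?_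
    obtain ⟨rfl, rfl⟩ := (hU i j).1 hij
    exact ⟨p, q, hp, hq, hS⟩

end GrassConormal

namespace GrassConormal

open Matrix Filter Topology

/-! ### Orbits of codimension two and diamonds -/

variable {k l : ℕ} {lam lam' mu : YoungDiagram} {op : ℤ → Prop} {s par : ℤ → ℤ}
  {w : Fin (k + l) → Fin (k + l) → Prop} {a b : ℤ}

/-- The relation between the top `λ'` of a diamond given by two pairs of which none is the parent
of the other, and the rook placement of its orbit. -/
structure IsSeparateTop (k l : ℕ) (lam lam' : YoungDiagram) (s par : ℤ → ℤ)
    (a b : ℤ) (w : Fin (k + l) → Fin (k + l) → Prop) : Prop where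
  lt : a < b
  ne_par : a ≠ par b
  nonneg_left : 0 ≤ a
  lt_left : s a < (k + l : ℕ)
  nonneg_right : 0 ≤ b
  lt_right : s b < (k + l : ℕ)
  isDoubleFlip : IsDoubleFlip lam lam' (a - k) (s a - k) (b - k) (s b - k)
  uncovAt_iff : ∀ i j, UncovAt (fixedIdx k l lam) w i j ↔ (i = a ∧ j = s a) ∨ (i = b ∧ j = s b)

/-- The relation between one of the two tops of diamonds given by a pair and its parent, and the
rook placement of its orbit. -/
structure IsLowerTop (k l : ℕ) (lam lam' : YoungDiagram) (s par : ℤ → ℤ)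
    (a b : ℤ) (w : Fin (k + l) → Fin (k + l) → Prop) : Prop where
  par_eq : par b = a
  nonneg : 0 ≤ a
  lt : s b < (k + l : ℕ)
  isFlip : IsFlip lam lam' (a - k) (s b - k)
  uncovAt_iff : ∀ i j, UncovAt (fixedIdx k l lam) w i j ↔ (i = b ∧ j = s b) ∨ (i = a ∧ j = s b)

/-- The relation between the other top of diamonds given by a pair and its parent, and the rook
placement of its orbit. -/
structure IsUpperTop (k l : ℕ) (lam lam' : YoungDiagram) (s par : ℤ → ℤ)
    (a b : ℤ) (w : Fin (k + l) → Fin (k + l) → Prop) : Prop where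
  par_eq : par b = a
  nonneg : 0 ≤ b
  lt : s a < (k + l : ℕ)
  isFlip : IsFlip lam lam' (b - k) (s a - k)
  uncovAt_iff : ∀ i j, UncovAt (fixedIdx k l lam) w i j ↔ (i = b ∧ j = s b) ∨ (i = b ∧ j = s a)

/-- `λ'` is the top of the diamonds given by the pairs of `a` and `b`, and `w` is the rook placement
of its orbit. -/
structure IsTopRook (k l : ℕ) (lam lam' : YoungDiagram) (op : ℤ → Prop) (s par : ℤ → ℤ)
    (a b : ℤ) (w : Fin (k + l) → Fin (k + l) → Prop) : Prop where
  isRook : IsRook (fixedIdx k l lam) w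
  op_left : op a
  op_right : op b
  cases : IsSeparateTop k l lam lam' s par a b w ∨ IsLowerTop k l lam lam' s par a b w ∨
    IsUpperTop k l lam lam' s par a b w

theorem IsTopRook.lt (h : IsTopRook k l lam lam' op s par a b w)
    (M : PairMatching k l lam op s par) : a < b := by
  have := M.par_lt b h.op_right
  rcases h.cases with h | h | h
  · exact h.lt
  · rw [← h.par_eq]
    exact this
  · rw [← h.par_eq]
    exact this

/-- The pair of `b` is always in the range, while a parent `a` may stick out on one side. Hence one
of the two middle partitions is automatically in `Omega`. -/
theorem IsTopRook.range_right (h : IsTopRook k l lam lam' op s par a b w)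
    (M : PairMatching k l lam op s par) : 0 ≤ b ∧ s b < (k + l : ℕ) := by
  have h1 := h.lt M
  have h2 := M.lt_par b h.op_right
  rcases h.cases with h | h | h
  · exact ⟨h.nonneg_right, h.lt_right⟩
  · exact ⟨h.nonneg.trans h1.le, h.lt⟩
  · rw [h.par_eq] at h2
    exact ⟨h.nonneg, h2.trans h.lt⟩

theorem IsTopRook.mem_Omega (h : IsTopRook k l lam lam' op s par a b w)
    (M : PairMatching k l lam op s par) : lam' ∈ Omega k l := by
  have h1 := h.lt M
  have h2 := M.lt_par b h.op_right
  have h3 := M.lt a h.op_left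
  have h4 := M.lt b h.op_right
  rcases h.cases with h | h | h
  · exact h.isDoubleFlip.mem_Omega M.mem_Omega h3 h4 h.nonneg_left h.lt_left h.nonneg_right
      h.lt_right
  · exact h.isFlip.mem_Omega M.mem_Omega (by omega) h.nonneg h.lt
  · rw [h.par_eq] at h2
    exact h.isFlip.mem_Omega M.mem_Omega (by omega) h.nonneg h.lt

theorem IsTopRook.isTop (h : IsTopRook k l lam lam' op s par a b w)
    (M : PairMatching k l lam op s par) :
    IsTop lam lam' (a - k) (s a - k) (b - k) (s b - k) := by
  have hlt := h.lt M
  have ha := h.op_left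
  have hb := h.op_right
  have h1 : ¬ IsChild lam (a - k) (s a - k) (b - k) (s b - k) := fun hc => by
    have := hc.2.2.1
    omega
  rcases h.cases with h | h | h
  · refine Or.inl ⟨h1, ?_, h.isDoubleFlip⟩
    rw [M.isChild_iff _ _ hb ha]
    exact h.ne_par.symm
  · exact Or.inr ⟨Or.inr ((M.isChild_iff _ _ hb ha).2 h.par_eq), Or.inr h.isFlip⟩
  · exact Or.inr ⟨Or.inr ((M.isChild_iff _ _ hb ha).2 h.par_eq), Or.inl h.isFlip⟩

theorem IsTopRook.isUpDiamond (h : IsTopRook k l lam lam' op s par a b w)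
    (M : PairMatching k l lam op s par) {lam1 lam2 : YoungDiagram}
    (h1 : IsFlip lam lam1 (a - k) (s a - k)) (h2 : IsFlip lam lam2 (b - k) (s b - k)) :
    IsUpDiamond lam lam1 lam' lam2 := by
  have := h.lt M
  exact isUpDiamond_of_isTop (M.isPair h.op_left) (M.isPair h.op_right) (by omega) h1 h2
    (h.isTop M)

/-- The set of uncovered positions remembers both pairs and which of the three types occurs. This
yields the injectivity of the map and the uniqueness of the diamond. -/
theorem IsTopRook.unique {lam'' : YoungDiagram} {a' b' : ℤ}
    (h : IsTopRook k l lam lam' op s par a b w) (h' : IsTopRook k l lam lam'' op s par a' b' w)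
    (M : PairMatching k l lam op s par) : a = a' ∧ b = b' ∧ lam' = lam'' := by
  have hab := h.lt M
  have hab' := h'.lt M
  have hs := fun x y (h : s x = s y) => (M.invol x).symm.trans ((congrArg s h).trans (M.invol y))
  have key : a = a' ∧ b = b' := by
    rcases h.cases with g | g | g <;> rcases h'.cases with g' | g' | g' <;>
    · have e1 := (g.uncovAt_iff _ _).1 ((g'.uncovAt_iff _ _).2 (Or.inl ⟨rfl, rfl⟩))
      have e2 := (g.uncovAt_iff _ _).1 ((g'.uncovAt_iff _ _).2 (Or.inr ⟨rfl, rfl⟩))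
      have e3 := (g'.uncovAt_iff _ _).1 ((g.uncovAt_iff _ _).2 (Or.inl ⟨rfl, rfl⟩))
      have e4 := (g'.uncovAt_iff _ _).1 ((g.uncovAt_iff _ _).2 (Or.inr ⟨rfl, rfl⟩))
      clear g g' h h'
      grind
  obtain ⟨rfl, rfl⟩ := key
  refine ⟨rfl, rfl, ?_⟩
  rcases h.cases with g | g | g <;> rcases h'.cases with g' | g' | g'
  · exact g.isDoubleFlip.unique g'.isDoubleFlip
  · exact absurd g'.par_eq.symm g.ne_par
  · exact absurd g'.par_eq.symm g.ne_par
  · exact absurd g.par_eq.symm g'.ne_par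
  · exact g.isFlip.unique g'.isFlip
  · rcases (g.uncovAt_iff _ _).1 ((g'.uncovAt_iff _ _).2 (Or.inr ⟨rfl, rfl⟩)) with e | e
    · exact absurd (hs _ _ e.2) hab.ne
    · exact absurd e.1 hab.ne'
  · exact absurd g.par_eq.symm g'.ne_par
  · rcases (g.uncovAt_iff _ _).1 ((g'.uncovAt_iff _ _).2 (Or.inr ⟨rfl, rfl⟩)) with e | e
    · exact absurd e.1 hab.ne
    · exact absurd e.1 hab.ne
  · exact g.isFlip.unique g'.isFlip

theorem IsTopRook.ncard_uncov (h : IsTopRook k l lam lam' op s par a b w)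
    (M : PairMatching k l lam op s par) : (Uncov (fixedIdx k l lam) w).ncard = 2 := by
  have hab := h.lt M
  rcases h.cases with h | h | h
  · exact ncard_uncov_eq_two h.uncovAt_iff fun e => hab.ne e.1
  · exact ncard_uncov_eq_two h.uncovAt_iff fun e => hab.ne' e.1
  · exact ncard_uncov_eq_two h.uncovAt_iff fun e => M.s_ne hab.ne' e.2

theorem IsSeparateTop.eq_rookOf (h : IsSeparateTop k l lam lam' s par a b w)
    (M : PairMatching k l lam op s par) (hw : IsRook (fixedIdx k l lam) w) (ha : op a)
    (hb : op b) :
    w = rookOf (fixedIdx k l lam) s (Equiv.swap (par b) b * Equiv.swap (par a) a) :=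
  rook_eq_of_uncov hw M.isRook_rookOf <| uncov_eq_of_uncovAt fun i j => (h.uncovAt_iff i j).trans
    (M.uncovAt_double ha hb h.lt h.ne_par h.nonneg_left h.lt_left h.nonneg_right h.lt_right).symm

theorem IsLowerTop.eq_rookOf (h : IsLowerTop k l lam lam' s par a b w)
    (M : PairMatching k l lam op s par) (hw : IsRook (fixedIdx k l lam) w) (hb : op b) :
    w = rookOf (fixedIdx k l lam) s (Equiv.swap a b * Equiv.swap (par a) a) := by
  obtain ⟨rfl, h1, h2, h3, h4⟩ := h
  exact rook_eq_of_uncov hw M.isRook_rookOf <| uncov_eq_of_uncovAt fun i j => (h4 i j).trans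
    (M.uncovAt_lower hb h1 h2).symm

theorem IsUpperTop.eq_rookOf (h : IsUpperTop k l lam lam' s par a b w)
    (M : PairMatching k l lam op s par) (hw : IsRook (fixedIdx k l lam) w) (hb : op b) :
    w = rookOf (fixedIdx k l lam) s (Equiv.swap (par a) a * Equiv.swap a b) := by
  obtain ⟨rfl, h1, h2, h3, h4⟩ := h
  exact rook_eq_of_uncov hw M.isRook_rookOf <| uncov_eq_of_uncovAt fun i j => (h4 i j).trans
    (M.uncovAt_upper hb h1 h2).symm

theorem IsTopRook.fillsExcept (h : IsTopRook k l lam lam' op s par a b w)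
    (M : PairMatching k l lam op s par) : FillsExcept (fixedIdx k l lam) op s a b w := by
  have ha := h.op_left
  have hb := h.op_right
  have hab := h.lt M
  rcases h.cases with g | g | g
  · rw [g.eq_rookOf M h.isRook ha hb]
    exact M.fillsExcept (M.isShift_double ha hb hab) fun x hx h1 h2 =>
      M.preservesInterval_mul ha hb hx h1 h2
  · rw [g.eq_rookOf M h.isRook hb]
    obtain ⟨rfl, -⟩ := g
    exact M.fillsExcept (M.isShift_double ha hb hab) fun x hx h1 h2 =>
      M.preservesInterval_mul ha hb hx h1 h2
  · rw [g.eq_rookOf M h.isRook hb]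
    obtain ⟨rfl, -⟩ := g
    exact M.fillsExcept (M.isShift_upper hb) fun x hx h1 h2 =>
      M.preservesInterval_mul hb ha hx h2 h1

/-- For a parent and a child the open orbit of the slice has a single rook, the mixed position. That
this position is uncovered forces (b, s b) to be uncovered as well, by comparison of counts inside
the pair of `b`. -/
theorem IsTopRook.isAttached_iff (h : IsTopRook k l lam lam' op s par a b w)
    (M : PairMatching k l lam op s par) {O : Set (Matrix (Fin (k + l)) (Fin (k + l)) ℂ)} :
    IsAttached k l lam lam' O ↔ O = orb (fixedIdx k l lam) (rookMat w) := by
  have ha := h.op_left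
  have hb := h.op_right
  have hab := h.lt M
  have hF := h.fillsExcept M
  have hw := h.isRook
  rcases h.cases with g | g | g
  · obtain ⟨p, q, hp, hq, hpq⟩ := (g.uncovAt_iff _ _).2 (Or.inl ⟨rfl, rfl⟩)
    obtain ⟨p', q', hp', hq', hpq'⟩ := (g.uncovAt_iff _ _).2 (Or.inr ⟨rfl, rfl⟩)
    have hn := M.nested a b ha hb hab
    refine Noncrossing.isAttached_iff ⟨hpq.1, hpq'.1, Or.inr ?_⟩ (fun r => ?_) hw hpq hpq'
      fun w' hw' h1 h2 hc => ?_
    · simp only [Fin.lt_def]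
      omega
    · rw [g.isDoubleFlip.mem_fixedIdx, ← hq, ← hq', ← hp, ← hp']
      simp [Fin.ext_iff]
    · refine (rook_eq_of_uncov_subset hw hw' ?_ hc).symm
      refine uncov_subset_of_uncovAt fun i j hij => ?_
      rcases (g.uncovAt_iff i j).1 hij with ⟨rfl, rfl⟩ | ⟨rfl, rfl⟩
      · exact ⟨p, q, hp, hq, h1⟩
      · exact ⟨p', q', hp', hq', h2⟩
  · obtain ⟨p', q', hp', hq', hpq'⟩ := (g.uncovAt_iff _ _).2 (Or.inl ⟨rfl, rfl⟩)
    obtain ⟨p, q, hp, hq, hpq⟩ := (g.uncovAt_iff _ _).2 (Or.inr ⟨rfl, rfl⟩)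
    obtain rfl : q = q' := Fin.ext (by omega)
    refine Noncrossing.isAttached_iff ⟨hpq.1, hpq.1, Or.inl ⟨rfl, rfl⟩⟩ (fun r => ?_) hw hpq hpq
      fun w' hw' h1 _ hc => ?_
    · rw [g.isFlip.mem_fixedIdx, ← hq, ← hp]
      simp [Fin.ext_iff]
    · have h2 := M.uncov_of_above hF hw' hc hp' hq' hb hab hp h1
      refine (rook_eq_of_uncov_subset hw hw' ?_ hc).symm
      refine uncov_subset_of_uncovAt fun i j hij => ?_
      rcases (g.uncovAt_iff i j).1 hij with ⟨rfl, rfl⟩ | ⟨rfl, rfl⟩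
      · exact ⟨p', q, hp', hq', h2⟩
      · exact ⟨p, q, hp, hq, h1⟩
  · obtain ⟨p', q', hp', hq', hpq'⟩ := (g.uncovAt_iff _ _).2 (Or.inl ⟨rfl, rfl⟩)
    obtain ⟨p, q, hp, hq, hpq⟩ := (g.uncovAt_iff _ _).2 (Or.inr ⟨rfl, rfl⟩)
    obtain rfl : p = p' := Fin.ext (by omega)
    have hlt := M.lt_par b hb
    rw [g.par_eq] at hlt
    refine Noncrossing.isAttached_iff ⟨hpq.1, hpq.1, Or.inl ⟨rfl, rfl⟩⟩ (fun r => ?_) hw hpq hpq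
      fun w' hw' h1 _ hc => ?_
    · rw [g.isFlip.mem_fixedIdx, ← hq, ← hp]
      simp [Fin.ext_iff]
    · have hle : q' ≤ q := Fin.le_def.2 (by omega)
      have h2 := M.uncov_of_right hF hw' hc hp' hq' hb hab hle h1
      refine (rook_eq_of_uncov_subset hw hw' ?_ hc).symm
      refine uncov_subset_of_uncovAt fun i j hij => ?_
      rcases (g.uncovAt_iff i j).1 hij with ⟨rfl, rfl⟩ | ⟨rfl, rfl⟩
      · exact ⟨p, q', hp', hq', h2⟩
      · exact ⟨p, q, hp, hq, h1⟩

/-! ### Closure relations between orbits of codimension one and two -/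

theorem MatchingOn.rookMat_mem_closure_single {n : ℕ} {I : Set (Fin n)}
    {w : Fin n → Fin n → Prop} (M : MatchingOn I op s par) (hw : IsRook I w) {x : ℤ}
    (hx : op x) (h : UncovAt I w x (s x)) :
    rookMat w ∈ closure (orb I (rookMat (rookOf I s (Equiv.swap (par x) x)))) := by
  obtain ⟨p, q, hp, hq, hpq⟩ := h
  exact M.clearAt_subset_closure_single hx hp hq
    (hw.rookMat_mem_clearAt (Set.singleton_subset_iff.2 hpq))

/-- The position (a, s a) is covered from below by the rook (b, s a), which a column operation from
(b, s b) can clear. -/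
theorem IsLowerTop.mem_closure (g : IsLowerTop k l lam lam' s par a b w)
    (M : PairMatching k l lam op s par) (hw : IsRook (fixedIdx k l lam) w) (ha : op a)
    (hb : op b) (hn : s a < (k + l : ℕ)) :
    rookMat w ∈ closure (orb (fixedIdx k l lam)
      (rookMat (rookOf (fixedIdx k l lam) s (Equiv.swap (par a) a)))) := by
  have hlt := M.par_lt b hb
  have hlt' := M.lt_par b hb
  have hpa := M.par_lt a ha
  have hpa' := M.lt_par a ha
  have hw' := g.eq_rookOf M hw hb
  have hsh : IsShift op s (Equiv.swap a b * Equiv.swap (par a) a) := by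
    have := M.isShift_double ha hb (by rw [← g.par_eq]; exact hlt)
    rwa [g.par_eq] at this
  rw [g.par_eq] at hlt hlt'
  obtain ⟨p', q', hp', hq', hpq'⟩ := (g.uncovAt_iff _ _).2 (Or.inl ⟨rfl, rfl⟩)
  obtain ⟨p, q, hp, hq, hpq⟩ := (g.uncovAt_iff _ _).2 (Or.inr ⟨rfl, rfl⟩)
  obtain rfl : q = q' := Fin.ext (by omega)
  have hπb : (Equiv.swap a b * Equiv.swap (par a) a) b = a := by
    rw [Equiv.Perm.mul_apply, Equiv.swap_apply_of_ne_of_ne (a := par a) (by omega) (by omega),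
      Equiv.swap_apply_right]
  have hπa : (Equiv.swap a b * Equiv.swap (par a) a) a = par a := by
    rw [Equiv.Perm.mul_apply, Equiv.swap_apply_right,
      Equiv.swap_apply_of_ne_of_ne (by omega) (by omega)]
  obtain ⟨d, hd, hwd⟩ := M.rookOf_of_lt hsh (p := p') hpq'.1.1 (by rw [hp', hπb]; exact hn)
  rw [hp', hπb] at hd
  refine hw.mem_of_col isClosed_closure (fun x hx y hxy => mem_closure_orb_of_rel hx hxy)
    (M.clearAt_subset_closure_single ha hp hd) (b := p') (c := q) (Fin.lt_def.2 (by omega))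
    (Fin.lt_def.2 (by omega)) hpq'.1 (fun r hr hwr => ?_) (by rw [hw']; exact hwd) hpq.2.2
  rw [hw'] at hwr
  have := hwr.2
  rw [hp, hπa] at this
  have := Fin.le_def.1 hr
  omega

/-- Here (a, s a) is covered from the left by the rook (a, s b), which a row operation from (b, s b)
can clear. -/
theorem IsUpperTop.mem_closure (g : IsUpperTop k l lam lam' s par a b w)
    (M : PairMatching k l lam op s par) (hw : IsRook (fixedIdx k l lam) w) (ha : op a)
    (hb : op b) (h0 : 0 ≤ a) :
    rookMat w ∈ closure (orb (fixedIdx k l lam)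
      (rookMat (rookOf (fixedIdx k l lam) s (Equiv.swap (par a) a)))) := by
  have hlt := M.par_lt b hb
  have hlt' := M.lt_par b hb
  have hpa := M.par_lt a ha
  have hpa' := M.lt_par a ha
  have hbs := M.lt b hb
  have hn := g.lt
  have hw' := g.eq_rookOf M hw hb
  have hsh : IsShift op s (Equiv.swap (par a) a * Equiv.swap a b) := by
    have := M.isShift_upper hb
    rwa [g.par_eq] at this
  rw [g.par_eq] at hlt hlt'
  obtain ⟨p', q', hp', hq', hpq'⟩ := (g.uncovAt_iff _ _).2 (Or.inl ⟨rfl, rfl⟩)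
  obtain ⟨p, q, hp, hq, hpq⟩ := (g.uncovAt_iff _ _).2 (Or.inr ⟨rfl, rfl⟩)
  obtain rfl : p = p' := Fin.ext (by omega)
  obtain ⟨pa, hpa0⟩ := exists_fin (n := k + l) h0 (by omega)
  have hπa : (Equiv.swap (par a) a * Equiv.swap a b) a = b := by
    rw [Equiv.Perm.mul_apply, Equiv.swap_apply_left,
      Equiv.swap_apply_of_ne_of_ne (by omega) (by omega)]
  have hπpar : (Equiv.swap (par a) a * Equiv.swap a b) (par a) = a := by
    rw [Equiv.Perm.mul_apply, Equiv.swap_apply_of_ne_of_ne (a := a) (by omega) (by omega),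
      Equiv.swap_apply_left]
  obtain ⟨c, hc, hwc⟩ := M.rookOf_of_lt hsh (p := pa) ((M.mem_iff _).2 (by rwa [hpa0]))
    (by rw [hpa0, hπa]; omega)
  rw [hpa0, hπa] at hc
  obtain rfl : c = q' := Fin.ext (by omega)
  refine hw.mem_of_row isClosed_closure (fun x hx y hxy => mem_closure_orb_of_rel hx hxy)
    (M.clearAt_subset_closure_single ha hpa0 hq) (b := p) (c := c) (Fin.lt_def.2 (by omega))
    (Fin.lt_def.2 (by omega)) hpq'.1 (fun r hr hwr => ?_) (by rw [hw']; exact hwc) hpq.2.1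
  rw [hw'] at hwr
  have h1 := hwr.2
  rw [hq] at h1
  have h2 : (Equiv.swap (par a) a * Equiv.swap a b) r = a := by
    by_contra hne
    exact M.s_ne hne h1
  have h3 : (r : ℤ) = par a := (Equiv.swap (par a) a * Equiv.swap a b).injective (h2.trans hπpar.symm)
  have := Fin.le_def.1 hr
  omega

theorem IsTopRook.mem_closure (h : IsTopRook k l lam lam' op s par a b w)
    (M : PairMatching k l lam op s par) {x : ℤ} (hx : x = a ∨ x = b) (h0 : 0 ≤ x)
    (hn : s x < (k + l : ℕ)) :
    rookMat w ∈ closure (orb (fixedIdx k l lam)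
      (rookMat (rookOf (fixedIdx k l lam) s (Equiv.swap (par x) x)))) := by
  have ha := h.op_left
  have hb := h.op_right
  have hw := h.isRook
  rcases hx with rfl | rfl
  · rcases h.cases with g | g | g
    · exact M.rookMat_mem_closure_single hw ha ((g.uncovAt_iff _ _).2 (Or.inl ⟨rfl, rfl⟩))
    · exact g.mem_closure M hw ha hb hn
    · exact g.mem_closure M hw ha hb h0
  · refine M.rookMat_mem_closure_single hw hb ?_
    rcases h.cases with g | g | g
    · exact (g.uncovAt_iff _ _).2 (Or.inr ⟨rfl, rfl⟩)
    · exact (g.uncovAt_iff _ _).2 (Or.inl ⟨rfl, rfl⟩)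
    · exact (g.uncovAt_iff _ _).2 (Or.inl ⟨rfl, rfl⟩)

/-! ### Correspondence between diamonds and orbits of codimension two -/

theorem PairMatching.exists_isTopRook_of_ncard (M : PairMatching k l lam op s par)
    (hw : IsRook (fixedIdx k l lam) w) (h : (Uncov (fixedIdx k l lam) w).ncard = 2) :
    ∃ a b lam', IsTopRook k l lam lam' op s par a b w := by
  obtain ⟨x, y, hxy, hU⟩ := Set.ncard_eq_two.1 h
  obtain ⟨a, b, ha, hb, hc⟩ := M.classify_two hw hxy hU
  have h1 := M.par_lt b hb
  have h2 := M.lt_par b hb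
  have h3 := M.lt b hb
  rcases hc with ⟨g1, g2, g3, g4, g5, g6, g7⟩ | ⟨g1, g2, g3, g4⟩ | ⟨g1, g2, g3, g4⟩
  · obtain ⟨lam', hf⟩ := M.exists_isDoubleFlip ha hb g1.ne
    exact ⟨a, b, lam', hw, ha, hb, Or.inl ⟨g1, g2, g3, g4, g5, g6, hf, g7⟩⟩
  · obtain ⟨lam', hf⟩ := exists_isFlip lam (a - k) (s b - k) (by omega) ((M.op_iff a).1 ha)
      (M.phi_s hb)
    exact ⟨a, b, lam', hw, ha, hb, Or.inr (Or.inl ⟨g1, g2, g3, hf, g4⟩)⟩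
  · rw [g1] at h2
    obtain ⟨lam', hf⟩ := exists_isFlip lam (b - k) (s a - k) (by omega) ((M.op_iff b).1 hb)
      (M.phi_s ha)
    exact ⟨a, b, lam', hw, ha, hb, Or.inr (Or.inr ⟨g1, g2, g3, hf, g4⟩)⟩

theorem PairMatching.exists_isTopRook_of_isTop (M : PairMatching k l lam op s par)
    (hlam' : lam' ∈ Omega k l) (ha : op a) (hb : op b) (hab : a < b)
    (h : IsTop lam lam' (a - k) (s a - k) (b - k) (s b - k)) :
    ∃ w, IsTopRook k l lam lam' op s par a b w := by
  rcases h with ⟨-, h2, hf⟩ | ⟨hc, hf⟩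
  · rw [M.isChild_iff _ _ hb ha] at h2
    have h3 := nonneg_of_phi_eq_one hlam' hf.1
    have h4 := lt_of_phi_eq_neg_one hlam' hf.2.1
    have h5 := nonneg_of_phi_eq_one hlam' hf.2.2.1
    have h6 := lt_of_phi_eq_neg_one hlam' hf.2.2.2.1
    exact ⟨_, M.isRook_rookOf, ha, hb, Or.inl ⟨hab, Ne.symm h2, h3, h4, h5, h6, hf,
      fun i j => M.uncovAt_double ha hb hab (Ne.symm h2) h3 h4 h5 h6⟩⟩
  · have hpar : par b = a := by
      rcases hc with hc | hc
      · have := hc.2.2.1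
        omega
      · exact (M.isChild_iff _ _ hb ha).1 hc
    subst hpar
    rcases hf with hf | hf
    · have h3 := nonneg_of_phi_eq_one hlam' hf.1
      have h4 := lt_of_phi_eq_neg_one hlam' hf.2.1
      exact ⟨_, M.isRook_rookOf, ha, hb, Or.inr (Or.inr ⟨rfl, h3, h4, hf,
        fun i j => M.uncovAt_upper hb h3 h4⟩)⟩
    · have h3 := nonneg_of_phi_eq_one hlam' hf.1
      have h4 := lt_of_phi_eq_neg_one hlam' hf.2.1
      exact ⟨_, M.isRook_rookOf, ha, hb, Or.inr (Or.inl ⟨rfl, h3, h4, hf,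
        fun i j => M.uncovAt_lower hb h3 h4⟩)⟩

theorem PairMatching.exists_isTopRook (M : PairMatching k l lam op s par)
    {lam1 lam2 : YoungDiagram} (h : IsUpDiamond lam lam1 lam' lam2) (hlam' : lam' ∈ Omega k l) :
    ∃ a b w, IsTopRook k l lam lam' op s par a b w ∧
      ((IsFlip lam lam1 (a - k) (s a - k) ∧ IsFlip lam lam2 (b - k) (s b - k)) ∨
        (IsFlip lam lam2 (a - k) (s a - k) ∧ IsFlip lam lam1 (b - k) (s b - k))) := by
  obtain ⟨a1, b1, a2, b2, hp1, hp2, hne, hf1, hf2, ht⟩ := h.exists_isTop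
  obtain ⟨a, rfl⟩ : ∃ a, a1 = a - k := ⟨a1 + k, by omega⟩
  obtain ⟨c, rfl⟩ : ∃ a, b1 = a - k := ⟨b1 + k, by omega⟩
  obtain ⟨b, rfl⟩ : ∃ a, a2 = a - k := ⟨a2 + k, by omega⟩
  obtain ⟨d, rfl⟩ : ∃ a, b2 = a - k := ⟨b2 + k, by omega⟩
  obtain ⟨ha, rfl⟩ := (M.isPair_iff _ _).1 hp1
  obtain ⟨hb, rfl⟩ := (M.isPair_iff _ _).1 hp2
  rcases lt_or_gt_of_ne hne with hlt | hlt
  · obtain ⟨w, hw⟩ := M.exists_isTopRook_of_isTop hlam' ha hb (by omega) ht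
    exact ⟨a, b, w, hw, Or.inl ⟨hf1, hf2⟩⟩
  · obtain ⟨w, hw⟩ := M.exists_isTopRook_of_isTop hlam' hb ha (by omega) ht.symm
    exact ⟨b, a, w, hw, Or.inr ⟨hf2, hf1⟩⟩

theorem IsRook.eq_of_orb_eq {n : ℕ} {I : Set (Fin n)} {w w' : Fin n → Fin n → Prop}
    (hw : IsRook I w) (hw' : IsRook I w') (h : orb I (rookMat w) = orb I (rookMat w')) : w = w' :=
  hw.eq_of_closure_orb_eq hw' (by rw [h])

theorem PairMatching.exists_isFlip (M : PairMatching k l lam op s par) (ha : op a) :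
    ∃ mu, IsFlip lam mu (a - k) (s a - k) := by
  have := M.lt a ha
  exact GrassConormal.exists_isFlip lam _ _ (by omega) ((M.op_iff a).1 ha) (M.phi_s ha)

theorem PairMatching.eq_single_of_ncard (M : PairMatching k l lam op s par)
    (hw : IsRook (fixedIdx k l lam) w) (h : (Uncov (fixedIdx k l lam) w).ncard = 1) :
    ∃ x, op x ∧ 0 ≤ x ∧ s x < (k + l : ℕ) ∧
      w = rookOf (fixedIdx k l lam) s (Equiv.swap (par x) x) := by
  obtain ⟨⟨p, q⟩, hU⟩ := Set.ncard_eq_one.1 h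
  obtain ⟨x, hx, h0, hn, -, hu, -⟩ := M.exists_first hw
    ⟨p, q, uncovAt_coe.2 (by rw [hU]; rfl)⟩
  refine ⟨x, hx, h0, hn, rook_eq_of_uncov hw M.isRook_rookOf (uncov_eq_of_uncovAt fun i j => ?_)⟩
  rw [M.uncovAt_single hx h0 hn]
  have huniq : ∀ i j, UncovAt (fixedIdx k l lam) w i j → i = p ∧ j = q := by
    rintro _ _ ⟨p', q', rfl, rfl, h'⟩
    rw [hU] at h'
    obtain ⟨rfl, rfl⟩ := Prod.mk.inj (Set.mem_singleton_iff.1 h')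
    exact ⟨rfl, rfl⟩
  obtain ⟨e1, e2⟩ := huniq _ _ hu
  constructor
  · intro hij
    obtain ⟨e3, e4⟩ := huniq _ _ hij
    exact ⟨e3.trans e1.symm, e4.trans e2.symm⟩
  · rintro ⟨rfl, rfl⟩
    exact hu

/-- If `x` differs from `a` and `b`, then `w` fills the interval of `x`, whereas the codimension one
placement leaves (x, s x) uncovered and has a smaller count there. Closures cannot increase counts.
-/
theorem IsTopRook.eq_or_eq_of_mem_closure (h : IsTopRook k l lam lam' op s par a b w)
    (M : PairMatching k l lam op s par) {x : ℤ} (hx : op x) (h0 : 0 ≤ x)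
    (hn : s x < (k + l : ℕ))
    (hcl : rookMat w ∈ closure (orb (fixedIdx k l lam)
      (rookMat (rookOf (fixedIdx k l lam) s (Equiv.swap (par x) x))))) : x = a ∨ x = b := by
  by_contra! hne
  obtain ⟨p, q, hp, hq, hpq⟩ := (M.uncovAt_single hx h0 hn).2 ⟨rfl, rfl⟩
  have h1 := (h.fillsExcept M p q (by rwa [hp]) (by rw [hp, hq]) (by rw [hp]; exact hne.1)
    (by rw [hp]; exact hne.2)).1
  have h2 := opens_le_count h1
  have h3 := h.isRook.count_le_of_mem_closure M.isRook_rookOf hcl p (q + 1)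
  have h4 := count_lt_opens_of_mem_uncov M.isRook_rookOf hpq
  omega

theorem IsTopRook.codim_one_iff (h : IsTopRook k l lam lam' op s par a b w)
    (M : PairMatching k l lam op s par) {lam1 lam2 : YoungDiagram}
    (hf1 : IsFlip lam lam1 (a - k) (s a - k)) (hf2 : IsFlip lam lam2 (b - k) (s b - k))
    {P : Set (Matrix (Fin (k + l)) (Fin (k + l)) ℂ)} :
    (IsCodimOrbit k l lam 1 P ∧ orb (fixedIdx k l lam) (rookMat w) ⊆ closure P) ↔
      ∃ mu, (mu = lam1 ∨ mu = lam2) ∧ mu ∈ Omega k l ∧ IsAttached k l lam mu P := by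
  constructor
  · rintro ⟨hP, hcl⟩
    obtain ⟨v, hv, rfl⟩ := isOrbit_iff_rook.1 hP.1
    obtain ⟨x, hx, h0, hn, rfl⟩ := M.eq_single_of_ncard hv ((isCodimOrbit_orb_iff hv).1 hP)
    have hlt := M.lt x hx
    rcases h.eq_or_eq_of_mem_closure M hx h0 hn (hcl (mem_orb_self _)) with rfl | rfl
    · exact ⟨lam1, Or.inl rfl, hf1.mem_Omega M.mem_Omega hlt h0 hn,
        (M.isAttached_single_iff hx h0 hn hf1).2 rfl⟩
    · exact ⟨lam2, Or.inr rfl, hf2.mem_Omega M.mem_Omega hlt h0 hn,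
        (M.isAttached_single_iff hx h0 hn hf2).2 rfl⟩
  · rintro ⟨mu, hmu, hO, hP⟩
    obtain ⟨x, hxab, hx, hf⟩ : ∃ x, (x = a ∨ x = b) ∧ op x ∧ IsFlip lam mu (x - k) (s x - k) := by
      rcases hmu with rfl | rfl
      · exact ⟨a, Or.inl rfl, h.op_left, hf1⟩
      · exact ⟨b, Or.inr rfl, h.op_right, hf2⟩
    have h0 := nonneg_of_phi_eq_one hO hf.1
    have hn := lt_of_phi_eq_neg_one hO hf.2.1
    rw [M.isAttached_single_iff hx h0 hn hf] at hP
    subst hP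
    refine ⟨(isCodimOrbit_orb_iff M.isRook_rookOf).2
      (ncard_uncov_eq_one fun i j => M.uncovAt_single hx h0 hn), fun y hy => ?_⟩
    exact mem_closure_orb_of_rel (h.mem_closure M hxab h0 hn) hy

end GrassConormal

/-! ### The proposition -/

theorem proposition2p6p2 (k l : ℕ) (lam : YoungDiagram)
    (hlam : lam ∈ GrassConormal.Omega k l) :
    -- `λ' ↦ O_λ^{λ'}` is a map from the tops of diamonds to the codimension two orbits
    (∀ lam' ∈ GrassConormal.diamondTops k l lam,
      (∃! O, GrassConormal.IsAttached k l lam lam' O) ∧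
      ∀ O, GrassConormal.IsAttached k l lam lam' O → GrassConormal.IsCodimOrbit k l lam 2 O) ∧
    -- it is bijective
    (∀ O, GrassConormal.IsCodimOrbit k l lam 2 O →
      ∃! lam', lam' ∈ GrassConormal.diamondTops k l lam ∧
        GrassConormal.IsAttached k l lam lam' O) ∧
    -- given a diamond:
    (∀ lam1 lam' lam2, GrassConormal.IsUpDiamond lam lam1 lam' lam2 →
      lam' ∈ GrassConormal.Omega k l →
      (lam1 ∈ GrassConormal.Omega k l ∨ lam2 ∈ GrassConormal.Omega k l) →
      -- it is the only one for `λ'`, up to exchanging `λ₁` and `λ₂`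
      (∀ mu1 mu2, GrassConormal.IsUpDiamond lam mu1 lam' mu2 →
        (mu1 = lam1 ∧ mu2 = lam2) ∨ (mu1 = lam2 ∧ mu2 = lam1)) ∧
      -- `O_λ^{λ_m}` is defined if `λ_m` is in `Ω_{k,l}`
      (∀ mu, (mu = lam1 ∨ mu = lam2) → mu ∈ GrassConormal.Omega k l →
        ∃! P, GrassConormal.IsAttached k l lam mu P) ∧
      -- these are the codimension one orbits whose closures contain `O_λ^{λ'}`
      (∀ O, GrassConormal.IsAttached k l lam lam' O → ∀ P,
        (GrassConormal.IsCodimOrbit k l lam 1 P ∧ O ⊆ closure P) ↔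
          ∃ mu, (mu = lam1 ∨ mu = lam2) ∧ mu ∈ GrassConormal.Omega k l ∧
            GrassConormal.IsAttached k l lam mu P)) := by
  open GrassConormal in
  obtain ⟨op, s, par, M⟩ := exists_pairMatching hlam
  refine ⟨?_, ?_, ?_⟩
  · rintro lam' ⟨hlam', lam1, lam2, hd, -⟩
    obtain ⟨a, b, w, h, -⟩ := M.exists_isTopRook hd hlam'
    refine ⟨⟨_, (h.isAttached_iff M).2 rfl, fun O hO => (h.isAttached_iff M).1 hO⟩,
      fun O hO => ?_⟩
    rw [(h.isAttached_iff M).1 hO]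
    exact (isCodimOrbit_orb_iff h.isRook).2 (h.ncard_uncov M)
  · intro O hO
    obtain ⟨w, hw, rfl⟩ := isOrbit_iff_rook.1 hO.1
    obtain ⟨a, b, lam', h⟩ := M.exists_isTopRook_of_ncard hw ((isCodimOrbit_orb_iff hw).1 hO)
    obtain ⟨lam1, h1⟩ := M.exists_isFlip h.op_left
    obtain ⟨lam2, h2⟩ := M.exists_isFlip h.op_right
    obtain ⟨hb0, hbn⟩ := h.range_right M
    refine ⟨lam', ⟨⟨h.mem_Omega M, lam1, lam2, h.isUpDiamond M h1 h2,
      Or.inr (h2.mem_Omega hlam (M.lt b h.op_right) hb0 hbn)⟩, (h.isAttached_iff M).2 rfl⟩, ?_⟩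
    rintro lam'' ⟨⟨hlam'', mu1, mu2, hd, -⟩, hatt⟩
    obtain ⟨a', b', w', h', -⟩ := M.exists_isTopRook hd hlam''
    obtain rfl := hw.eq_of_orb_eq h'.isRook ((h'.isAttached_iff M).1 hatt)
    exact (h'.unique h M).2.2
  · intro lam1 lam' lam2 hd hlam' _
    obtain ⟨a, b, w, h, hf⟩ := M.exists_isTopRook hd hlam'
    refine ⟨fun mu1 mu2 hd' => ?_, fun mu hmu hO => ?_, fun O hO P => ?_⟩
    · obtain ⟨a', b', w', h', hf'⟩ := M.exists_isTopRook hd' hlam'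
      obtain rfl := h.isRook.eq_of_orb_eq h'.isRook
        ((h'.isAttached_iff M).1 ((h.isAttached_iff M).2 rfl))
      obtain ⟨rfl, rfl, -⟩ := h.unique h' M
      rcases hf with ⟨g1, g2⟩ | ⟨g1, g2⟩ <;> rcases hf' with ⟨g1', g2'⟩ | ⟨g1', g2'⟩
      · exact Or.inl ⟨g1'.unique g1, g2'.unique g2⟩
      · exact Or.inr ⟨g2'.unique g2, g1'.unique g1⟩
      · exact Or.inr ⟨g1'.unique g1, g2'.unique g2⟩
      · exact Or.inl ⟨g2'.unique g2, g1'.unique g1⟩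
    · obtain ⟨x, hx, hfx⟩ : ∃ x, op x ∧ IsFlip lam mu (x - k) (s x - k) := by
        rcases hf with ⟨g1, g2⟩ | ⟨g1, g2⟩ <;> rcases hmu with rfl | rfl
        · exact ⟨a, h.op_left, g1⟩
        · exact ⟨b, h.op_right, g2⟩
        · exact ⟨b, h.op_right, g2⟩
        · exact ⟨a, h.op_left, g1⟩
      have key := fun P => M.isAttached_single_iff (P := P) hx (nonneg_of_phi_eq_one hO hfx.1)
        (lt_of_phi_eq_neg_one hO hfx.2.1) hfx
      exact ⟨_, (key _).2 rfl, fun P hP => (key P).1 hP⟩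
    · rw [(h.isAttached_iff M).1 hO]
      rcases hf with ⟨g1, g2⟩ | ⟨g1, g2⟩
      · exact h.codim_one_iff M g1 g2
      · rw [h.codim_one_iff M g1 g2]
        simp only [or_comm]
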